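/- Let $M$ be a compact complex manifold of dimension $n$ with a Kähler form $\omega=\frac{\sqrt{-1}}{2\pi}\sum g_{i\bar j}\,dz_i\wedge d\bar z_j$ that represents $c_1(M)$ (so $c_1(M)>0$). Let $Ric(\omega)=-\frac{\sqrt{-1}}{2\pi}\partial\bar\partial\log\det(g_{i\bar j})$ be the Ricci form, and let $f_\omega$ be a smooth real function on $M$ with $$Ric(\omega)-\omega=\frac{\sqrt{-1}}{2\pi}\,\partial\bar\partial f_\omega .$$ Let $X$ be a holomorphic vector field on $M$ (of type $(1,0)$), and let $\theta_X$ be a smooth complex-valued function with $i(X)\omega=\frac{\sqrt{-1}}{2\pi}\bar\partial\theta_X$. For $0\le k\le n$ let $$F_k(X,\omega)=(n-k)\int_M\theta_X\,\omega^n+(k+1)\int_M\Delta\theta_X\,Ric(\omega)^k\wedge\omega^{n-k}-(n-k)\int_M\theta_X\,Ric(\omega)^{k+1}\wedge\omega^{n-k-1}$$ be the holomorphic invariant of Chen and Tian, where $\Delta u=g^{i\bar j}\partial_i\bar\partial_j u$ and the last term is $0$ for $k=n$. Then $$F_k(X,\omega)=(k+1)\int_M X(f_\omega)\,\omega^n ,$$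 that is, $F_k(X,\omega)$ is $k+1$ times the Futaki invariant $\int_M X(f_\omega)\,\omega^n$ of $X$. -/

import Mathlib

open scoped Manifold ContDiff

noncomputable section

/-! ## Complex manifolds of dimension `n`, modelled on `ℂⁿ` -/

/-- The model space `ℂⁿ`. Its volume is the Lebesgue measure `∏ dxⱼ dyⱼ`. -/
abbrev Cn (n : ℕ) : Type := Fin n → ℂ

/-- The holomorphic tangent space of `M` at `x`, i.e. the real tangent space with its complex
structure. In the chart `chartAt x`, the vector `v` stands for the real vector
`∑ⱼ (vⱼ ∂/∂zⱼ + conj vⱼ ∂/∂z̄ⱼ)`, whose `(1,0)`-part is `∑ⱼ vⱼ ∂/∂zⱼ`. -/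
abbrev TSpace (n : ℕ) {M : Type*} [TopologicalSpace M] [ChartedSpace (Cn n) M] (x : M) : Type :=
  TangentSpace 𝓘(ℂ, Cn n) x

/-- A complex manifold is a real smooth manifold. -/
instance instRealManifold {n : ℕ} {M : Type*} [TopologicalSpace M] [ChartedSpace (Cn n) M]
    [IsManifold 𝓘(ℂ, Cn n) ω M] : IsManifold 𝓘(ℝ, Cn n) ∞ M := by
  refine isManifold_of_contDiffOn _ _ _ fun e e' he he' => ?_
  have h : ContDiffOn ℂ ω _ _ := ((contDiffGroupoid ω 𝓘(ℂ, Cn n)).compatible he he').1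
  exact (h.restrict_scalars ℝ).of_le le_top

section Coordinates

variable {n : ℕ}

/-- The Wirtinger derivative `∂u/∂zⱼ`. -/
def wirtinger (j : Fin n) (u : Cn n → ℂ) (z : Cn n) : ℂ :=
  (fderiv ℝ u z (Pi.single j 1) - Complex.I * fderiv ℝ u z (Pi.single j Complex.I)) / 2

/-- The Wirtinger derivative `∂u/∂z̄ⱼ`. -/
def wirtingerBar (j : Fin n) (u : Cn n → ℂ) (z : Cn n) : ℂ :=
  (fderiv ℝ u z (Pi.single j 1) + Complex.I * fderiv ℝ u z (Pi.single j Complex.I)) / 2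

/-- The matrix `(∂²u/∂zⱼ∂z̄ₖ)`. -/
def complexHessian (u : Cn n → ℂ) (z : Cn n) : Matrix (Fin n) (Fin n) ℂ :=
  Matrix.of fun j k => wirtinger j (wirtingerBar k u) z

/-- The value on `(v, w)` of the 2-form `(√-1/2π) ∑ Aⱼₖ dzⱼ ∧ dz̄ₖ`. -/
def oneOneValue (A : Matrix (Fin n) (Fin n) ℂ) (v w : Cn n) : ℂ :=
  Complex.I / (2 * Real.pi) *
    ∑ j, ∑ k, A j k * (v j * (starRingEnd ℂ) (w k) - w j * (starRingEnd ℂ) (v k))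

end Coordinates

section Forms

variable {n : ℕ} {M : Type*} [TopologicalSpace M] [ChartedSpace (Cn n) M]

/-- The derivative at `z` of the inverse of the chart `c`. -/
def chartInvDeriv (c : OpenPartialHomeomorph M (Cn n)) (z : Cn n) :
    Cn n →L[ℂ] TSpace n (c.symm z) :=
  mfderiv 𝓘(ℂ, Cn n) 𝓘(ℂ, Cn n) c.symm z

/-- A real differential `k`-form read in the chart `c`. -/
def chartForm {k : ℕ} (c : OpenPartialHomeomorph M (Cn n))
    (α : ∀ x : M, (TSpace n x) [⋀^Fin k]→L[ℝ] ℝ) (z : Cn n) : (Cn n) [⋀^Fin k]→L[ℝ] ℝ :=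
  (α (c.symm z)).compContinuousLinearMap ((chartInvDeriv c z).restrictScalars ℝ)

/-- A real differential form is smooth if it is so in every chart. -/
def IsSmoothForm {k : ℕ} (α : ∀ x : M, (TSpace n x) [⋀^Fin k]→L[ℝ] ℝ) : Prop :=
  ∀ c ∈ atlas (Cn n) M, ContDiffOn ℝ ∞ (chartForm c α) c.target

variable (n M) in
/-- A Kähler form: a smooth real 2-form that is closed, of type `(1,1)`, and positive. -/
structure KahlerForm where
  /-- the 2-form -/
  form : ∀ x : M, (TSpace n x) [⋀^Fin 2]→L[ℝ] ℝ
  smooth : IsSmoothForm form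
  closed : ∀ c ∈ atlas (Cn n) M, ∀ z ∈ c.target, extDeriv (chartForm c form) z = 0
  type_one_one : ∀ (x : M) (v w : TSpace n x),
    form x ![Complex.I • v, Complex.I • w] = form x ![v, w]
  pos : ∀ (x : M) (v : TSpace n x), v ≠ 0 → 0 < form x ![v, Complex.I • v]

/-- The exterior algebra of the complexified real cotangent space at `x`: the (mixed degree)
complex-valued forms at `x`, with the wedge product as multiplication. -/
abbrev FormAlg (n : ℕ) {M : Type*} [TopologicalSpace M] [ChartedSpace (Cn n) M] (x : M) : Type :=
  ExteriorAlgebra ℂ (TSpace n x →ₗ[ℝ] ℂ)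

/-- The covector `dzⱼ` at `x`, for the coordinates of `chartAt x`. -/
def dzAt (x : M) (j : Fin n) : TSpace n x →ₗ[ℝ] ℂ :=
  (LinearMap.proj j : Cn n →ₗ[ℝ] ℂ)

/-- The covector `dz̄ⱼ` at `x`, for the coordinates of `chartAt x`. -/
def dzBarAt (x : M) (j : Fin n) : TSpace n x →ₗ[ℝ] ℂ :=
  Complex.conjAe.toLinearMap ∘ₗ (LinearMap.proj j : Cn n →ₗ[ℝ] ℂ)

/-- The form `(√-1/2π) ∑ Aⱼₖ dzⱼ ∧ dz̄ₖ` at `x`, for the coordinates of `chartAt x`. -/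
def oneOneForm (x : M) (A : Matrix (Fin n) (Fin n) ℂ) : FormAlg n x :=
  (Complex.I / (2 * Real.pi) : ℂ) •
    ∑ j, ∑ k, A j k • (ExteriorAlgebra.ι ℂ (dzAt x j) * ExteriorAlgebra.ι ℂ (dzBarAt x k))

/-- The form `(√-1/2π) ∂∂̄u` at `x`. -/
def ddbar (u : M → ℂ) (x : M) : FormAlg n x :=
  oneOneForm x (complexHessian (u ∘ (chartAt (Cn n) x).symm) (chartAt (Cn n) x x))

/-! ### Integration of top degree forms -/

/-- The positively oriented real basis `e₁, √-1 e₁, …, eₙ, √-1 eₙ` of `ℂⁿ`. -/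
def stdFrame (n : ℕ) (i : Fin (n * 2)) : Cn n :=
  Pi.single (finProdFinEquiv.symm i).1 (if (finProdFinEquiv.symm i).2 = 0 then 1 else Complex.I)

/-- The alternating map `(ℓ₁, …, ℓ₂ₙ) ↦ (ℓ₁ ∧ … ∧ ℓ₂ₙ)(e₁, √-1 e₁, …) = det (ℓₐ(e_b))`. -/
def frameDet (n : ℕ) : (Cn n →ₗ[ℝ] ℂ) [⋀^Fin (n * 2)]→ₗ[ℂ] ℂ :=
  (Matrix.detRowAlternating (n := Fin (n * 2)) (R := ℂ)).compLinearMap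
    (LinearMap.pi fun b => LinearMap.applyₗ' ℂ (stdFrame n b))

/-- The coefficient of `dx₁ ∧ dy₁ ∧ … ∧ dxₙ ∧ dyₙ` in a form on `ℂⁿ`. The components of degree
other than `2n` do not contribute. -/
def topCoeff (n : ℕ) : ExteriorAlgebra ℂ (Cn n →ₗ[ℝ] ℂ) →ₗ[ℂ] ℂ :=
  ExteriorAlgebra.liftAlternating
    (Pi.single (M := fun i : ℕ => (Cn n →ₗ[ℝ] ℂ) [⋀^Fin i]→ₗ[ℂ] ℂ) (n * 2) (frameDet n))

/-- The coefficient of `dx₁ ∧ dy₁ ∧ … ∧ dxₙ ∧ dyₙ` in the form `η` read in the chart `c`. -/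
def chartTopCoeff (c : OpenPartialHomeomorph M (Cn n)) (η : ∀ x : M, FormAlg n x) (z : Cn n) : ℂ :=
  topCoeff n (ExteriorAlgebra.map
    (LinearMap.lcomp ℂ ℂ (((chartInvDeriv c z).restrictScalars ℝ).toLinearMap)) (η (c.symm z)))

variable (n M) in
/-- A smooth partition of unity subordinate to the chart domains. -/
def chartPartition [T2Space M] [SigmaCompactSpace M] [IsManifold 𝓘(ℂ, Cn n) ω M] :
    SmoothPartitionOfUnity M 𝓘(ℝ, Cn n) M Set.univ :=
  (SmoothPartitionOfUnity.exists_isSubordinate_chartAt_source 𝓘(ℝ, Cn n) M).choose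

/-- The integral `∫_M η` of a form over `M` with its complex orientation, by means of a partition
of unity. -/
def formIntegral [T2Space M] [SigmaCompactSpace M] [IsManifold 𝓘(ℂ, Cn n) ω M]
    (η : ∀ x : M, FormAlg n x) : ℂ :=
  ∑ᶠ p : M, ∫ z in (chartAt (Cn n) p).target,
    (chartPartition n M p ((chartAt (Cn n) p).symm z) : ℂ) * chartTopCoeff (chartAt (Cn n) p) η z

/-! ### Vector fields and first derivatives of functions -/

/-- A holomorphic vector field, as a holomorphic section of the holomorphic tangent bundle. -/
def IsHolomorphicVectorField [IsManifold 𝓘(ℂ, Cn n) ω M] (X : ∀ x : M, TSpace n x) : Prop :=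
  ContMDiff 𝓘(ℂ, Cn n) (𝓘(ℂ, Cn n).tangent) ω
    (fun x => (⟨x, X x⟩ : TangentBundle 𝓘(ℂ, Cn n) M))

/-- The real differential of a complex-valued function. -/
def realDiff (u : M → ℂ) (x : M) : TSpace n x →L[ℝ] ℂ :=
  (mfderiv 𝓘(ℝ, Cn n) 𝓘(ℝ, ℂ) u x : Cn n →L[ℝ] ℂ)

/-- `(∂u)(v) = (du(v) - √-1 du(√-1 v)) / 2`. This is also the derivative of `u` along the
`(1,0)`-part `(v - √-1 Jv) / 2` of `v`. -/
def delValue (u : M → ℂ) (x : M) (v : TSpace n x) : ℂ :=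
  (realDiff u x v - Complex.I * realDiff u x (Complex.I • v)) / 2

/-- `(∂̄u)(v) = (du(v) + √-1 du(√-1 v)) / 2`. -/
def delBarValue (u : M → ℂ) (x : M) (v : TSpace n x) : ℂ :=
  (realDiff u x v + Complex.I * realDiff u x (Complex.I • v)) / 2

namespace KahlerForm

variable (Ω : KahlerForm n M)

/-- The matrix `(gⱼₖ̄)` in the chart `c`, with `Ω = (√-1/2π) ∑ gⱼₖ̄ dzⱼ ∧ dz̄ₖ`; that is,
`gⱼₖ̄ = (2π/√-1) Ω(∂/∂zⱼ, ∂/∂z̄ₖ) = π (Ω(eⱼ, √-1 eₖ) - √-1 Ω(eⱼ, eₖ))`. -/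
def metricMatrix (c : OpenPartialHomeomorph M (Cn n)) (z : Cn n) : Matrix (Fin n) (Fin n) ℂ :=
  Matrix.of fun j k => (Real.pi : ℂ) *
    ((chartForm c Ω.form z ![Pi.single j 1, Pi.single k Complex.I] : ℂ) -
      Complex.I * (chartForm c Ω.form z ![Pi.single j 1, Pi.single k 1] : ℂ))

/-- `-∂ⱼ∂̄ₖ log det g` in the chart `c`. -/
def ricciMatrix (c : OpenPartialHomeomorph M (Cn n)) (z : Cn n) : Matrix (Fin n) (Fin n) ℂ :=
  -complexHessian (fun w => (Real.log (Ω.metricMatrix c w).det.re : ℂ)) z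

/-- The Kähler form as an element of the algebra of forms. -/
def toForm (x : M) : FormAlg n x :=
  oneOneForm x (Ω.metricMatrix (chartAt (Cn n) x) (chartAt (Cn n) x x))

/-- The Ricci form `Ric = -(√-1/2π) ∂∂̄ log det g`, which is the first Chern form of `Ω`. -/
def ricciForm (x : M) : FormAlg n x :=
  oneOneForm x (Ω.ricciMatrix (chartAt (Cn n) x) (chartAt (Cn n) x x))

/-- `Ω` represents `c₁(M)` in de Rham cohomology: `Ric - Ω = dβ` for a smooth real 1-form `β`. -/
def RepresentsFirstChernClass : Prop :=
  ∃ β : ∀ x : M, (TSpace n x) [⋀^Fin 1]→L[ℝ] ℝ, IsSmoothForm β ∧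
    ∀ c ∈ atlas (Cn n) M, ∀ z ∈ c.target, ∀ v w : Cn n,
      oneOneValue (Ω.ricciMatrix c z) v w - (chartForm c Ω.form z ![v, w] : ℂ) =
        (extDeriv (chartForm c β) z ![v, w] : ℂ)

/-- The Laplacian `Δu = g^{jk̄} ∂ⱼ∂̄ₖu`. -/
def laplacian (u : M → ℂ) (x : M) : ℂ :=
  ((Ω.metricMatrix (chartAt (Cn n) x) (chartAt (Cn n) x x))⁻¹ *
    complexHessian (u ∘ (chartAt (Cn n) x).symm) (chartAt (Cn n) x x)).trace

/-- The value on `v` of `i(X)Ω`, where `X` is seen as the `(1,0)`-vector `(X - √-1 JX) / 2` and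
`Ω` is extended complex-linearly. -/
def contractValue (X : ∀ x : M, TSpace n x) (x : M) (v : TSpace n x) : ℂ :=
  ((Ω.form x ![X x, v] : ℂ) - Complex.I * (Ω.form x ![Complex.I • X x, v] : ℂ)) / 2

/-- `θ` is a smooth function with `i(X)Ω = (√-1/2π) ∂̄θ`. -/
def IsPotentialOf (X : ∀ x : M, TSpace n x) (θ : M → ℂ) : Prop :=
  ContMDiff 𝓘(ℝ, Cn n) 𝓘(ℝ, ℂ) ∞ θ ∧
    ∀ (x : M) (v : TSpace n x),
      Ω.contractValue X x v = Complex.I / (2 * Real.pi) * delBarValue θ x v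

/-- `f` is a smooth real function with `Ric - Ω = (√-1/2π) ∂∂̄f`. -/
def IsRicciPotential (f : M → ℝ) : Prop :=
  ContMDiff 𝓘(ℝ, Cn n) 𝓘(ℝ, ℝ) ∞ f ∧
    ∀ x : M, Ω.ricciForm x - Ω.toForm x = ddbar (fun y => (f y : ℂ)) x

variable [T2Space M] [SigmaCompactSpace M] [IsManifold 𝓘(ℂ, Cn n) ω M]

/-- The invariant of Chen and Tian, for a function `θ` with `i(X)Ω = (√-1/2π) ∂̄θ`:
`(n-k) ∫ θ Ωⁿ + (k+1) ∫ Δθ Ricᵏ ∧ Ωⁿ⁻ᵏ - (n-k) ∫ θ Ricᵏ⁺¹ ∧ Ωⁿ⁻ᵏ⁻¹`, for `0 ≤ k ≤ n`. The last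
term is zero for `k = n`. -/
def chenTian (θ : M → ℂ) (k : ℕ) : ℂ :=
  ((n : ℂ) - k) * formIntegral (fun x => θ x • Ω.toForm x ^ n)
    + (k + 1) * formIntegral
        (fun x => Ω.laplacian θ x • (Ω.ricciForm x ^ k * Ω.toForm x ^ (n - k)))
    - ((n : ℂ) - k) * formIntegral
        (fun x => θ x • (Ω.ricciForm x ^ (k + 1) * Ω.toForm x ^ (n - k - 1)))

/-- The Futaki invariant `∫ X(f) Ωⁿ`, for a function `f` with `Ric - Ω = (√-1/2π) ∂∂̄f`. -/
def futaki (X : ∀ x : M, TSpace n x) (f : M → ℝ) : ℂ :=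
  formIntegral (fun x => delValue (fun y => (f y : ℂ)) x (X x) • Ω.toForm x ^ n)

end KahlerForm

end Forms

end

/-!
Write `ρ = Ric(Ω)` and `σ = (√-1/2π) ∂∂̄f = ρ - Ω`. Everything takes place in the pencil of forms
`Ω + tσ`, whose top power is the density `n! π⁻ⁿ det (g + t ∂∂̄f)`; hence `σʲ ∧ Ωⁿ⁻ʲ` is, up to the
factor `n choose j`, the coefficient of `tʲ` in that determinant (`choose_mul_topCoeff`). Expanding
`ρᵏ = (Ω + σ)ᵏ` turns every integral of the theorem into a combination of the numbers
`coeffInt u j = ∫ u · [tʲ] det (g + t ∂∂̄f)` for `u` one of `θ`, `X(f)`, `Δθ`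
(`KahlerForm.formIntegral_ricciForm_pow`).

Three relations between these numbers suffice.
* `∂̄(θ + t X(f))` is the contraction of `X` with `g + t ∂∂̄f`, because `X` is holomorphic. So
  `∫ ∂̄((θ + t X(f)) ∂f) ∧ (Ω + tσ)ⁿ⁻¹ = 0` reads
  `∫ (X(f) P(t) + (θ + t X(f)) P'(t)) = 0` with `P(t) = det (g + t ∂∂̄f)`, and comparing coefficients
  gives `coeffInt X(f) j = -coeffInt θ (j + 1)` (`KahlerForm.coeffInt_derivative_add`).
* `∂̄(X(f) + θ + Δθ) = 0` (`KahlerForm.delBarAt_holomorphyDefect`): the Laplacian of `θ` is the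
  divergence `∑ ∂ᵢXⁱ + X(log det g)`, so `∂̄Δθ` is minus the contraction of `X` with the matrix of
  `ρ`, and this matrix is `g + ∂∂̄f`. Hence the integral of `X(f) + θ + Δθ` against `σʲ⁺¹ ∧ Ωⁿ⁻ʲ⁻¹`
  vanishes, which expresses `Δθ` through `θ` and `X(f)` (`KahlerForm.coeffInt_laplacian_succ`).
* `∫ Δθ Ωⁿ = 0` (`KahlerForm.coeffInt_laplacian_zero`).

The invariant of Chen and Tian is then a combination of the numbers `coeffInt θ j`, and telescopes to
`-(k + 1) coeffInt θ 1 = (k + 1) coeffInt X(f) 0` (`sum_choose_div_choose`).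

Stokes' theorem is used only for the forms `∂̄(u ∂v) ∧ (Ω + tσ)ⁿ⁻¹`
(`KahlerForm.densInt_divergence`). In a chart their coefficient is the trace of
`adj (g + t ∂∂̄f)` times the matrix of `∂̄(u ∂v)`, and this is the divergence of
`u adj (g + t ∂∂̄f) ∂v`, because the cofactors of a `∂̄`-closed matrix have zero divergence (`piola`).
A partition of unity applied to `u` reduces the integral to functions with compact support in `ℂⁿ`.
-/

noncomputable section

/-! ### Powers of (1,1)-forms and determinants -/

section SquareZero

variable {R : Type*} [Ring R]

theorem add_pow_succ_of_sq_zero {w S : R} (hc : Commute w S) (hw : w * w = 0) (k : ℕ) :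
    (w + S) ^ (k + 1) = S ^ (k + 1) + ((k + 1 : ℕ) : R) * (w * S ^ k) := by
  induction k with
  | zero => simp [add_comm]
  | succ k ih =>
    have h1 : S * w = w * S := hc.eq.symm
    have h2 : S ^ (k + 1) * w = w * S ^ (k + 1) := ((hc.symm).pow_left (k + 1)).eq
    have h3 : w * S ^ k * w = 0 := by
      rw [mul_assoc, ((hc.symm).pow_left k).eq, ← mul_assoc, hw, zero_mul]
    have h4 : w * S ^ k * S = w * S ^ (k + 1) := by rw [mul_assoc, ← pow_succ]
    rw [pow_succ (w + S), ih, add_mul, mul_add, mul_add, h2, mul_assoc _ _ w, h3,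
      mul_assoc _ _ S, h4, ← pow_succ]
    push_cast
    noncomm_ring

/-- The second claim feeds the induction, which expands `(w₀ + S)ᵏ⁺¹ = Sᵏ⁺¹ + (k + 1) w₀ Sᵏ`. -/
theorem sum_pow_of_sq_zero {m : ℕ} (w : Fin m → R) (hc : ∀ i j, Commute (w i) (w j))
    (hw : ∀ i, w i * w i = 0) :
    (∑ i, w i) ^ m = (m.factorial : R) * (List.ofFn w).prod ∧ (∑ i, w i) ^ (m + 1) = 0 := by
  induction m with
  | zero => simp
  | succ m ih =>
    obtain ⟨ih1, ih2⟩ := ih (fun i => w i.succ) (fun i j => hc _ _) (fun i => hw _)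
    have hcS : Commute (w 0) (∑ i : Fin m, w i.succ) := Commute.sum_right _ _ _ fun i _ => hc _ _
    constructor
    · rw [Fin.sum_univ_succ, add_pow_succ_of_sq_zero hcS (hw 0), ih1, ih2, List.ofFn_succ,
        List.prod_cons, Nat.factorial_succ, zero_add, Nat.cast_mul, mul_assoc,
        ← mul_assoc (w 0), ← (Nat.cast_commute (m.factorial) (w 0)).eq, mul_assoc]
    · rw [Fin.sum_univ_succ, add_pow_succ_of_sq_zero hcS (hw 0), pow_succ, ih2]
      simp

end SquareZero

section Cn

variable {n : ℕ}

/-- The covector `dzⱼ` on `ℂⁿ`. -/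
def dzCn (j : Fin n) : Cn n →ₗ[ℝ] ℂ := LinearMap.proj j

/-- The covector `dz̄ⱼ` on `ℂⁿ`. -/
def dzBarCn (j : Fin n) : Cn n →ₗ[ℝ] ℂ := Complex.conjAe.toLinearMap ∘ₗ LinearMap.proj j

/-- The form `(√-1/2π) ∑ Aⱼₖ dzⱼ ∧ dz̄ₖ` on `ℂⁿ`. -/
def oneOneCn (A : Matrix (Fin n) (Fin n) ℂ) : ExteriorAlgebra ℂ (Cn n →ₗ[ℝ] ℂ) :=
  (Complex.I / (2 * Real.pi) : ℂ) •
    ∑ j, ∑ k, A j k • (ExteriorAlgebra.ι ℂ (dzCn j) * ExteriorAlgebra.ι ℂ (dzBarCn k))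

theorem oneOneCn_add (A B : Matrix (Fin n) (Fin n) ℂ) :
    oneOneCn (A + B) = oneOneCn A + oneOneCn B := by
  simp [oneOneCn, add_smul, Finset.sum_add_distrib]

theorem oneOneCn_smul (t : ℂ) (A : Matrix (Fin n) (Fin n) ℂ) :
    oneOneCn (t • A) = t • oneOneCn A := by
  simp only [oneOneCn, Matrix.smul_apply, smul_eq_mul, mul_smul, ← Finset.smul_sum]
  rw [smul_comm]

/-- Products of two covectors commute with each other. -/
theorem commute_ι_mul_ι {V : Type*} [AddCommGroup V] [Module ℂ V] (a b a' b' : V) :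
    Commute (ExteriorAlgebra.ι ℂ a * ExteriorAlgebra.ι ℂ b)
      (ExteriorAlgebra.ι ℂ a' * ExteriorAlgebra.ι ℂ b') := by
  have key : ∀ x y z : V, ExteriorAlgebra.ι ℂ x * ExteriorAlgebra.ι ℂ y * ExteriorAlgebra.ι ℂ z =
      ExteriorAlgebra.ι ℂ z * (ExteriorAlgebra.ι ℂ x * ExteriorAlgebra.ι ℂ y) := by
    intro x y z
    have h1 := eq_neg_of_add_eq_zero_left (ExteriorAlgebra.ι_add_mul_swap (R := ℂ) y z)
    have h2 := eq_neg_of_add_eq_zero_left (ExteriorAlgebra.ι_add_mul_swap (R := ℂ) x z)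
    rw [mul_assoc, h1, mul_neg, ← mul_assoc, h2, neg_mul, neg_neg, mul_assoc]
  have h1 : Commute (ExteriorAlgebra.ι ℂ a * ExteriorAlgebra.ι ℂ b) (ExteriorAlgebra.ι ℂ a') :=
    key a b a'
  exact h1.mul_right (key a b b')

theorem commute_oneOneCn (A B : Matrix (Fin n) (Fin n) ℂ) :
    Commute (oneOneCn A) (oneOneCn B) := by
  unfold oneOneCn
  refine Commute.smul_left (Commute.smul_right ?_ _) _
  refine Commute.sum_left _ _ _ fun i _ => Commute.sum_left _ _ _ fun j _ => ?_
  refine Commute.sum_right _ _ _ fun i' _ => Commute.sum_right _ _ _ fun j' _ => ?_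
  exact Commute.smul_left (Commute.smul_right (commute_ι_mul_ι _ _ _ _) _) _

/-- The product of the `aⱼ ∧ bⱼ` as a single `2n`-fold wedge product, in the order
`a₁, b₁, a₂, b₂, …` that `stdFrame` uses. -/
theorem prod_ofFn_ι_mul_ι {V : Type*} [AddCommGroup V] [Module ℂ V] (a b : Fin n → V) :
    (List.ofFn fun j => ExteriorAlgebra.ι ℂ (a j) * ExteriorAlgebra.ι ℂ (b j)).prod =
      ExteriorAlgebra.ιMulti ℂ (n * 2) (fun i : Fin (n * 2) =>
        if (finProdFinEquiv.symm i).2 = 0 then a (finProdFinEquiv.symm i).1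
        else b (finProdFinEquiv.symm i).1) := by
  rw [ExteriorAlgebra.ιMulti_apply, List.ofFn_mul, List.prod_flatten, List.map_ofFn]
  congr 1
  congr 1
  funext i
  have e0 : (⟨i * 2 + (0 : Fin 2), by omega⟩ : Fin (n * 2)) = finProdFinEquiv (i, 0) := by
    ext; simp [finProdFinEquiv]; ring
  have e1 : (⟨i * 2 + (1 : Fin 2), by omega⟩ : Fin (n * 2)) = finProdFinEquiv (i, 1) := by
    ext; simp [finProdFinEquiv]; ring
  simp only [Function.comp, List.ofFn_succ, List.ofFn_zero, List.prod_cons, List.prod_nil, mul_one,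
    Fin.succ_zero_eq_one]
  rw [e0, e1]
  simp

/-- `dz₁ ∧ A dz̄₁ ∧ … ∧ dzₙ ∧ A dz̄ₙ` on the standard frame: after sorting rows and columns this is the
determinant of the block matrix with rows `(1, √-1)` and `(A, -√-1 A)`. -/
theorem frameDet_interleave (A : Matrix (Fin n) (Fin n) ℂ) :
    frameDet n (fun i : Fin (n * 2) =>
        if (finProdFinEquiv.symm i).2 = 0 then dzCn (finProdFinEquiv.symm i).1
        else ∑ k, A (finProdFinEquiv.symm i).1 k • dzBarCn k) =
      (-2 * Complex.I) ^ n * A.det := by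
  set e : Fin n ⊕ Fin n ≃ Fin (n * 2) :=
    ((Equiv.prodComm _ _).trans ((finTwoEquiv.prodCongr (Equiv.refl _)).trans
      (Equiv.boolProdEquivSum _))).symm.trans finProdFinEquiv with he
  have el : ∀ i, e (Sum.inl i) = finProdFinEquiv (i, 0) := by intro i; simp [he, finTwoEquiv]
  have er : ∀ i, e (Sum.inr i) = finProdFinEquiv (i, 1) := by intro i; simp [he, finTwoEquiv]
  change Matrix.det (Matrix.of fun a b => _) = _
  rw [← Matrix.det_submatrix_equiv_self e]
  have : (Matrix.of fun a b : Fin (n * 2) =>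
      (if (finProdFinEquiv.symm a).2 = 0 then dzCn (finProdFinEquiv.symm a).1
        else ∑ k, A (finProdFinEquiv.symm a).1 k • dzBarCn k) (stdFrame n b)).submatrix e e =
      Matrix.fromBlocks 1 (Complex.I • (1 : Matrix (Fin n) (Fin n) ℂ)) A ((-Complex.I) • A) := by
    ext a b
    rcases a with a | a <;> rcases b with b | b <;>
      simp [-finProdFinEquiv_symm_apply, el, er, stdFrame, dzCn, dzBarCn, Matrix.one_apply,
        Pi.single_apply, apply_ite, mul_comm]
    intro h h'
    exact absurd h h'
  refine (congrArg Matrix.det this).trans ?_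
  rw [Matrix.det_fromBlocks_one₁₁]
  have : (-Complex.I) • A - A * (Complex.I • (1 : Matrix (Fin n) (Fin n) ℂ)) =
      (-2 * Complex.I) • A := by
    rw [Matrix.mul_smul, Matrix.mul_one, ← sub_smul]; congr 1; ring
  rw [this, Matrix.det_smul, Fintype.card_fin]

/-- The top power of a (1,1)-form: the `n` summands `dzⱼ ∧ ∑ₖ Aⱼₖ dz̄ₖ` commute and square to zero. -/
theorem topCoeff_oneOneCn_pow (A : Matrix (Fin n) (Fin n) ℂ) :
    topCoeff n (oneOneCn A ^ n) = (n.factorial : ℂ) * ((Real.pi : ℂ)⁻¹) ^ n * A.det := by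
  have h1 : oneOneCn A = (Complex.I / (2 * Real.pi) : ℂ) • ∑ j,
      ExteriorAlgebra.ι ℂ (dzCn j) * ExteriorAlgebra.ι ℂ (∑ k, A j k • dzBarCn k) := by
    simp [oneOneCn, Finset.mul_sum]
  have h2 := (sum_pow_of_sq_zero (fun j => ExteriorAlgebra.ι ℂ (dzCn j) *
    ExteriorAlgebra.ι ℂ (∑ k, A j k • dzBarCn k)) (fun i j => commute_ι_mul_ι _ _ _ _) (fun i => by
      rw [mul_assoc, ← mul_assoc (ExteriorAlgebra.ι ℂ (∑ k, A i k • dzBarCn k)),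
        eq_neg_of_add_eq_zero_left (ExteriorAlgebra.ι_add_mul_swap (R := ℂ)
          (∑ k, A i k • dzBarCn k) (dzCn i)), neg_mul, mul_neg, ← mul_assoc, ← mul_assoc,
        ExteriorAlgebra.ι_sq_zero]; simp)).1
  rw [h1, smul_pow, h2, prod_ofFn_ι_mul_ι, ← nsmul_eq_mul, map_smul, map_nsmul, topCoeff,
    ExteriorAlgebra.liftAlternating_apply_ιMulti, Pi.single_eq_same, frameDet_interleave]
  simp only [nsmul_eq_mul, smul_eq_mul]
  have : (Complex.I / (2 * Real.pi)) ^ n * (-2 * Complex.I) ^ n = ((Real.pi : ℂ)⁻¹) ^ n := by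
    rw [← mul_pow]
    congr 1
    have : (Real.pi : ℂ) ≠ 0 := by exact_mod_cast Real.pi_ne_zero
    field_simp
    rw [Complex.I_sq]; ring
  rw [← this]; ring

/-- The polynomial `det (G + t S)` in `t`. -/
def pencil (G S : Matrix (Fin n) (Fin n) ℂ) : Polynomial ℂ :=
  ((Polynomial.X : Polynomial ℂ) • S.map Polynomial.C + G.map Polynomial.C).det

theorem eval_pencil (G S : Matrix (Fin n) (Fin n) ℂ) (t : ℂ) :
    (pencil G S).eval t = (G + t • S).det := by
  rw [pencil, ← Polynomial.coe_evalRingHom, RingHom.map_det]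
  congr 1
  ext i j
  simp [add_comm (G i j), mul_comm t]

theorem natDegree_pencil_le (G S : Matrix (Fin n) (Fin n) ℂ) : (pencil G S).natDegree ≤ n := by
  simpa [pencil] using Polynomial.natDegree_det_X_add_C_le S G

/-- Mixed powers of two (1,1)-forms are the coefficients in `t` of `det (G + t S)`, by comparison of
the binomial expansion of the top power of the form of `G + t S` with its determinant. -/
theorem choose_mul_topCoeff (G S : Matrix (Fin n) (Fin n) ℂ) {j : ℕ} (hj : j ≤ n) :
    (n.choose j : ℂ) * topCoeff n (oneOneCn S ^ j * oneOneCn G ^ (n - j)) =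
      (n.factorial : ℂ) * ((Real.pi : ℂ)⁻¹) ^ n * (pencil G S).coeff j := by
  have key : (∑ i ∈ Finset.range (n + 1), Polynomial.C ((n.choose i : ℂ) *
      topCoeff n (oneOneCn S ^ i * oneOneCn G ^ (n - i))) * Polynomial.X ^ i) =
      Polynomial.C ((n.factorial : ℂ) * ((Real.pi : ℂ)⁻¹) ^ n) * pencil G S := by
    refine Polynomial.funext fun t => ?_
    rw [Polynomial.eval_mul, eval_pencil, Polynomial.eval_C, ← topCoeff_oneOneCn_pow,
      oneOneCn_add, oneOneCn_smul, add_comm (oneOneCn G),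
      ((commute_oneOneCn S G).smul_left t).add_pow, map_sum, Polynomial.eval_finsetSum]
    refine Finset.sum_congr rfl fun i _ => ?_
    rw [smul_pow, ← (Nat.cast_commute (n.choose i) (_ * _)).eq,
      ← nsmul_eq_mul (n.choose i) (_ * oneOneCn G ^ (n - i)), map_nsmul, smul_mul_assoc, map_smul]
    simp
    ring
  have := congrArg (fun p => Polynomial.coeff p j) key
  simp only [Polynomial.finsetSum_coeff, Polynomial.coeff_C_mul, Polynomial.coeff_X_pow] at this
  rw [← this]
  simp [Nat.lt_succ_of_le hj]

end Cn

/-! ### Wirtinger calculus -/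

section Wirtinger

variable {n : ℕ} {u v : Cn n → ℂ} {z : Cn n}

theorem wirtinger_congr {j : Fin n} (h : u =ᶠ[nhds z] v) : wirtinger j u z = wirtinger j v z := by
  simp [wirtinger, h.fderiv_eq]

theorem wirtingerBar_congr {j : Fin n} (h : u =ᶠ[nhds z] v) :
    wirtingerBar j u z = wirtingerBar j v z := by
  simp [wirtingerBar, h.fderiv_eq]

theorem complexHessian_congr (h : u =ᶠ[nhds z] v) : complexHessian u z = complexHessian v z := by
  ext j k
  exact wirtinger_congr (h.eventuallyEq_nhds.mono fun w hw => wirtingerBar_congr hw)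

theorem wirtinger_const (j : Fin n) (a : ℂ) : wirtinger j (fun _ => a) z = 0 := by
  simp [wirtinger]

theorem wirtingerBar_const (j : Fin n) (a : ℂ) : wirtingerBar j (fun _ => a) z = 0 := by
  simp [wirtingerBar]

theorem wirtingerBar_add (j : Fin n) (hu : DifferentiableAt ℝ u z) (hv : DifferentiableAt ℝ v z) :
    wirtingerBar j (fun w => u w + v w) z = wirtingerBar j u z + wirtingerBar j v z := by
  simp [wirtingerBar, fderiv_fun_add hu hv]; ring

theorem wirtinger_mul (j : Fin n) (hu : DifferentiableAt ℝ u z) (hv : DifferentiableAt ℝ v z) :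
    wirtinger j (fun w => u w * v w) z = wirtinger j u z * v z + u z * wirtinger j v z := by
  simp [wirtinger, fderiv_fun_mul hu hv]; ring

theorem wirtingerBar_mul (j : Fin n) (hu : DifferentiableAt ℝ u z) (hv : DifferentiableAt ℝ v z) :
    wirtingerBar j (fun w => u w * v w) z =
      wirtingerBar j u z * v z + u z * wirtingerBar j v z := by
  simp [wirtingerBar, fderiv_fun_mul hu hv]; ring

theorem wirtingerBar_const_mul (j : Fin n) (a : ℂ) (hu : DifferentiableAt ℝ u z) :
    wirtingerBar j (fun w => a * u w) z = a * wirtingerBar j u z := by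
  simp [wirtingerBar, fderiv_const_mul hu]; ring

theorem wirtinger_sum {ι : Type*} (s : Finset ι) (j : Fin n) {U : ι → Cn n → ℂ}
    (hU : ∀ i ∈ s, DifferentiableAt ℝ (U i) z) :
    wirtinger j (fun w => ∑ i ∈ s, U i w) z = ∑ i ∈ s, wirtinger j (U i) z := by
  simp only [wirtinger, fderiv_fun_sum hU, sum_apply, ← Finset.sum_div,
    Finset.sum_sub_distrib, Finset.mul_sum]

theorem wirtingerBar_sum {ι : Type*} (s : Finset ι) (j : Fin n) {U : ι → Cn n → ℂ}
    (hU : ∀ i ∈ s, DifferentiableAt ℝ (U i) z) :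
    wirtingerBar j (fun w => ∑ i ∈ s, U i w) z = ∑ i ∈ s, wirtingerBar j (U i) z := by
  simp only [wirtingerBar, fderiv_fun_sum hU, sum_apply, ← Finset.sum_div,
    Finset.sum_add_distrib, Finset.mul_sum]

/-- The real differential is `∂ + ∂̄`. -/
theorem fderiv_eq_wirtinger (u : Cn n → ℂ) (z v : Cn n) :
    fderiv ℝ u z v =
      ∑ a, (wirtinger a u z * v a + wirtingerBar a u z * (starRingEnd ℂ) (v a)) := by
  have hv : v = ∑ a, ((v a).re • (Pi.single a 1 : Cn n) + (v a).im • (Pi.single a Complex.I : Cn n)) := by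
    funext b
    simp [Finset.sum_apply, Pi.single_apply, Finset.sum_add_distrib]
  conv_lhs => rw [hv]
  rw [map_sum]
  refine Finset.sum_congr rfl fun a _ => ?_
  rw [map_add, map_smul, map_smul]
  have h1 : v a = (v a).re + (v a).im * Complex.I := (Complex.re_add_im _).symm
  have h2 : (starRingEnd ℂ) (v a) = (v a).re - (v a).im * Complex.I := by
    apply Complex.ext <;> simp
  rw [h2]
  conv_rhs => enter [1, 2]; rw [h1]
  simp only [wirtinger, wirtingerBar, Complex.real_smul]
  ring_nf
  simp only [Complex.I_sq]
  ring

theorem wirtinger_comp_holomorphic {T : Cn n → Cn n} (j : Fin n) (hT : DifferentiableAt ℂ T z)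
    (hu : DifferentiableAt ℝ u (T z)) :
    wirtinger j (u ∘ T) z = ∑ a, wirtinger a u (T z) * fderiv ℂ T z (Pi.single j 1) a := by
  have hI : (Pi.single j Complex.I : Cn n) = Complex.I • Pi.single j 1 := by
    rw [← Pi.single_smul]; simp
  rw [wirtinger, fderiv_comp _ hu (hT.restrictScalars ℝ), hT.fderiv_restrictScalars ℝ]
  simp only [ContinuousLinearMap.comp_apply, ContinuousLinearMap.coe_restrictScalars', hI, map_smul]
  rw [fderiv_eq_wirtinger, fderiv_eq_wirtinger, Finset.mul_sum, ← Finset.sum_sub_distrib,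
    Finset.sum_div]
  refine Finset.sum_congr rfl fun a _ => ?_
  simp only [Pi.smul_apply, smul_eq_mul, map_mul, Complex.conj_I]
  ring_nf
  simp only [Complex.I_sq]
  ring

theorem wirtingerBar_comp_holomorphic {T : Cn n → Cn n} (j : Fin n) (hT : DifferentiableAt ℂ T z)
    (hu : DifferentiableAt ℝ u (T z)) :
    wirtingerBar j (u ∘ T) z =
      ∑ a, wirtingerBar a u (T z) * (starRingEnd ℂ) (fderiv ℂ T z (Pi.single j 1) a) := by
  have hI : (Pi.single j Complex.I : Cn n) = Complex.I • Pi.single j 1 := by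
    rw [← Pi.single_smul]; simp
  rw [wirtingerBar, fderiv_comp _ hu (hT.restrictScalars ℝ), hT.fderiv_restrictScalars ℝ]
  simp only [ContinuousLinearMap.comp_apply, ContinuousLinearMap.coe_restrictScalars', hI, map_smul]
  rw [fderiv_eq_wirtinger, fderiv_eq_wirtinger, Finset.mul_sum, ← Finset.sum_add_distrib,
    Finset.sum_div]
  refine Finset.sum_congr rfl fun a _ => ?_
  simp only [Pi.smul_apply, smul_eq_mul, map_mul, Complex.conj_I]
  ring_nf
  simp only [Complex.I_sq]
  ring

theorem fderiv_single_I_of_holomorphic {F : Cn n → ℂ} (j : Fin n) (hF : DifferentiableAt ℂ F z) :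
    fderiv ℝ F z (Pi.single j Complex.I) = Complex.I * fderiv ℝ F z (Pi.single j 1) := by
  have hI : (Pi.single j Complex.I : Cn n) = Complex.I • Pi.single j 1 := by
    rw [← Pi.single_smul]; simp
  rw [hF.fderiv_restrictScalars ℝ]
  simp [hI]

theorem wirtingerBar_holomorphic {F : Cn n → ℂ} (j : Fin n) (hF : DifferentiableAt ℂ F z) :
    wirtingerBar j F z = 0 := by
  rw [wirtingerBar, fderiv_single_I_of_holomorphic j hF, ← mul_assoc, Complex.I_mul_I]
  simp

theorem wirtinger_conj_holomorphic {F : Cn n → ℂ} (j : Fin n) (hF : DifferentiableAt ℂ F z) :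
    wirtinger j (fun w => (starRingEnd ℂ) (F w)) z = 0 := by
  have h : fderiv ℝ (fun w => (starRingEnd ℂ) (F w)) z =
      (Complex.conjCLE : ℂ →L[ℝ] ℂ).comp (fderiv ℝ F z) :=
    ((Complex.conjCLE : ℂ →L[ℝ] ℂ).hasFDerivAt.comp z
      (hF.restrictScalars ℝ).hasFDerivAt).fderiv
  rw [wirtinger, h]
  simp only [ContinuousLinearMap.comp_apply, fderiv_single_I_of_holomorphic j hF]
  simp only [ContinuousLinearEquiv.coe_coe, Complex.conjCLE_apply, map_mul, Complex.conj_I]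
  ring_nf
  simp only [Complex.I_sq]
  ring

variable {s : Set (Cn n)}

theorem ContDiffOn.wirtinger (hs : IsOpen s) (hu : ContDiffOn ℝ ∞ u s) (j : Fin n) :
    ContDiffOn ℝ ∞ (wirtinger j u) s := by
  have h := hu.fderiv_of_isOpen hs (m := ∞) (by simp)
  unfold _root_.wirtinger
  fun_prop

theorem ContDiffOn.wirtingerBar (hs : IsOpen s) (hu : ContDiffOn ℝ ∞ u s) (j : Fin n) :
    ContDiffOn ℝ ∞ (wirtingerBar j u) s := by
  have h := hu.fderiv_of_isOpen hs (m := ∞) (by simp)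
  unfold _root_.wirtingerBar
  fun_prop

theorem ContDiffOn.differentiableAt_of_isOpen (hs : IsOpen s) (hu : ContDiffOn ℝ ∞ u s)
    (hz : z ∈ s) : DifferentiableAt ℝ u z :=
  (hu.differentiableOn (by simp)).differentiableAt (hs.mem_nhds hz)

theorem fderiv_fderiv_apply_comm (hs : IsOpen s) (hu : ContDiffOn ℝ ∞ u s) (hz : z ∈ s)
    (a b : Cn n) :
    fderiv ℝ (fun w => fderiv ℝ u w a) z b = fderiv ℝ (fun w => fderiv ℝ u w b) z a := by
  have hd : DifferentiableAt ℝ (fderiv ℝ u) z :=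
    ((hu.fderiv_of_isOpen hs (m := ∞) (by simp)).differentiableOn (by simp)).differentiableAt
      (hs.mem_nhds hz)
  have hsym : IsSymmSndFDerivAt ℝ u z :=
    (hu.contDiffAt (hs.mem_nhds hz)).isSymmSndFDerivAt (by rw [minSmoothness_of_isRCLikeNormedField]; exact WithTop.coe_le_coe.2 le_top)
  rw [fderiv_clm_apply hd (differentiableAt_const _), fderiv_clm_apply hd (differentiableAt_const _)]
  simpa using hsym b a

theorem differentiableAt_fderiv_apply (hs : IsOpen s) (hu : ContDiffOn ℝ ∞ u s) (hz : z ∈ s)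
    (a : Cn n) : DifferentiableAt ℝ (fun w => fderiv ℝ u w a) z := by
  have hd : DifferentiableAt ℝ (fderiv ℝ u) z :=
    ((hu.fderiv_of_isOpen hs (m := ∞) (by simp)).differentiableOn (by simp)).differentiableAt
      (hs.mem_nhds hz)
  fun_prop

theorem fderiv_wirtinger (hs : IsOpen s) (hu : ContDiffOn ℝ ∞ u s) (hz : z ∈ s) (j : Fin n)
    (v : Cn n) :
    fderiv ℝ (wirtinger j u) z v = (fderiv ℝ (fun w => fderiv ℝ u w (Pi.single j 1)) z v -
      Complex.I * fderiv ℝ (fun w => fderiv ℝ u w (Pi.single j Complex.I)) z v) / 2 := by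
  have h1 := differentiableAt_fderiv_apply hs hu hz (Pi.single j 1)
  have h2 := differentiableAt_fderiv_apply hs hu hz (Pi.single j Complex.I)
  have := ((h1.hasFDerivAt.sub (h2.hasFDerivAt.const_mul Complex.I)).mul_const (2⁻¹ : ℂ)).fderiv
  have e : wirtinger j u = fun w => ((fun w => fderiv ℝ u w (Pi.single j 1)) -
      fun w => Complex.I * fderiv ℝ u w (Pi.single j Complex.I)) w * 2⁻¹ := by
    funext w; simp [wirtinger, div_eq_mul_inv]
  rw [e, this]
  simp
  ring

theorem fderiv_wirtingerBar (hs : IsOpen s) (hu : ContDiffOn ℝ ∞ u s) (hz : z ∈ s) (j : Fin n)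
    (v : Cn n) :
    fderiv ℝ (wirtingerBar j u) z v = (fderiv ℝ (fun w => fderiv ℝ u w (Pi.single j 1)) z v +
      Complex.I * fderiv ℝ (fun w => fderiv ℝ u w (Pi.single j Complex.I)) z v) / 2 := by
  have h1 := differentiableAt_fderiv_apply hs hu hz (Pi.single j 1)
  have h2 := differentiableAt_fderiv_apply hs hu hz (Pi.single j Complex.I)
  have := ((h1.hasFDerivAt.add (h2.hasFDerivAt.const_mul Complex.I)).mul_const (2⁻¹ : ℂ)).fderiv
  have e : wirtingerBar j u = fun w => ((fun w => fderiv ℝ u w (Pi.single j 1)) +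
      fun w => Complex.I * fderiv ℝ u w (Pi.single j Complex.I)) w * 2⁻¹ := by
    funext w; simp [wirtingerBar, div_eq_mul_inv]
  rw [e, this]
  simp
  ring

theorem wirtinger_wirtingerBar_comm (hs : IsOpen s) (hu : ContDiffOn ℝ ∞ u s) (hz : z ∈ s)
    (j k : Fin n) :
    wirtinger j (wirtingerBar k u) z = wirtingerBar k (wirtinger j u) z := by
  rw [wirtinger, wirtingerBar]
  simp only [fderiv_wirtinger hs hu hz, fderiv_wirtingerBar hs hu hz]
  rw [fderiv_fderiv_apply_comm hs hu hz (Pi.single k 1) (Pi.single j 1),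
    fderiv_fderiv_apply_comm hs hu hz (Pi.single k 1) (Pi.single j Complex.I),
    fderiv_fderiv_apply_comm hs hu hz (Pi.single k Complex.I) (Pi.single j 1),
    fderiv_fderiv_apply_comm hs hu hz (Pi.single k Complex.I) (Pi.single j Complex.I)]
  ring

theorem wirtingerBar_wirtingerBar_comm (hs : IsOpen s) (hu : ContDiffOn ℝ ∞ u s) (hz : z ∈ s)
    (j k : Fin n) :
    wirtingerBar j (wirtingerBar k u) z = wirtingerBar k (wirtingerBar j u) z := by
  rw [wirtingerBar, wirtingerBar]
  simp only [fderiv_wirtingerBar hs hu hz]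
  rw [fderiv_fderiv_apply_comm hs hu hz (Pi.single k 1) (Pi.single j 1),
    fderiv_fderiv_apply_comm hs hu hz (Pi.single k 1) (Pi.single j Complex.I),
    fderiv_fderiv_apply_comm hs hu hz (Pi.single k Complex.I) (Pi.single j 1),
    fderiv_fderiv_apply_comm hs hu hz (Pi.single k Complex.I) (Pi.single j Complex.I)]
  ring

/-- `∂̄_l` of a mixed second derivative is symmetric in the antiholomorphic indices. -/
theorem wirtingerBar_complexHessian_comm (hs : IsOpen s) (hu : ContDiffOn ℝ ∞ u s) (hz : z ∈ s)
    (j k l : Fin n) :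
    wirtingerBar l (fun w => complexHessian u w j k) z =
      wirtingerBar k (fun w => complexHessian u w j l) z := by
  have h1 : ∀ k, (fun w => complexHessian u w j k) =ᶠ[nhds z] wirtingerBar k (wirtinger j u) := by
    intro k
    filter_upwards [hs.mem_nhds hz] with w hw
    exact wirtinger_wirtingerBar_comm hs hu hw j k
  rw [wirtingerBar_congr (h1 k), wirtingerBar_congr (h1 l)]
  exact wirtingerBar_wirtingerBar_comm hs (hu.wirtinger hs j) hz l k

/-- The transformation law of `∂∂̄u` under a holomorphic map. -/
theorem complexHessian_comp_holomorphic {T : Cn n → Cn n} (hs : IsOpen s) (ht : ContDiffOn ℝ ∞ u s)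
    (hT : ∀ᶠ w in nhds z, DifferentiableAt ℂ T w) (hT' : ContDiffAt ℂ 2 T z) (hz : T z ∈ s) :
    complexHessian (u ∘ T) z = (Matrix.of fun j a => fderiv ℂ T z (Pi.single j 1) a) *
      complexHessian u (T z) *
        (Matrix.of fun b k => (starRingEnd ℂ) (fderiv ℂ T z (Pi.single k 1) b)) := by
  have hcont : ContinuousAt T z := hT'.continuousAt
  have hTz : DifferentiableAt ℂ T z := hT.self_of_nhds
  ext j k
  have h1 : wirtingerBar k (u ∘ T) =ᶠ[nhds z] fun w => ∑ b, wirtingerBar b u (T w) *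
      (starRingEnd ℂ) (fderiv ℂ T w (Pi.single k 1) b) := by
    filter_upwards [hT, hcont (hs.mem_nhds hz)] with w hw hw'
    exact wirtingerBar_comp_holomorphic k hw (ht.differentiableAt_of_isOpen hs hw')
  have hF : ∀ b, DifferentiableAt ℂ (fun w => fderiv ℂ T w (Pi.single k 1) b) z := by
    intro b
    have : DifferentiableAt ℂ (fderiv ℂ T) z :=
      (hT'.fderiv_right (m := 1) le_rfl).differentiableAt (by simp)
    have h2 : DifferentiableAt ℂ (fun w => fderiv ℂ T w (Pi.single k 1)) z := by fun_prop
    exact (differentiableAt_pi.1 h2) b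
  have hFc : ∀ b, DifferentiableAt ℝ (fun w => (starRingEnd ℂ) (fderiv ℂ T w (Pi.single k 1) b)) z :=
    fun b => (Complex.conjCLE : ℂ →L[ℝ] ℂ).differentiableAt.comp z ((hF b).restrictScalars ℝ)
  have hub : ∀ b, DifferentiableAt ℝ (wirtingerBar b u) (T z) := fun b =>
    (ht.wirtingerBar hs b).differentiableAt_of_isOpen hs hz
  have huT : ∀ b, DifferentiableAt ℝ (fun w => wirtingerBar b u (T w)) z := fun b =>
    (hub b).comp z (hTz.restrictScalars ℝ)
  change wirtinger j (wirtingerBar k (u ∘ T)) z = _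
  rw [wirtinger_congr h1, wirtinger_sum _ _ fun b _ => (huT b).fun_mul (hFc b)]
  simp only [Matrix.mul_apply, Matrix.of_apply]
  refine Finset.sum_congr rfl fun b _ => ?_
  rw [wirtinger_mul j (huT b) (hFc b), wirtinger_conj_holomorphic j (hF b), mul_zero, add_zero]
  congr 1
  rw [show (fun w => wirtingerBar b u (T w)) = wirtingerBar b u ∘ T from rfl,
    wirtinger_comp_holomorphic j hTz (hub b)]
  refine Finset.sum_congr rfl fun a _ => ?_
  rw [mul_comm]; rfl

end Wirtinger

/-! ### Derivatives of determinants and the Piola identity -/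

section Det

/-- Jacobi's formula for the derivative of a determinant. -/
theorem hasFDerivAt_det {𝕜 E ι : Type*} [NontriviallyNormedField 𝕜] [NormedAddCommGroup E]
    [NormedSpace 𝕜 E] [NormedAlgebra 𝕜 ℂ] [Fintype ι] [DecidableEq ι] {B : E → Matrix ι ι ℂ}
    {B' : ι → ι → E →L[𝕜] ℂ} {z : E} (hB : ∀ i j, HasFDerivAt (fun w => B w i j) (B' i j) z) :
    HasFDerivAt (fun w => (B w).det) (∑ i, ∑ j, (B z).adjugate j i • B' i j) z := by
  have h1 : HasFDerivAt (fun w => (B w).det) (∑ σ : Equiv.Perm ι, ((Equiv.Perm.sign σ : ℤ) : ℂ) •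
      ∑ i, (∏ j ∈ Finset.univ.erase i, B z (σ j) j) • B' (σ i) i) z := by
    have : (fun w => (B w).det) = fun w => ∑ σ : Equiv.Perm ι, ((Equiv.Perm.sign σ : ℤ) : ℂ) *
        ∏ i, B w (σ i) i := by
      funext w; rw [Matrix.det_apply']
    rw [this]
    refine HasFDerivAt.fun_sum fun σ _ => ?_
    exact (HasFDerivAt.finsetProd (g := fun i w => B w (σ i) i) fun i _ => hB (σ i) i).const_mul _
  convert h1 using 1
  ext v
  simp only [sum_apply, smul_apply, smul_eq_mul,
    Finset.mul_sum]
  have key : ∀ i, ∑ j, (B z).adjugate i j * (B' j i v) =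
      ∑ σ : Equiv.Perm ι, ((Equiv.Perm.sign σ : ℤ) : ℂ) *
        ((∏ j ∈ Finset.univ.erase i, B z (σ j) j) * B' (σ i) i v) := by
    intro i
    have := Matrix.mulVec_cramer (B z)
    have h2 : ((B z).updateCol i (fun j => B' j i v)).det =
        ∑ j, (B z).adjugate i j * (B' j i v) := by
      rw [← Matrix.cramer_apply, Matrix.cramer_eq_adjugate_mulVec]
      rfl
    rw [← h2, Matrix.det_apply']
    refine Finset.sum_congr rfl fun σ _ => ?_
    rw [← Finset.mul_prod_erase _ _ (Finset.mem_univ i), Matrix.updateCol_self, mul_comm (B' _ _ _)]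
    congr 2
    refine Finset.prod_congr rfl fun j hj => ?_
    rw [Matrix.updateCol_ne (Finset.ne_of_mem_erase hj)]
  rw [Finset.sum_comm, Finset.sum_congr rfl fun i _ => key i, Finset.sum_comm]

variable {n : ℕ} {B : Cn n → Matrix (Fin n) (Fin n) ℂ} {z : Cn n}

theorem wirtingerBar_det (hB : ∀ i j, DifferentiableAt ℝ (fun w => B w i j) z) (k : Fin n) :
    wirtingerBar k (fun w => (B w).det) z =
      ∑ i, ∑ j, (B z).adjugate j i * wirtingerBar k (fun w => B w i j) z := by
  rw [wirtingerBar, (hasFDerivAt_det fun i j => (hB i j).hasFDerivAt).fderiv]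
  simp only [wirtingerBar, sum_apply, smul_apply,
    smul_eq_mul, Finset.mul_sum, ← Finset.sum_add_distrib, Finset.sum_div]
  refine Finset.sum_congr rfl fun i _ => Finset.sum_congr rfl fun j _ => ?_
  ring

theorem wirtinger_det (hB : ∀ i j, DifferentiableAt ℝ (fun w => B w i j) z) (k : Fin n) :
    wirtinger k (fun w => (B w).det) z =
      ∑ i, ∑ j, (B z).adjugate j i * wirtinger k (fun w => B w i j) z := by
  rw [wirtinger, (hasFDerivAt_det fun i j => (hB i j).hasFDerivAt).fderiv]
  simp only [wirtinger, sum_apply, smul_apply,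
    smul_eq_mul, Finset.mul_sum, ← Finset.sum_sub_distrib, Finset.sum_div]
  refine Finset.sum_congr rfl fun i _ => Finset.sum_congr rfl fun j _ => ?_
  ring

theorem differentiableAt_det (hB : ∀ i j, DifferentiableAt ℝ (fun w => B w i j) z) :
    DifferentiableAt ℝ (fun w => (B w).det) z :=
  (hasFDerivAt_det fun i j => (hB i j).hasFDerivAt).differentiableAt

theorem differentiableAt_updateRow (hB : ∀ i j, DifferentiableAt ℝ (fun w => B w i j) z)
    (j : Fin n) (r : Fin n → ℂ) (a b : Fin n) :
    DifferentiableAt ℝ (fun w => (B w).updateRow j r a b) z := by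
  by_cases h : a = j
  · subst h; simp [Matrix.updateRow_self]
  · simpa [Matrix.updateRow_ne h] using hB a b

theorem differentiableAt_adjugate (hB : ∀ i j, DifferentiableAt ℝ (fun w => B w i j) z)
    (k j : Fin n) : DifferentiableAt ℝ (fun w => (B w).adjugate k j) z := by
  simp only [Matrix.adjugate_apply]
  exact differentiableAt_det (differentiableAt_updateRow hB _ _)

/-- The Piola identity: the columns of the cofactor matrix of a `∂̄`-closed matrix are free of
divergence. The derivative of a cofactor is a sum of minors with two rows `e_k`, `e_b`, which are
antisymmetric in `k, b`, times derivatives of `B`, which are symmetric. -/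
theorem piola (hB : ∀ i j, DifferentiableAt ℝ (fun w => B w i j) z)
    (hsym : ∀ a b k, wirtingerBar k (fun w => B w a b) z = wirtingerBar b (fun w => B w a k) z)
    (j : Fin n) : ∑ k, wirtingerBar k (fun w => (B w).adjugate k j) z = 0 := by
  have h1 : ∀ k, wirtingerBar k (fun w => (B w).adjugate k j) z =
      ∑ a, ∑ b, (((B z).updateRow j (Pi.single k 1)).updateRow a (Pi.single b 1)).det *
        (if a = j then 0 else wirtingerBar k (fun w => B w a b) z) := by
    intro k
    simp only [Matrix.adjugate_apply]
    rw [wirtingerBar_det (differentiableAt_updateRow hB _ _)]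
    refine Finset.sum_congr rfl fun a _ => Finset.sum_congr rfl fun b _ => ?_
    rw [Matrix.adjugate_apply]
    congr 1
    split_ifs with h
    · subst h; simp [Matrix.updateRow_self, wirtingerBar_const]
    · simp [Matrix.updateRow_ne h]
  simp only [h1]
  rw [Finset.sum_comm]
  refine Finset.sum_eq_zero fun a _ => ?_
  by_cases h : a = j
  · simp [h]
  simp only [h, if_false]
  set D : Fin n → Fin n → ℂ := fun k b =>
    (((B z).updateRow j (Pi.single k 1)).updateRow a (Pi.single b 1)).det with hD
  have hanti : ∀ k b, D k b = - D b k := by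
    intro k b
    have := Matrix.det_permute (Equiv.swap a j)
      (((B z).updateRow j (Pi.single b 1)).updateRow a (Pi.single k 1))
    rw [Equiv.Perm.sign_swap h] at this
    simp only [hD]
    rw [show ((((B z).updateRow j (Pi.single k 1)).updateRow a (Pi.single b 1))) =
      ((((B z).updateRow j (Pi.single b 1)).updateRow a (Pi.single k 1))).submatrix
        (Equiv.swap a j) id from ?_, this]
    · simp
    · ext x y
      by_cases hx : x = a
      · subst hx; simp [Matrix.updateRow_self, Matrix.updateRow_ne (Ne.symm h)]
      · by_cases hx' : x = j
        · subst hx'; simp [Matrix.updateRow_self, Matrix.updateRow_ne hx]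
        · simp [Equiv.swap_apply_of_ne_of_ne hx hx', Matrix.updateRow_ne hx,
            Matrix.updateRow_ne hx']
  have h2 : ∑ k, ∑ b, D k b * wirtingerBar k (fun w => B w a b) z =
      -∑ k, ∑ b, D k b * wirtingerBar k (fun w => B w a b) z := by
    conv_lhs => rw [Finset.sum_comm]
    simp only [← Finset.sum_neg_distrib]
    refine Finset.sum_congr rfl fun k _ => Finset.sum_congr rfl fun b _ => ?_
    rw [hanti b k, hsym a k b]; ring
  exact self_eq_neg.1 h2

/-- The product rule for `∑ₖ ∂̄ₖ (u ∑ⱼ adj(B)ₖⱼ ∂ⱼv)`; by `piola` the cofactors of a `∂̄`-closed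
matrix `B` are not differentiated. -/
theorem divergence_adjugate {s : Set (Cn n)} (hs : IsOpen s) {u v : Cn n → ℂ} (hz : z ∈ s)
    (hu : ContDiffOn ℝ ∞ u s) (hv : ContDiffOn ℝ ∞ v s)
    (hB : ∀ i j, DifferentiableAt ℝ (fun w => B w i j) z)
    (hsym : ∀ a b k, wirtingerBar k (fun w => B w a b) z = wirtingerBar b (fun w => B w a k) z) :
    ∑ k, wirtingerBar k (fun w => u w * ∑ j, (B w).adjugate k j * wirtinger j v w) z =
      ((B z).adjugate * (Matrix.of (fun j k => wirtinger j v z * wirtingerBar k u z) +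
        u z • complexHessian v z)).trace := by
  have hu' := hu.differentiableAt_of_isOpen hs hz
  have hv' := fun j => (hv.wirtinger hs j).differentiableAt_of_isOpen hs hz
  have hA := differentiableAt_adjugate hB
  have h1 : ∀ k, wirtingerBar k (fun w => u w * ∑ j, (B w).adjugate k j * wirtinger j v w) z =
      (∑ j, (B z).adjugate k j * (wirtinger j v z * wirtingerBar k u z +
        u z * complexHessian v z j k)) +
      u z * ∑ j, wirtingerBar k (fun w => (B w).adjugate k j) z * wirtinger j v z := by
    intro k
    rw [wirtingerBar_mul k hu' (DifferentiableAt.fun_sum fun j _ => (hA k j).fun_mul (hv' j)),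
      wirtingerBar_sum _ _ fun j _ => (hA k j).fun_mul (hv' j), Finset.mul_sum, Finset.mul_sum,
      Finset.mul_sum, ← Finset.sum_add_distrib, ← Finset.sum_add_distrib]
    refine Finset.sum_congr rfl fun j _ => ?_
    rw [wirtingerBar_mul k (hA k j) (hv' j), ← wirtinger_wirtingerBar_comm hs hv hz]
    simp only [complexHessian, Matrix.of_apply]
    ring
  simp only [h1, Finset.sum_add_distrib]
  have h2 : ∑ k, u z * ∑ j, wirtingerBar k (fun w => (B w).adjugate k j) z * wirtinger j v z = 0 := by
    rw [← Finset.mul_sum, Finset.sum_comm]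
    simp only [← Finset.sum_mul, piola hB hsym]
    simp
  rw [h2, add_zero]
  simp [Matrix.trace, Matrix.mul_apply]

end Det

/-! ### Change of charts -/

section Charts

theorem isOpen_transition {n : ℕ} {M : Type*} [TopologicalSpace M]
    (c c' : OpenPartialHomeomorph M (Cn n)) :
    IsOpen (c.target ∩ c.symm ⁻¹' c'.source) :=
  c.symm.isOpen_inter_preimage c'.open_source

theorem eventuallyEq_comp_transition {n : ℕ} {M : Type*} [TopologicalSpace M]
    {c : OpenPartialHomeomorph M (Cn n)} {z : Cn n} (c' : OpenPartialHomeomorph M (Cn n)) (u : M → ℂ)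
    (hz : z ∈ c.target) (hz' : c.symm z ∈ c'.source) :
    u ∘ c.symm =ᶠ[nhds z] (u ∘ c'.symm) ∘ (c' ∘ c.symm) := by
  filter_upwards [(isOpen_transition c c').mem_nhds ⟨hz, hz'⟩] with w hw
  simp [c'.left_inv hw.2]

variable {n : ℕ} {M : Type*} [TopologicalSpace M] [ChartedSpace (Cn n) M]

theorem contDiffOn_transition [IsManifold 𝓘(ℂ, Cn n) ω M] {c c' : OpenPartialHomeomorph M (Cn n)}
    (hc : c ∈ atlas (Cn n) M) (hc' : c' ∈ atlas (Cn n) M) :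
    ContDiffOn ℂ ω (c' ∘ c.symm) (c.target ∩ c.symm ⁻¹' c'.source) := by
  have h := ((contDiffGroupoid ω 𝓘(ℂ, Cn n)).compatible hc hc').1
  simpa [contDiffPregroupoid, OpenPartialHomeomorph.trans_source] using! h

theorem contDiffAt_transition [IsManifold 𝓘(ℂ, Cn n) ω M] {c c' : OpenPartialHomeomorph M (Cn n)}
    (hc : c ∈ atlas (Cn n) M) (hc' : c' ∈ atlas (Cn n) M) {z : Cn n} (hz : z ∈ c.target)
    (hz' : c.symm z ∈ c'.source) : ContDiffAt ℂ ω (c' ∘ c.symm) z :=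
  (contDiffOn_transition hc hc').contDiffAt ((isOpen_transition c c').mem_nhds ⟨hz, hz'⟩)

/-- The derivative of the inverse of a chart, read in the preferred chart of the target. -/
theorem chartInvDeriv_eq_fderiv [IsManifold 𝓘(ℂ, Cn n) ω M] {c : OpenPartialHomeomorph M (Cn n)}
    (hc : c ∈ atlas (Cn n) M) {z : Cn n} (hz : z ∈ c.target) :
    chartInvDeriv c z = fderiv ℂ (chartAt (Cn n) (c.symm z) ∘ c.symm) z := by
  have hmd : MDifferentiableAt 𝓘(ℂ, Cn n) 𝓘(ℂ, Cn n) c.symm z :=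
    mdifferentiableAt_atlas_symm (I := 𝓘(ℂ, Cn n)) (by
      exact hc) hz
  rw [chartInvDeriv, hmd.mfderiv]
  simp [writtenInExtChartAt]
  rfl

/-- `chartInvDeriv c z` as an endomorphism of `ℂⁿ`, in the coordinates of the preferred chart of
the target. -/
def chartCLM (c : OpenPartialHomeomorph M (Cn n)) (z : Cn n) : Cn n →L[ℂ] Cn n :=
  chartInvDeriv c z

/-- The matrix of `chartInvDeriv c z`. -/
def jac (c : OpenPartialHomeomorph M (Cn n)) (z : Cn n) : Matrix (Fin n) (Fin n) ℂ :=
  Matrix.of fun a j => chartCLM c z (Pi.single j 1) a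

theorem ContinuousLinearMap.apply_eq_sum_single (T : Cn n →L[ℂ] Cn n) (v : Cn n) (a : Fin n) :
    T v a = ∑ j, T (Pi.single j 1) a * v j := by
  have hv : v = ∑ j, v j • (Pi.single j 1 : Cn n) := by
    funext b
    simp [Finset.sum_apply, Pi.single_apply]
  conv_lhs => rw [hv]
  rw [map_sum, Finset.sum_apply]
  refine Finset.sum_congr rfl fun j _ => ?_
  rw [map_smul, Pi.smul_apply, smul_eq_mul, mul_comm]

theorem chartCLM_apply (c : OpenPartialHomeomorph M (Cn n)) (z v : Cn n) (a : Fin n) :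
    chartCLM c z v a = ∑ j, jac c z a j * v j :=
  (chartCLM c z).apply_eq_sum_single v a

theorem chartCLM_eq_fderiv [IsManifold 𝓘(ℂ, Cn n) ω M] {c : OpenPartialHomeomorph M (Cn n)}
    (hc : c ∈ atlas (Cn n) M) {z : Cn n} (hz : z ∈ c.target) :
    chartCLM c z = fderiv ℂ (chartAt (Cn n) (c.symm z) ∘ c.symm) z :=
  chartInvDeriv_eq_fderiv hc hz

/-- The pullback of a (1,1)-form under the inverse of a chart. -/
theorem map_oneOneForm (c : OpenPartialHomeomorph M (Cn n)) (z : Cn n)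
    (A : Matrix (Fin n) (Fin n) ℂ) :
    ExteriorAlgebra.map
      (LinearMap.lcomp ℂ ℂ (((chartInvDeriv c z).restrictScalars ℝ).toLinearMap))
      (oneOneForm (c.symm z) A) =
    oneOneCn ((jac c z).transpose * A * (jac c z).map (starRingEnd ℂ)) := by
  have h1 : ∀ a, LinearMap.lcomp ℂ ℂ (((chartInvDeriv c z).restrictScalars ℝ).toLinearMap)
      (dzAt (c.symm z) a) = ∑ j, jac c z a j • dzCn j := by
    intro a
    refine LinearMap.ext fun v => ?_
    change chartCLM c z v a = _
    simp [chartCLM_apply, dzCn]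
  have h2 : ∀ a, LinearMap.lcomp ℂ ℂ (((chartInvDeriv c z).restrictScalars ℝ).toLinearMap)
      (dzBarAt (c.symm z) a) = ∑ j, (starRingEnd ℂ) (jac c z a j) • dzBarCn j := by
    intro a
    refine LinearMap.ext fun v => ?_
    change (starRingEnd ℂ) (chartCLM c z v a) = _
    simp [chartCLM_apply, dzBarCn]
  simp only [oneOneForm, oneOneCn, map_smul, map_sum, map_mul, ExteriorAlgebra.map_apply_ι, h1, h2,
    Matrix.mul_apply, Matrix.transpose_apply, Matrix.map_apply]
  congr 1
  simp only [Finset.sum_mul, Finset.mul_sum, Finset.sum_smul, Finset.smul_sum, smul_mul_assoc,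
    mul_smul_comm, smul_smul]
  have : ∀ f : Fin n → Fin n → Fin n → Fin n → ExteriorAlgebra ℂ (Cn n →ₗ[ℝ] ℂ),
      ∑ a, ∑ b, ∑ j, ∑ k, f a b j k = ∑ k, ∑ j, ∑ b, ∑ a, f a b j k := by
    intro f
    calc _ = ∑ a, ∑ j, ∑ b, ∑ k, f a b j k :=
          Finset.sum_congr rfl fun a _ => Finset.sum_comm
      _ = ∑ j, ∑ a, ∑ b, ∑ k, f a b j k := Finset.sum_comm
      _ = ∑ j, ∑ a, ∑ k, ∑ b, f a b j k :=
          Finset.sum_congr rfl fun j _ => Finset.sum_congr rfl fun a _ => Finset.sum_comm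
      _ = ∑ j, ∑ k, ∑ a, ∑ b, f a b j k := Finset.sum_congr rfl fun j _ => Finset.sum_comm
      _ = ∑ j, ∑ k, ∑ b, ∑ a, f a b j k :=
          Finset.sum_congr rfl fun j _ => Finset.sum_congr rfl fun k _ => Finset.sum_comm
      _ = ∑ k, ∑ j, ∑ b, ∑ a, f a b j k := Finset.sum_comm
  rw [this]
  refine Finset.sum_congr rfl fun j _ => Finset.sum_congr rfl fun k _ => Finset.sum_congr rfl
    fun b _ => Finset.sum_congr rfl fun a _ => ?_
  congr 1
  ring

variable (n) in
/-- A function is smooth in all charts. -/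
def ChartSmooth (u : M → ℂ) : Prop :=
  ∀ c ∈ atlas (Cn n) M, ContDiffOn ℝ ∞ (u ∘ c.symm) c.target

/-- The matrix `∂ⱼ∂̄ₖu` at `x` in the preferred chart. -/
def hessAt (u : M → ℂ) (x : M) : Matrix (Fin n) (Fin n) ℂ :=
  complexHessian (u ∘ (chartAt (Cn n) x).symm) (chartAt (Cn n) x x)

/-- The vector `∂ⱼu` at `x` in the preferred chart. -/
def delAt (u : M → ℂ) (x : M) (j : Fin n) : ℂ :=
  wirtinger j (u ∘ (chartAt (Cn n) x).symm) (chartAt (Cn n) x x)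

/-- The vector `∂̄ₖu` at `x` in the preferred chart. -/
def delBarAt (u : M → ℂ) (x : M) (k : Fin n) : ℂ :=
  wirtingerBar k (u ∘ (chartAt (Cn n) x).symm) (chartAt (Cn n) x x)

section

variable [IsManifold 𝓘(ℂ, Cn n) ω M] {c : OpenPartialHomeomorph M (Cn n)} {u : M → ℂ} {z : Cn n}

theorem wirtinger_chart (hc : c ∈ atlas (Cn n) M) (hu : ChartSmooth n u) (hz : z ∈ c.target)
    (j : Fin n) : wirtinger j (u ∘ c.symm) z = ∑ a, delAt u (c.symm z) a * jac c z a j := by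
  have hz' := mem_chart_source (Cn n) (c.symm z)
  rw [wirtinger_congr (eventuallyEq_comp_transition (chartAt (Cn n) (c.symm z)) u hz hz'),
    wirtinger_comp_holomorphic]
  · simp [delAt, jac, chartCLM_eq_fderiv hc hz]
  · exact (contDiffAt_transition hc (chart_mem_atlas _ _) hz hz').differentiableAt (by simp)
  · exact (hu _ (chart_mem_atlas _ _)).differentiableAt_of_isOpen (chartAt _ _).open_target
      ((chartAt (Cn n) (c.symm z)).map_source hz')

theorem wirtingerBar_chart (hc : c ∈ atlas (Cn n) M) (hu : ChartSmooth n u) (hz : z ∈ c.target)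
    (j : Fin n) : wirtingerBar j (u ∘ c.symm) z =
      ∑ a, delBarAt u (c.symm z) a * (starRingEnd ℂ) (jac c z a j) := by
  have hz' := mem_chart_source (Cn n) (c.symm z)
  rw [wirtingerBar_congr (eventuallyEq_comp_transition (chartAt (Cn n) (c.symm z)) u hz hz'),
    wirtingerBar_comp_holomorphic]
  · simp [delBarAt, jac, chartCLM_eq_fderiv hc hz]
  · exact (contDiffAt_transition hc (chart_mem_atlas _ _) hz hz').differentiableAt (by simp)
  · exact (hu _ (chart_mem_atlas _ _)).differentiableAt_of_isOpen (chartAt _ _).open_target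
      ((chartAt (Cn n) (c.symm z)).map_source hz')

theorem complexHessian_chart (hc : c ∈ atlas (Cn n) M) (hu : ChartSmooth n u) (hz : z ∈ c.target) :
    complexHessian (u ∘ c.symm) z =
      (jac c z).transpose * hessAt u (c.symm z) * (jac c z).map (starRingEnd ℂ) := by
  have hz' := mem_chart_source (Cn n) (c.symm z)
  rw [complexHessian_congr (eventuallyEq_comp_transition (chartAt (Cn n) (c.symm z)) u hz hz'),
    complexHessian_comp_holomorphic (chartAt (Cn n) (c.symm z)).open_target
      (hu _ (chart_mem_atlas _ _))]
  · simp only [hessAt, jac, chartCLM_eq_fderiv hc hz]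
    rfl
  · filter_upwards [(isOpen_transition c (chartAt (Cn n) (c.symm z))).mem_nhds ⟨hz, hz'⟩] with w hw
    exact (contDiffAt_transition hc (chart_mem_atlas _ _) hw.1 hw.2).differentiableAt (by simp)
  · exact (contDiffAt_transition hc (chart_mem_atlas _ _) hz hz').of_le le_top
  · exact (chartAt (Cn n) (c.symm z)).map_source hz'

/-- The chain rule for two charts. -/
theorem jac_transition {c' : OpenPartialHomeomorph M (Cn n)} (hc : c ∈ atlas (Cn n) M)
    (hc' : c' ∈ atlas (Cn n) M) (hz : z ∈ c.target) (hz' : c.symm z ∈ c'.source) :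
    jac c z = jac c' (c' (c.symm z)) *
      Matrix.of fun a j => fderiv ℂ (c' ∘ c.symm) z (Pi.single j 1) a := by
  set x := c.symm z with hx
  have hx' : c'.symm (c' x) = x := c'.left_inv hz'
  have hzx := mem_chart_source (Cn n) x
  have hd1 : DifferentiableAt ℂ (chartAt (Cn n) x ∘ c'.symm) (c' x) :=
    (contDiffAt_transition hc' (chart_mem_atlas _ _) (c'.map_source hz')
      (by rw [hx']; exact hzx)).differentiableAt (by simp)
  have hd2 : DifferentiableAt ℂ (c' ∘ c.symm) z :=
    (contDiffAt_transition hc hc' hz hz').differentiableAt (by simp)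
  have h1 : (chartAt (Cn n) x ∘ c.symm) =ᶠ[nhds z]
      (chartAt (Cn n) x ∘ c'.symm) ∘ (c' ∘ c.symm) := by
    filter_upwards [(isOpen_transition c c').mem_nhds ⟨hz, hz'⟩] with w hw
    simp [c'.left_inv hw.2]
  ext a j
  have h2 : chartCLM c' (c' x) = fderiv ℂ (chartAt (Cn n) x ∘ c'.symm) (c' x) := by
    rw [chartCLM_eq_fderiv hc' (c'.map_source hz'), hx']
  have h3 := chartCLM_apply c' (c' x) (fderiv ℂ (c' ∘ c.symm) z (Pi.single j 1)) a
  rw [Matrix.mul_apply]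
  simp only [Matrix.of_apply]
  rw [← h3, h2, jac, Matrix.of_apply, chartCLM_eq_fderiv hc hz, ← hx, h1.fderiv_eq,
    fderiv_comp z hd1 hd2]
  rfl

theorem jac_chartAt (x : M) : jac (chartAt (Cn n) x) (chartAt (Cn n) x x) = 1 := by
  ext a j
  have hx := mem_chart_source (Cn n) x
  have hx' := (chartAt (Cn n) x).left_inv hx
  rw [jac, Matrix.of_apply, chartCLM_eq_fderiv (chart_mem_atlas _ _)
    ((chartAt (Cn n) x).map_source hx), hx']
  have : (chartAt (Cn n) x ∘ (chartAt (Cn n) x).symm) =ᶠ[nhds (chartAt (Cn n) x x)] id := by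
    filter_upwards [(chartAt (Cn n) x).open_target.mem_nhds ((chartAt (Cn n) x).map_source hx)]
      with w hw
    simp [(chartAt (Cn n) x).right_inv hw]
  rw [this.fderiv_eq, fderiv_id]
  simp [Matrix.one_apply, Pi.single_apply]

theorem det_jac_ne_zero (hc : c ∈ atlas (Cn n) M) (hz : z ∈ c.target) : (jac c z).det ≠ 0 := by
  set x := c.symm z with hx
  have hzx := mem_chart_source (Cn n) x
  have hcx : (chartAt (Cn n) x).symm (chartAt (Cn n) x x) = x := (chartAt (Cn n) x).left_inv hzx
  have hxs : x ∈ c.source := c.map_target hz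
  have h := jac_transition (z := chartAt (Cn n) x x) (chart_mem_atlas _ x) hc
    ((chartAt (Cn n) x).map_source hzx) (by rw [hcx]; exact hxs)
  rw [jac_chartAt, hcx, hx, c.right_inv hz] at h
  intro h0
  have := congrArg Matrix.det h
  rw [Matrix.det_mul, h0, zero_mul, Matrix.det_one] at this
  exact one_ne_zero this

end

theorem ContMDiff.chartSmooth_of [IsManifold 𝓘(ℂ, Cn n) ω M] {u : M → ℂ}
    (hu : ContMDiff 𝓘(ℝ, Cn n) 𝓘(ℝ, ℂ) ∞ u) : ChartSmooth n u := by
  intro c hc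
  have h1 : ContMDiffOn 𝓘(ℝ, Cn n) 𝓘(ℝ, Cn n) ∞ c.symm c.target :=
    contMDiffOn_symm_of_mem_maximalAtlas (IsManifold.subset_maximalAtlas hc)
  exact contMDiffOn_iff_contDiffOn.1 (hu.comp_contMDiffOn h1)

theorem realDiff_eq {u : M → ℂ} [IsManifold 𝓘(ℂ, Cn n) ω M]
    (hu : ContMDiff 𝓘(ℝ, Cn n) 𝓘(ℝ, ℂ) ∞ u) (x : M) (v : Cn n) :
    realDiff u x v = fderiv ℝ (u ∘ (chartAt (Cn n) x).symm) (chartAt (Cn n) x x) v := by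
  have hmd : MDifferentiableAt 𝓘(ℝ, Cn n) 𝓘(ℝ, ℂ) u x := hu.mdifferentiableAt (by simp)
  rw [realDiff, hmd.mfderiv]
  simp [writtenInExtChartAt]
  rfl

theorem delValue_eq {u : M → ℂ} [IsManifold 𝓘(ℂ, Cn n) ω M]
    (hu : ContMDiff 𝓘(ℝ, Cn n) 𝓘(ℝ, ℂ) ∞ u) (x : M) (v : Cn n) :
    delValue u x v = ∑ j, delAt u x j * v j := by
  have h : delValue u x v = (realDiff u x v - Complex.I * realDiff u x (Complex.I • v : Cn n)) / 2 :=
    rfl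
  rw [h, realDiff_eq hu, realDiff_eq hu, fderiv_eq_wirtinger, fderiv_eq_wirtinger,
    Finset.mul_sum, ← Finset.sum_sub_distrib, Finset.sum_div]
  refine Finset.sum_congr rfl fun a _ => ?_
  simp only [Pi.smul_apply, smul_eq_mul, map_mul, Complex.conj_I, delAt]
  ring_nf
  simp only [Complex.I_sq]
  ring

theorem delBarValue_eq {u : M → ℂ} [IsManifold 𝓘(ℂ, Cn n) ω M]
    (hu : ContMDiff 𝓘(ℝ, Cn n) 𝓘(ℝ, ℂ) ∞ u) (x : M) (v : Cn n) :
    delBarValue u x v = ∑ j, delBarAt u x j * (starRingEnd ℂ) (v j) := by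
  have h : delBarValue u x v = (realDiff u x v + Complex.I * realDiff u x (Complex.I • v : Cn n)) / 2 :=
    rfl
  rw [h, realDiff_eq hu, realDiff_eq hu, fderiv_eq_wirtinger, fderiv_eq_wirtinger,
    Finset.mul_sum, ← Finset.sum_add_distrib, Finset.sum_div]
  refine Finset.sum_congr rfl fun a _ => ?_
  simp only [Pi.smul_apply, smul_eq_mul, map_mul, Complex.conj_I, delBarAt]
  ring_nf
  simp only [Complex.I_sq]
  ring

end Charts

/-! ### The matrix of a Kähler form -/

section TwoForm

variable {n : ℕ} (α : (Cn n) [⋀^Fin 2]→L[ℝ] ℝ)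

theorem twoForm_swap (v w : Cn n) : α ![v, w] = -α ![w, v] := by
  have := α.toAlternatingMap.map_swap ![w, v] (i := 0) (j := 1) (by decide)
  rw [← ContinuousAlternatingMap.coe_toAlternatingMap, ← this]
  congr 1
  funext i
  fin_cases i <;> rfl

theorem twoForm_add_left (v v' w : Cn n) : α ![v + v', w] = α ![v, w] + α ![v', w] :=
  α.vecCons_add ![w] v v'

theorem twoForm_smul_left (a : ℝ) (v w : Cn n) : α ![a • v, w] = a * α ![v, w] :=
  α.vecCons_smul ![w] a v

theorem twoForm_add_right (v w w' : Cn n) : α ![v, w + w'] = α ![v, w] + α ![v, w'] := by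
  rw [twoForm_swap, twoForm_add_left, twoForm_swap α w, twoForm_swap α w']; ring

theorem twoForm_smul_right (a : ℝ) (v w : Cn n) : α ![v, a • w] = a * α ![v, w] := by
  rw [twoForm_swap, twoForm_smul_left, twoForm_swap α w]; ring

/-- The sesquilinear form `h` of a real `(1,1)`-form `α`, normalised so that
`α = (√-1/2π) ∑ hⱼₖ dzⱼ ∧ dz̄ₖ` with `hⱼₖ = h(eⱼ, eₖ)`. It is linear in the first variable. -/
def herm (v w : Cn n) : ℂ :=
  (Real.pi : ℂ) * ((α ![v, Complex.I • w] : ℂ) - Complex.I * (α ![v, w] : ℂ))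

theorem herm_add_left (v v' w : Cn n) : herm α (v + v') w = herm α v w + herm α v' w := by
  simp only [herm, twoForm_add_left]; push_cast; ring

theorem herm_add_right (v w w' : Cn n) : herm α v (w + w') = herm α v w + herm α v w' := by
  simp only [herm, smul_add, twoForm_add_right]; push_cast; ring

variable {α}

theorem twoForm_I_left (h11 : ∀ v w : Cn n, α ![Complex.I • v, Complex.I • w] = α ![v, w])
    (v w : Cn n) : α ![Complex.I • v, w] = -α ![v, Complex.I • w] := by
  rw [← h11 v (Complex.I • w), smul_smul, Complex.I_mul_I]
  have : ((-1 : ℂ) • w) = (-1 : ℝ) • w := by simp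
  rw [this, twoForm_smul_right]; ring

theorem complex_smul_eq (a : ℂ) (v : Cn n) : a • v = a.re • v + a.im • (Complex.I • v) := by
  funext i
  simp only [Pi.smul_apply, Pi.add_apply, smul_eq_mul, Complex.real_smul]
  conv_lhs => rw [← Complex.re_add_im a]
  ring

theorem herm_smul_left (h11 : ∀ v w : Cn n, α ![Complex.I • v, Complex.I • w] = α ![v, w])
    (a : ℂ) (v w : Cn n) : herm α (a • v) w = a * herm α v w := by
  rw [complex_smul_eq, herm_add_left]
  conv_rhs => rw [← Complex.re_add_im a]
  simp only [herm, twoForm_smul_left, h11, twoForm_I_left h11 v w]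
  push_cast
  ring_nf
  simp only [Complex.I_sq]
  ring

theorem herm_conj (h11 : ∀ v w : Cn n, α ![Complex.I • v, Complex.I • w] = α ![v, w])
    (v w : Cn n) : (starRingEnd ℂ) (herm α v w) = herm α w v := by
  simp only [herm, map_mul, map_sub, Complex.conj_ofReal, Complex.conj_I]
  rw [twoForm_swap α w (Complex.I • v), twoForm_I_left h11, twoForm_swap α w v]
  push_cast
  ring

theorem herm_smul_right (h11 : ∀ v w : Cn n, α ![Complex.I • v, Complex.I • w] = α ![v, w])
    (a : ℂ) (v w : Cn n) : herm α v (a • w) = (starRingEnd ℂ) a * herm α v w := by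
  rw [← herm_conj h11, herm_smul_left h11, map_mul, herm_conj h11]

theorem herm_eq_sum (h11 : ∀ v w : Cn n, α ![Complex.I • v, Complex.I • w] = α ![v, w])
    (v w : Cn n) : herm α v w = ∑ j, ∑ k,
      herm α (Pi.single j 1) (Pi.single k 1) * (v j * (starRingEnd ℂ) (w k)) := by
  have hs : ∀ v : Cn n, v = ∑ j, v j • (Pi.single j 1 : Cn n) := by
    intro v
    funext b
    simp [Finset.sum_apply, Pi.single_apply]
  have h0l : ∀ w, herm α 0 w = 0 := fun w => by simpa using herm_smul_left h11 0 0 w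
  have h0r : ∀ v, herm α v 0 = 0 := fun v => by simpa using herm_smul_right h11 0 v 0
  have hl : ∀ (s : Finset (Fin n)) (w : Cn n), herm α (∑ j ∈ s, v j • (Pi.single j 1 : Cn n)) w =
      ∑ j ∈ s, v j * herm α (Pi.single j 1) w := by
    intro s w
    induction s using Finset.induction_on with
    | empty => simp [h0l]
    | insert a s ha ih => rw [Finset.sum_insert ha, Finset.sum_insert ha, herm_add_left, ih,
        herm_smul_left h11]
  have hr : ∀ (s : Finset (Fin n)) (v : Cn n), herm α v (∑ j ∈ s, w j • (Pi.single j 1 : Cn n)) =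
      ∑ j ∈ s, (starRingEnd ℂ) (w j) * herm α v (Pi.single j 1) := by
    intro s v
    induction s using Finset.induction_on with
    | empty => simp [h0r]
    | insert a s ha ih => rw [Finset.sum_insert ha, Finset.sum_insert ha, herm_add_right, ih,
        herm_smul_right h11]
  conv_lhs => rw [hs v, hs w, hl]
  refine Finset.sum_congr rfl fun j _ => ?_
  rw [hr, Finset.mul_sum]
  exact Finset.sum_congr rfl fun k _ => by ring

/-- The matrix of `herm α` in the standard basis. -/
def hermMatrix (α : (Cn n) [⋀^Fin 2]→L[ℝ] ℝ) : Matrix (Fin n) (Fin n) ℂ :=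
  Matrix.of fun j k => herm α (Pi.single j 1) (Pi.single k 1)

open scoped ComplexOrder in
theorem hermMatrix_posDef (h11 : ∀ v w : Cn n, α ![Complex.I • v, Complex.I • w] = α ![v, w])
    (hpos : ∀ v : Cn n, v ≠ 0 → 0 < α ![v, Complex.I • v]) : (hermMatrix α).PosDef := by
  refine Matrix.PosDef.of_dotProduct_mulVec_pos ?_ fun x hx => ?_
  · ext j k
    simp only [hermMatrix, Matrix.conjTranspose_apply, Matrix.of_apply]
    exact herm_conj h11 _ _
  · have h1 : star x ⬝ᵥ (hermMatrix α).mulVec x = herm α (star x) (star x) := by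
      rw [herm_eq_sum h11]
      simp only [dotProduct, Matrix.mulVec, hermMatrix, Matrix.of_apply, Finset.mul_sum]
      refine Finset.sum_congr rfl fun j _ => Finset.sum_congr rfl fun k _ => ?_
      simp only [Pi.star_apply, RCLike.star_def, Complex.conj_conj]
      ring
    have h0 : α ![star x, star x] = 0 := by
      have := twoForm_swap α (star x) (star x); linarith
    rw [h1, herm, h0]
    have h2 := hpos (star x) (by simpa using hx)
    have h3 : (0 : ℝ) < Real.pi * α ![star x, Complex.I • star x] := mul_pos Real.pi_pos h2
    have h4 : (0 : ℂ) < ((Real.pi * α ![star x, Complex.I • star x] : ℝ) : ℂ) := by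
      exact_mod_cast h3
    simpa using h4

theorem hermMatrix_det_pos (h11 : ∀ v w : Cn n, α ![Complex.I • v, Complex.I • w] = α ![v, w])
    (hpos : ∀ v : Cn n, v ≠ 0 → 0 < α ![v, Complex.I • v]) :
    ∃ r : ℝ, 0 < r ∧ (hermMatrix α).det = r := by
  have h := (hermMatrix_posDef h11 hpos).det_pos
  rw [Complex.lt_def] at h
  exact ⟨(hermMatrix α).det.re, h.1, Complex.ext rfl h.2.symm⟩

end TwoForm

section ClosedForm

variable {n : ℕ} {F : Cn n → (Cn n) [⋀^Fin 2]→L[ℝ] ℝ} {z : Cn n}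

/-- The equation `dF = 0` on three constant vector fields. -/
theorem fderiv_twoForm_cocycle (hF : DifferentiableAt ℝ F z) (hcl : extDeriv F z = 0)
    (a b c : Cn n) :
    fderiv ℝ (fun w => F w ![b, c]) z a - fderiv ℝ (fun w => F w ![a, c]) z b +
      fderiv ℝ (fun w => F w ![a, b]) z c = 0 := by
  have h := extDeriv_apply hF ![a, b, c]
  rw [hcl, Fin.sum_univ_three] at h
  have e0 : (0 : Fin 3).removeNth ![a, b, c] = ![b, c] := by
    funext i; fin_cases i <;> rfl
  have e1 : (1 : Fin 3).removeNth ![a, b, c] = ![a, c] := by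
    funext i; fin_cases i <;> rfl
  have e2 : (2 : Fin 3).removeNth ![a, b, c] = ![a, b] := by
    funext i; fin_cases i <;> rfl
  rw [e0, e1, e2] at h
  simp at h
  linarith

theorem fderiv_twoForm_I
    (h11 : ∀ᶠ y in nhds z, ∀ v w : Cn n, F y ![Complex.I • v, Complex.I • w] = F y ![v, w])
    (a v w : Cn n) :
    fderiv ℝ (fun y => F y ![Complex.I • v, Complex.I • w]) z a =
      fderiv ℝ (fun y => F y ![v, w]) z a := by
  have : (fun y => F y ![Complex.I • v, Complex.I • w]) =ᶠ[nhds z] fun y => F y ![v, w] :=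
    h11.mono fun y hy => hy v w
  rw [this.fderiv_eq]

theorem fderiv_twoForm_I_left
    (h11 : ∀ᶠ y in nhds z, ∀ v w : Cn n, F y ![Complex.I • v, Complex.I • w] = F y ![v, w])
    (a v w : Cn n) :
    fderiv ℝ (fun y => F y ![Complex.I • v, w]) z a =
      -fderiv ℝ (fun y => F y ![v, Complex.I • w]) z a := by
  have : (fun y => F y ![Complex.I • v, w]) =ᶠ[nhds z] fun y => -F y ![v, Complex.I • w] :=
    h11.mono fun y hy => twoForm_I_left hy v w
  rw [this.fderiv_eq, fderiv_fun_neg]; rfl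

theorem fderiv_herm (hF : DifferentiableAt ℝ F z) (v w a : Cn n) :
    fderiv ℝ (fun y => herm (F y) v w) z a = (Real.pi : ℂ) *
      ((fderiv ℝ (fun y => F y ![v, Complex.I • w]) z a : ℂ) -
        Complex.I * (fderiv ℝ (fun y => F y ![v, w]) z a : ℂ)) := by
  have hd : ∀ m, DifferentiableAt ℝ (fun y => F y m) z := fun m =>
    (ContinuousAlternatingMap.apply ℝ (Cn n) ℝ m).differentiableAt.comp z hF
  have hc : ∀ m, HasFDerivAt (fun y => ((F y m : ℝ) : ℂ))
      (Complex.ofRealCLM.comp (fderiv ℝ (fun y => F y m) z)) z := fun m =>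
    Complex.ofRealCLM.hasFDerivAt.comp z (hd m).hasFDerivAt
  have := ((hc ![v, Complex.I • w]).fun_sub ((hc ![v, w]).const_mul Complex.I)).const_mul
    (Real.pi : ℂ)
  unfold herm
  rw [this.fderiv]
  simp

/-- The Kähler condition `∂ₐ hⱼₖ = ∂ⱼ hₐₖ`: it is a combination of `dF = 0` on the triples obtained from
`eₐ, eⱼ, eₖ` by multiplication of an even or odd number of them by `√-1`. -/
theorem wirtinger_hermMatrix_comm (hF : DifferentiableAt ℝ F z) (hcl : extDeriv F z = 0)
    (h11 : ∀ᶠ y in nhds z, ∀ v w : Cn n, F y ![Complex.I • v, Complex.I • w] = F y ![v, w])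
    (a j k : Fin n) :
    wirtinger a (fun y => hermMatrix (F y) j k) z =
      wirtinger j (fun y => hermMatrix (F y) a k) z := by
  have hI : ∀ j : Fin n, (Pi.single j Complex.I : Cn n) = Complex.I • Pi.single j 1 := by
    intro j; rw [← Pi.single_smul]; simp
  simp only [wirtinger, hermMatrix, Matrix.of_apply, fderiv_herm hF, hI]
  set A : Cn n := Pi.single a 1
  set J : Cn n := Pi.single j 1
  set K : Cn n := Pi.single k 1
  have c1 := fderiv_twoForm_cocycle hF hcl A J (Complex.I • K)
  have c2 := fderiv_twoForm_cocycle hF hcl (Complex.I • A) (Complex.I • J) (Complex.I • K)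
  have c3 := fderiv_twoForm_cocycle hF hcl A J K
  have c4 := fderiv_twoForm_cocycle hF hcl (Complex.I • A) (Complex.I • J) K
  simp only [fderiv_twoForm_I h11, fderiv_twoForm_I_left h11] at c1 c2 c3 c4
  have r1 := congrArg (fun r : ℝ => (r : ℂ)) c1
  have r2 := congrArg (fun r : ℝ => (r : ℂ)) c2
  have r3 := congrArg (fun r : ℝ => (r : ℂ)) c3
  have r4 := congrArg (fun r : ℝ => (r : ℂ)) c4
  push_cast at r1 r2 r3 r4
  linear_combination (Real.pi / 2 : ℂ) * (r1 + Complex.I ^ 2 * r2 - Complex.I * r3 + Complex.I * r4) -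
    (Real.pi / 2 : ℂ) * (fderiv ℝ (fun w => F w ![A, J]) z (Complex.I • K) : ℂ) * Complex.I_sq

theorem wirtingerBar_hermMatrix_comm (hF : DifferentiableAt ℝ F z) (hcl : extDeriv F z = 0)
    (h11 : ∀ᶠ y in nhds z, ∀ v w : Cn n, F y ![Complex.I • v, Complex.I • w] = F y ![v, w])
    (b j k : Fin n) :
    wirtingerBar b (fun y => hermMatrix (F y) j k) z =
      wirtingerBar k (fun y => hermMatrix (F y) j b) z := by
  have h1 : ∀ j k l : Fin n, wirtingerBar l (fun y => hermMatrix (F y) j k) z =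
      (starRingEnd ℂ) (wirtinger l (fun y => hermMatrix (F y) k j) z) := by
    intro j k l
    have e : (fun y => hermMatrix (F y) j k) =ᶠ[nhds z]
        fun y => (Complex.conjCLE : ℂ →L[ℝ] ℂ) (hermMatrix (F y) k j) :=
      h11.mono fun y hy => (herm_conj hy _ _).symm
    have hd : DifferentiableAt ℝ (fun y => hermMatrix (F y) k j) z := by
      have hd : ∀ m, DifferentiableAt ℝ (fun y => F y m) z := fun m =>
        (ContinuousAlternatingMap.apply ℝ (Cn n) ℝ m).differentiableAt.comp z hF
      have hc : ∀ m, DifferentiableAt ℝ (fun y => ((F y m : ℝ) : ℂ)) z := fun m =>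
        Complex.ofRealCLM.differentiableAt.comp z (hd m)
      exact ((hc _).fun_sub ((hc _).const_mul Complex.I)).const_mul (Real.pi : ℂ)
    have := ((Complex.conjCLE : ℂ →L[ℝ] ℂ).hasFDerivAt.comp z hd.hasFDerivAt).fderiv
    rw [wirtingerBar_congr e, wirtingerBar, wirtinger]
    change (fderiv ℝ ((Complex.conjCLE : ℂ →L[ℝ] ℂ) ∘ fun y => hermMatrix (F y) k j) z _ +
      Complex.I * fderiv ℝ ((Complex.conjCLE : ℂ →L[ℝ] ℂ) ∘ fun y => hermMatrix (F y) k j) z _) / 2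
      = _
    rw [this]
    have h2 : (starRingEnd ℂ) 2 = 2 := Complex.conj_ofNat 2
    simp [h2]
  rw [h1, h1, wirtinger_hermMatrix_comm hF hcl h11]

end ClosedForm

section Kahler

variable {n : ℕ} {M : Type*} [TopologicalSpace M] [ChartedSpace (Cn n) M]

/-- A vector field in the coordinates of the preferred charts. -/
def toCn (X : ∀ x : M, TSpace n x) (x : M) : Cn n := X x

namespace KahlerForm

variable (Ω : KahlerForm n M)

/-- The Kähler form at `x` in the coordinates of the preferred chart. -/
def formCn (x : M) : (Cn n) [⋀^Fin 2]→L[ℝ] ℝ := Ω.form x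

/-- The matrix of the metric at `x` in the coordinates of the preferred chart. -/
def gAt (x : M) : Matrix (Fin n) (Fin n) ℂ := hermMatrix (Ω.formCn x)

theorem formCn_I (x : M) (v w : Cn n) :
    Ω.formCn x ![Complex.I • v, Complex.I • w] = Ω.formCn x ![v, w] := Ω.type_one_one x v w

theorem chartForm_apply (c : OpenPartialHomeomorph M (Cn n)) (z v w : Cn n) :
    chartForm c Ω.form z ![v, w] = Ω.formCn (c.symm z) ![chartCLM c z v, chartCLM c z w] := by
  change Ω.formCn (c.symm z) (_ ∘ ![v, w]) = _
  congr 1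
  funext i
  fin_cases i <;> rfl

theorem chartForm_I (c : OpenPartialHomeomorph M (Cn n)) (z v w : Cn n) :
    chartForm c Ω.form z ![Complex.I • v, Complex.I • w] = chartForm c Ω.form z ![v, w] := by
  rw [chartForm_apply, chartForm_apply, map_smul, map_smul, formCn_I]

theorem metricMatrix_eq_hermMatrix (c : OpenPartialHomeomorph M (Cn n)) (z : Cn n) :
    Ω.metricMatrix c z = hermMatrix (chartForm c Ω.form z) := by
  ext j k
  have hI : (Pi.single k Complex.I : Cn n) = Complex.I • Pi.single k 1 := by
    rw [← Pi.single_smul]; simp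
  simp [metricMatrix, hermMatrix, herm, hI]

theorem metricMatrix_eq (c : OpenPartialHomeomorph M (Cn n)) (z : Cn n) :
    Ω.metricMatrix c z =
      (jac c z).transpose * Ω.gAt (c.symm z) * (jac c z).map (starRingEnd ℂ) := by
  ext j k
  rw [metricMatrix_eq_hermMatrix]
  have : hermMatrix (chartForm c Ω.form z) j k = herm (Ω.formCn (c.symm z))
      (chartCLM c z (Pi.single j 1)) (chartCLM c z (Pi.single k 1)) := by
    simp only [hermMatrix, herm, Matrix.of_apply, chartForm_apply, map_smul]
  rw [this, herm_eq_sum (Ω.formCn_I _)]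
  simp only [Matrix.mul_apply, Matrix.transpose_apply, Matrix.map_apply, Finset.sum_mul]
  rw [Finset.sum_comm]
  refine Finset.sum_congr rfl fun b _ => Finset.sum_congr rfl fun a _ => ?_
  simp only [gAt, hermMatrix, jac, Matrix.of_apply]
  ring

theorem det_gAt_pos (x : M) : ∃ r : ℝ, 0 < r ∧ (Ω.gAt x).det = r :=
  hermMatrix_det_pos (Ω.formCn_I x) fun v hv => Ω.pos x v hv

theorem differentiableAt_chartForm {c : OpenPartialHomeomorph M (Cn n)} (hc : c ∈ atlas (Cn n) M)
    {z : Cn n} (hz : z ∈ c.target) : DifferentiableAt ℝ (chartForm c Ω.form) z :=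
  ((Ω.smooth c hc).differentiableOn (by simp)).differentiableAt (c.open_target.mem_nhds hz)

theorem contDiffOn_metricMatrix {c : OpenPartialHomeomorph M (Cn n)} (hc : c ∈ atlas (Cn n) M)
    (j k : Fin n) : ContDiffOn ℝ ∞ (fun z => Ω.metricMatrix c z j k) c.target := by
  have hd : ∀ m, ContDiffOn ℝ ∞ (fun y => chartForm c Ω.form y m) c.target := fun m =>
    (ContinuousAlternatingMap.apply ℝ (Cn n) ℝ m).contDiff.comp_contDiffOn (Ω.smooth c hc)
  have hc' : ∀ m, ContDiffOn ℝ ∞ (fun y => ((chartForm c Ω.form y m : ℝ) : ℂ)) c.target :=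
    fun m => Complex.ofRealCLM.contDiff.comp_contDiffOn (hd m)
  exact contDiffOn_const.mul ((hc' _).sub (contDiffOn_const.mul (hc' _)))

theorem wirtinger_metricMatrix_comm {c : OpenPartialHomeomorph M (Cn n)}
    (hc : c ∈ atlas (Cn n) M) {z : Cn n} (hz : z ∈ c.target) (a j k : Fin n) :
    wirtinger a (fun y => Ω.metricMatrix c y j k) z =
      wirtinger j (fun y => Ω.metricMatrix c y a k) z := by
  simp only [metricMatrix_eq_hermMatrix]
  exact wirtinger_hermMatrix_comm (Ω.differentiableAt_chartForm hc hz) (Ω.closed c hc z hz)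
    (Filter.Eventually.of_forall fun y => Ω.chartForm_I c y) a j k

theorem wirtingerBar_metricMatrix_comm {c : OpenPartialHomeomorph M (Cn n)}
    (hc : c ∈ atlas (Cn n) M) {z : Cn n} (hz : z ∈ c.target) (b j k : Fin n) :
    wirtingerBar b (fun y => Ω.metricMatrix c y j k) z =
      wirtingerBar k (fun y => Ω.metricMatrix c y j b) z := by
  simp only [metricMatrix_eq_hermMatrix]
  exact wirtingerBar_hermMatrix_comm (Ω.differentiableAt_chartForm hc hz) (Ω.closed c hc z hz)
    (Filter.Eventually.of_forall fun y => Ω.chartForm_I c y) b j k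

variable [IsManifold 𝓘(ℂ, Cn n) ω M]

theorem metricMatrix_chartAt (x : M) :
    Ω.metricMatrix (chartAt (Cn n) x) (chartAt (Cn n) x x) = Ω.gAt x := by
  rw [metricMatrix_eq, jac_chartAt, (chartAt (Cn n) x).left_inv (mem_chart_source _ x)]
  simp [Matrix.map_one]

theorem toForm_eq (x : M) : Ω.toForm x = oneOneForm x (Ω.gAt x) := by
  rw [toForm, metricMatrix_chartAt]

theorem det_metricMatrix_pos {c : OpenPartialHomeomorph M (Cn n)} (hc : c ∈ atlas (Cn n) M)
    {z : Cn n} (hz : z ∈ c.target) : ∃ r : ℝ, 0 < r ∧ (Ω.metricMatrix c z).det = r := by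
  obtain ⟨r, hr, h⟩ := Ω.det_gAt_pos (c.symm z)
  refine ⟨Complex.normSq (jac c z).det * r,
    mul_pos (Complex.normSq_pos.2 (det_jac_ne_zero hc hz)) hr, ?_⟩
  have hm : ((jac c z).map (starRingEnd ℂ)).det = (starRingEnd ℂ) (jac c z).det :=
    ((starRingEnd ℂ).map_det (jac c z)).symm
  rw [metricMatrix_eq, Matrix.det_mul, Matrix.det_mul, Matrix.det_transpose, h, hm]
  push_cast
  rw [← Complex.mul_conj]
  ring

/-- The equation `i(X)Ω = (√-1/2π) ∂̄θ` in coordinates: `∑ⱼ Xⱼ gⱼₖ̄ = ∂̄ₖθ`. -/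
theorem sum_gAt_mul {X : ∀ x : M, TSpace n x} {θ : M → ℂ} (h : Ω.IsPotentialOf X θ) (x : M)
    (k : Fin n) : ∑ j, toCn X x j * Ω.gAt x j k = delBarAt θ x k := by
  have h1 : ∀ v : Cn n, Ω.contractValue X x v =
      Complex.I / (2 * Real.pi) * herm (Ω.formCn x) (toCn X x) v := by
    intro v
    have h2 : Ω.contractValue X x v = ((Ω.formCn x ![toCn X x, v] : ℂ) -
        Complex.I * (Ω.formCn x ![Complex.I • toCn X x, v] : ℂ)) / 2 := rfl
    rw [h2, twoForm_I_left (Ω.formCn_I x), herm]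
    have : (Real.pi : ℂ) ≠ 0 := by exact_mod_cast Real.pi_ne_zero
    field_simp
    push_cast
    ring_nf
    simp only [Complex.I_sq]
    ring
  have h2 := h.2 x (Pi.single k 1 : Cn n)
  rw [h1, delBarValue_eq h.1] at h2
  have hp : (Complex.I / (2 * Real.pi) : ℂ) ≠ 0 := by
    have : (Real.pi : ℂ) ≠ 0 := by exact_mod_cast Real.pi_ne_zero
    simp [this]
  have h3 := mul_left_cancel₀ hp h2
  rw [herm_eq_sum (Ω.formCn_I x)] at h3
  simp only [Pi.single_apply, apply_ite (starRingEnd ℂ), map_one, map_zero, mul_ite, mul_one,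
    mul_zero, Finset.sum_ite_eq', Finset.mem_univ, if_true] at h3
  rw [← h3]
  refine Finset.sum_congr rfl fun j _ => ?_
  rw [mul_comm]; rfl

end KahlerForm

end Kahler

/-! ### Integration of densities -/

section Euclidean

variable {n : ℕ}

theorem ContDiffOn.matrix_det {s : Set (Cn n)} {B : Cn n → Matrix (Fin n) (Fin n) ℂ}
    (hB : ∀ i j, ContDiffOn ℝ ∞ (fun z => B z i j) s) :
    ContDiffOn ℝ ∞ (fun z => (B z).det) s := by
  simp only [Matrix.det_apply']
  exact ContDiffOn.sum fun σ _ => contDiffOn_const.mul (contDiffOn_prod fun i _ => hB _ _)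

theorem ContDiffOn.matrix_adjugate {s : Set (Cn n)} {B : Cn n → Matrix (Fin n) (Fin n) ℂ}
    (hB : ∀ i j, ContDiffOn ℝ ∞ (fun z => B z i j) s) (k j : Fin n) :
    ContDiffOn ℝ ∞ (fun z => (B z).adjugate k j) s := by
  simp only [Matrix.adjugate_apply]
  refine ContDiffOn.matrix_det fun a b => ?_
  by_cases h : a = j
  · subst h; simpa [Matrix.updateRow_self] using contDiffOn_const
  · simpa [Matrix.updateRow_ne h] using hB a b

theorem integral_fderiv_eq_zero {g : Cn n → ℂ} (hg : ContDiff ℝ ∞ g) (hc : HasCompactSupport g)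
    (v : Cn n) : ∫ z, fderiv ℝ g z v = 0 := by
  have hcont : Continuous fun z => fderiv ℝ g z v :=
    (hg.continuous_fderiv (by simp)).clm_apply continuous_const
  have hcs : HasCompactSupport fun z => fderiv ℝ g z v := hc.fderiv_apply ℝ v
  have h := integral_smul_fderiv_eq_neg_fderiv_smul_of_integrable (𝕜 := ℝ)
    (μ := MeasureTheory.volume) (f := fun _ : Cn n => (1 : ℝ)) (g := g) (v := v)
    (by simp)
    (by simpa using hcont.integrable_of_hasCompactSupport hcs)
    (by simpa using hg.continuous.integrable_of_hasCompactSupport hc)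
    (fun x _ => differentiableAt_const _) (fun x _ => hg.differentiable (by simp) x)
  simpa using h

/-- Stokes' theorem on an open set of `ℂⁿ`: the extension by zero of `g` is smooth with compact
support. -/
theorem integral_wirtingerBar_eq_zero {g : Cn n → ℂ} {s K : Set (Cn n)} (hs : IsOpen s)
    (hg : ContDiffOn ℝ ∞ g s) (hK : IsCompact K) (hKs : K ⊆ s) (h0 : ∀ z ∈ s, z ∉ K → g z = 0)
    (k : Fin n) : ∫ z in s, wirtingerBar k g z = 0 := by
  set G : Cn n → ℂ := s.indicator g with hG
  have hG0 : ∀ z, z ∉ K → G z = 0 := by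
    intro z hz
    by_cases h : z ∈ s
    · rw [hG, Set.indicator_of_mem h, h0 z h hz]
    · rw [hG, Set.indicator_of_notMem h]
  have hsm : ContDiff ℝ ∞ G := by
    rw [contDiff_iff_contDiffAt]
    intro z
    by_cases h : z ∈ s
    · have : G =ᶠ[nhds z] g := by
        filter_upwards [hs.mem_nhds h] with w hw
        rw [hG, Set.indicator_of_mem hw]
      exact (hg.contDiffAt (hs.mem_nhds h)).congr_of_eventuallyEq this
    · have : G =ᶠ[nhds z] fun _ => 0 := by
        filter_upwards [hK.isClosed.isOpen_compl.mem_nhds fun hz => h (hKs hz)] with w hw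
        exact hG0 w hw
      exact contDiffAt_const.congr_of_eventuallyEq this
  have hcs : HasCompactSupport G := HasCompactSupport.intro hK hG0
  have hcont : ∀ v, Continuous fun z => fderiv ℝ G z v := fun v =>
    (hsm.continuous_fderiv (by simp)).clm_apply continuous_const
  have hint : ∀ v, MeasureTheory.Integrable (fun z => fderiv ℝ G z v) := fun v =>
    (hcont v).integrable_of_hasCompactSupport (hcs.fderiv_apply ℝ v)
  have h1 : ∀ z ∈ s, wirtingerBar k g z = wirtingerBar k G z := by
    intro z hz
    refine wirtingerBar_congr ?_
    filter_upwards [hs.mem_nhds hz] with w hw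
    rw [hG, Set.indicator_of_mem hw]
  have h2 : ∀ z, z ∉ s → wirtingerBar k G z = 0 := by
    intro z hz
    have : G =ᶠ[nhds z] fun _ => 0 := by
      filter_upwards [hK.isClosed.isOpen_compl.mem_nhds fun hz' => hz (hKs hz')] with w hw
      exact hG0 w hw
    rw [wirtingerBar_congr this, wirtingerBar_const]
  rw [MeasureTheory.setIntegral_congr_fun hs.measurableSet h1,
    MeasureTheory.setIntegral_eq_integral_of_forall_compl_eq_zero h2]
  simp only [wirtingerBar]
  rw [MeasureTheory.integral_div, MeasureTheory.integral_add (hint _) ((hint _).const_mul _),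
    MeasureTheory.integral_const_mul, integral_fderiv_eq_zero hsm hcs,
    integral_fderiv_eq_zero hsm hcs]
  simp

/-- The real Jacobian of a complex linear map is the square of the modulus of its complex determinant. -/
theorem abs_det_restrictScalars (T : Cn n →L[ℂ] Cn n) :
    |(T.restrictScalars ℝ).det| =
      Complex.normSq (Matrix.of fun a j => T (Pi.single j 1) a : Matrix (Fin n) (Fin n) ℂ).det := by
  have h1 : (T.restrictScalars ℝ).det = Complex.normSq (LinearMap.det T.toLinearMap) := by
    rw [← Algebra.norm_complex_apply, ← LinearMap.det_restrictScalars]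
    rfl
  have h2 : LinearMap.det T.toLinearMap =
      (Matrix.of fun a j => T (Pi.single j 1) a : Matrix (Fin n) (Fin n) ℂ).det := by
    rw [← LinearMap.det_toMatrix']
    congr 1
  rw [h1, h2, abs_of_nonneg (Complex.normSq_nonneg _)]

end Euclidean

theorem isCompact_image_chart {n : ℕ} {M : Type*} [TopologicalSpace M] [CompactSpace M]
    {c : OpenPartialHomeomorph M (Cn n)} {K : Set M} (hK : IsClosed K)
    (hKc : K ⊆ c.source) : IsCompact (c '' K) ∧ c '' K ⊆ c.target ∧
      ∀ z ∈ c.target, z ∉ c '' K → c.symm z ∉ K := by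
  refine ⟨hK.isCompact.image_of_continuousOn (c.continuousOn.mono hKc), ?_, ?_⟩
  · rintro _ ⟨x, hx, rfl⟩
    exact c.map_source (hKc hx)
  · intro z hz hz' hK'
    exact hz' ⟨_, hK', c.right_inv hz⟩

section Density

variable {n : ℕ} {M : Type*} [TopologicalSpace M] [ChartedSpace (Cn n) M]

/-- The density with coefficient `w x` at `x` in the preferred chart, read in the chart `c`. -/
def chartDensity (c : OpenPartialHomeomorph M (Cn n)) (w : M → ℂ) (z : Cn n) : ℂ :=
  (Complex.normSq (jac c z).det : ℂ) * w (c.symm z)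

variable (n) in
/-- A density that is continuous in all charts. -/
def ContDensity (w : M → ℂ) : Prop :=
  ∀ c ∈ atlas (Cn n) M, ContinuousOn (chartDensity c w) c.target

theorem ContDensity.add {w w' : M → ℂ} (h : ContDensity n w) (h' : ContDensity n w') :
    ContDensity n fun x => w x + w' x := by
  intro c hc
  refine ((h c hc).add (h' c hc)).congr fun z _ => ?_
  simp [chartDensity, mul_add]

theorem ContDensity.const_mul {w : M → ℂ} (a : ℂ) (h : ContDensity n w) :
    ContDensity n fun x => a * w x := by
  intro c hc
  refine ((h c hc).const_mul a).congr fun z _ => ?_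
  simp only [chartDensity]; ring

theorem ContDensity.sum {ι : Type*} (s : Finset ι) {w : ι → M → ℂ}
    (h : ∀ i ∈ s, ContDensity n (w i)) : ContDensity n fun x => ∑ i ∈ s, w i x := by
  intro c hc
  refine (continuousOn_finsetSum s fun i hi => h i hi c hc).congr fun z _ => ?_
  simp [chartDensity, Finset.mul_sum]

/-- The transformation law of densities, with the real Jacobian as needed for the change of
variables in integrals. -/
theorem chartDensity_transition [IsManifold 𝓘(ℂ, Cn n) ω M] {c c' : OpenPartialHomeomorph M (Cn n)}
    (hc : c ∈ atlas (Cn n) M) (hc' : c' ∈ atlas (Cn n) M) (w : M → ℂ) {z : Cn n}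
    (hz : z ∈ c.target) (hz' : c.symm z ∈ c'.source) :
    chartDensity c w z = (|((fderiv ℂ (c' ∘ c.symm) z).restrictScalars ℝ).det| : ℝ) *
      chartDensity c' w (c' (c.symm z)) := by
  rw [abs_det_restrictScalars, chartDensity, chartDensity, jac_transition hc hc' hz hz',
    Matrix.det_mul, Complex.normSq_mul, c'.left_inv hz']
  push_cast
  ring

theorem integrableOn_of_compact {s K : Set (Cn n)} {g : Cn n → ℂ} (hs : IsOpen s)
    (hg : ContinuousOn g s) (hK : IsCompact K) (hKs : K ⊆ s) (h0 : ∀ z ∈ s, z ∉ K → g z = 0) :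
    MeasureTheory.IntegrableOn g s :=
  MeasureTheory.IntegrableOn.of_forall_sdiff_eq_zero
    ((hg.mono hKs).integrableOn_compact hK) hs.measurableSet fun z hz => h0 z hz.1 hz.2

variable [T2Space M] [CompactSpace M] [IsManifold 𝓘(ℂ, Cn n) ω M]

variable (n M) in
/-- The charts whose function in the partition of unity is not zero. -/
def activeCharts : Finset M :=
  (((chartPartition n M).locallyFinite.finite_nonempty_of_compact :
    {p | (Function.support (chartPartition n M p)).Nonempty}.Finite)).toFinset

theorem chartPartition_eq_zero {p : M} (hp : p ∉ activeCharts n M) (x : M) :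
    chartPartition n M p x = 0 := by
  by_contra h
  refine hp ?_
  rw [activeCharts, Set.Finite.mem_toFinset]
  exact ⟨x, h⟩

theorem tsupport_chartPartition (p : M) :
    tsupport (chartPartition n M p) ⊆ (chartAt (Cn n) p).source :=
  (SmoothPartitionOfUnity.exists_isSubordinate_chartAt_source 𝓘(ℝ, Cn n) M).choose_spec p

theorem sum_chartPartition (x : M) :
    ∑ p ∈ activeCharts n M, (chartPartition n M p x : ℂ) = 1 := by
  have h := (chartPartition n M).sum_eq_one (Set.mem_univ x)
  rw [finsum_eq_sum_of_support_subset (s := activeCharts n M)] at h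
  · exact_mod_cast h
  · intro p hp
    by_contra h'
    exact hp (chartPartition_eq_zero h' x)

variable (n) in
/-- The integral of a density, by the partition of unity that `formIntegral` uses. -/
def densInt (w : M → ℂ) : ℂ :=
  ∑ᶠ p : M, ∫ z in (chartAt (Cn n) p).target,
    (chartPartition n M p ((chartAt (Cn n) p).symm z) : ℂ) * chartDensity (chartAt (Cn n) p) w z

theorem densInt_eq_sum (w : M → ℂ) : densInt n w =
    ∑ p ∈ activeCharts n M, ∫ z in (chartAt (Cn n) p).target,
      (chartPartition n M p ((chartAt (Cn n) p).symm z) : ℂ) *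
        chartDensity (chartAt (Cn n) p) w z := by
  rw [densInt, finsum_eq_sum_of_support_subset]
  intro p hp
  by_contra h'
  exact hp (by simp [chartPartition_eq_zero h'])

theorem continuousOn_chartPartition (p : M) (c : OpenPartialHomeomorph M (Cn n)) :
    ContinuousOn (fun z => (chartPartition n M p (c.symm z) : ℂ)) c.target :=
  Complex.continuous_ofReal.comp_continuousOn
    ((chartPartition n M p).2.continuous.comp_continuousOn c.symm.continuousOn)

theorem integrableOn_chartPartition_mul {w : M → ℂ} (hw : ContDensity n w) (p : M) :
    MeasureTheory.IntegrableOn (fun z => (chartPartition n M p ((chartAt (Cn n) p).symm z) : ℂ) *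
      chartDensity (chartAt (Cn n) p) w z) (chartAt (Cn n) p).target := by
  obtain ⟨h1, h2, h3⟩ := isCompact_image_chart (isClosed_tsupport _)
    (tsupport_chartPartition (n := n) p)
  refine integrableOn_of_compact (chartAt (Cn n) p).open_target
    ((continuousOn_chartPartition p _).mul (hw _ (chart_mem_atlas _ _))) h1 h2 fun z hz hz' => ?_
  rw [image_eq_zero_of_notMem_tsupport (h3 z hz hz')]
  simp

theorem densInt_add {w w' : M → ℂ} (hw : ContDensity n w) (hw' : ContDensity n w') :
    densInt n (fun x => w x + w' x) = densInt n w + densInt n w' := by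
  rw [densInt_eq_sum, densInt_eq_sum, densInt_eq_sum, ← Finset.sum_add_distrib]
  refine Finset.sum_congr rfl fun p _ => ?_
  rw [← MeasureTheory.integral_add (integrableOn_chartPartition_mul hw p)
    (integrableOn_chartPartition_mul hw' p)]
  congr 1
  funext z
  simp only [chartDensity]; ring

theorem densInt_const_mul (a : ℂ) (w : M → ℂ) :
    densInt n (fun x => a * w x) = a * densInt n w := by
  rw [densInt_eq_sum, densInt_eq_sum, Finset.mul_sum]
  refine Finset.sum_congr rfl fun p _ => ?_
  rw [← MeasureTheory.integral_const_mul]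
  congr 1
  funext z
  simp only [chartDensity]; ring

theorem densInt_sum {ι : Type*} (s : Finset ι) {w : ι → M → ℂ}
    (hw : ∀ i ∈ s, ContDensity n (w i)) :
    densInt n (fun x => ∑ i ∈ s, w i x) = ∑ i ∈ s, densInt n (w i) := by
  classical
  induction s using Finset.induction_on with
  | empty =>
    have := densInt_const_mul (n := n) 0 (fun _ : M => (0 : ℂ))
    simpa using this
  | insert a s ha ih =>
    simp only [Finset.sum_insert ha]
    rw [densInt_add (hw a (Finset.mem_insert_self _ _))
      (ContDensity.sum s fun i hi => hw i (Finset.mem_insert_of_mem hi)),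
      ih fun i hi => hw i (Finset.mem_insert_of_mem hi)]

/-- The integral of a density supported in one chart is computed in that chart. -/
theorem densInt_eq_of_support {c : OpenPartialHomeomorph M (Cn n)} (hc : c ∈ atlas (Cn n) M)
    {w : M → ℂ} (hw : ContDensity n w) {K : Set M} (hK : IsClosed K) (hKc : K ⊆ c.source)
    (h0 : ∀ x, x ∉ K → w x = 0) : densInt n w = ∫ z in c.target, chartDensity c w z := by
  obtain ⟨h1, h2, h3⟩ := isCompact_image_chart hK hKc
  have key : ∀ p : M, ∫ z in (chartAt (Cn n) p).target,
      (chartPartition n M p ((chartAt (Cn n) p).symm z) : ℂ) * chartDensity (chartAt (Cn n) p) w z =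
      ∫ z in c.target, (chartPartition n M p (c.symm z) : ℂ) * chartDensity c w z := by
    intro p
    set c' := chartAt (Cn n) p with hc'def
    have hc' : c' ∈ atlas (Cn n) M := chart_mem_atlas _ _
    set U := c.target ∩ c.symm ⁻¹' c'.source with hU
    set V := c'.target ∩ c'.symm ⁻¹' c.source with hV
    have hUo : IsOpen U := isOpen_transition c c'
    have hVU : V = (c' ∘ c.symm) '' U := by
      ext z
      constructor
      · rintro ⟨hz, hz'⟩
        refine ⟨c (c'.symm z), ⟨c.map_source hz', ?_⟩, ?_⟩
        · simp only [Set.mem_preimage, c.left_inv hz']; exact c'.map_target hz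
        · simp [c.left_inv hz', c'.right_inv hz]
      · rintro ⟨y, ⟨hy, hy'⟩, rfl⟩
        refine ⟨c'.map_source hy', ?_⟩
        simp only [Function.comp, Set.mem_preimage, c'.left_inv hy']
        exact c.map_target hy
    have e1 : ∫ z in c'.target, (chartPartition n M p (c'.symm z) : ℂ) * chartDensity c' w z =
        ∫ z in V, (chartPartition n M p (c'.symm z) : ℂ) * chartDensity c' w z := by
      refine MeasureTheory.setIntegral_eq_of_subset_of_forall_sdiff_eq_zero
        c'.open_target.measurableSet Set.inter_subset_left fun z hz => ?_
      have : c'.symm z ∉ K := fun h => hz.2 ⟨hz.1, hKc h⟩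
      simp [chartDensity, h0 _ this]
    have e2 : ∫ z in c.target, (chartPartition n M p (c.symm z) : ℂ) * chartDensity c w z =
        ∫ z in U, (chartPartition n M p (c.symm z) : ℂ) * chartDensity c w z := by
      refine MeasureTheory.setIntegral_eq_of_subset_of_forall_sdiff_eq_zero
        c.open_target.measurableSet Set.inter_subset_left fun z hz => ?_
      have : c.symm z ∉ tsupport (chartPartition n M p) := fun h =>
        hz.2 ⟨hz.1, tsupport_chartPartition p h⟩
      simp [image_eq_zero_of_notMem_tsupport this]
    have hinj : Set.InjOn (c' ∘ c.symm) U := by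
      intro y hy y' hy' h
      exact c.symm.injOn hy.1 hy'.1 (c'.injOn hy.2 hy'.2 h)
    rw [e1, e2, hVU, MeasureTheory.integral_image_eq_integral_abs_det_fderiv_smul
      MeasureTheory.volume hUo.measurableSet (fun z hz => (((contDiffAt_transition hc hc' hz.1
        hz.2).differentiableAt (by simp)).hasFDerivAt.restrictScalars ℝ).hasFDerivWithinAt) hinj]
    refine MeasureTheory.setIntegral_congr_fun hUo.measurableSet fun z hz => ?_
    simp only [Function.comp, c'.left_inv hz.2, Complex.real_smul]
    rw [chartDensity_transition hc hc' w hz.1 hz.2]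
    simp only [Function.comp_def]
    ring
  rw [densInt_eq_sum, Finset.sum_congr rfl fun p _ => key p, ← MeasureTheory.integral_finsetSum]
  · refine MeasureTheory.setIntegral_congr_fun c.open_target.measurableSet fun z _ => ?_
    simp only [← Finset.sum_mul, sum_chartPartition, one_mul]
  · intro p _
    refine integrableOn_of_compact c.open_target
      ((continuousOn_chartPartition p _).mul (hw _ hc)) h1 h2 fun z hz hz' => ?_
    simp [chartDensity, h0 _ (h3 z hz hz')]

end Density

/-! ### The divergence theorem on `M` -/

/-- `B ↦ adj B` scales under `B ↦ Jᵀ B J̄` so that `tr (adj(B) C)` is a density. -/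
theorem Matrix.trace_adjugate_congr {n : ℕ} (J B C : Matrix (Fin n) (Fin n) ℂ) :
    ((J.transpose * B * J.map (starRingEnd ℂ)).adjugate *
      (J.transpose * C * J.map (starRingEnd ℂ))).trace =
      (Complex.normSq J.det : ℂ) * (B.adjugate * C).trace := by
  set Jc := J.map (starRingEnd ℂ) with hJc
  have hm : Jc.det = (starRingEnd ℂ) J.det := ((starRingEnd ℂ).map_det J).symm
  have h1 : (J.transpose * B * Jc).adjugate * (J.transpose * C * Jc) =
      Jc.adjugate * (J.det • (B.adjugate * C)) * Jc := by
    rw [Matrix.adjugate_mul_distrib, Matrix.adjugate_mul_distrib]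
    calc _ = Jc.adjugate * (B.adjugate * ((J.transpose.adjugate * J.transpose) * C)) * Jc := by
          simp only [Matrix.mul_assoc]
      _ = _ := by
          rw [Matrix.adjugate_mul, Matrix.det_transpose, Matrix.smul_mul, Matrix.one_mul,
            Matrix.mul_smul]
  rw [h1, Matrix.trace_mul_comm, ← Matrix.mul_assoc, Matrix.mul_adjugate, hm, Matrix.smul_mul,
    Matrix.one_mul, smul_smul, Matrix.trace_smul, smul_eq_mul, mul_comm ((starRingEnd ℂ) _),
    Complex.mul_conj]

section Stokes

variable {n : ℕ} {M : Type*} [TopologicalSpace M] [ChartedSpace (Cn n) M]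

variable (n) in
/-- The matrix of the form `∂̄(u ∂v)`, up to a constant: `∂ⱼv ∂̄ₖu + u ∂ⱼ∂̄ₖv`. -/
def delBarMulDel (u v : M → ℂ) (x : M) : Matrix (Fin n) (Fin n) ℂ :=
  Matrix.of (fun j k => delAt v x j * delBarAt u x k) + u x • hessAt v x

theorem ChartSmooth.mul {u v : M → ℂ} (hu : ChartSmooth n u) (hv : ChartSmooth n v) :
    ChartSmooth n fun x => u x * v x := fun c hc => (hu c hc).mul (hv c hc)

theorem delBarMulDel_eq_zero {u v : M → ℂ} {K : Set M} (hK : IsClosed K) (h0 : ∀ x, x ∉ K → u x = 0)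
    {x : M} (hx : x ∉ K) : delBarMulDel n u v x = 0 := by
  have h1 : ∀ k : Fin n, delBarAt u x k = 0 := by
    intro k
    have hs := mem_chart_source (Cn n) x
    have : u ∘ (chartAt (Cn n) x).symm =ᶠ[nhds (chartAt (Cn n) x x)] fun _ => 0 := by
      have hcont : ContinuousAt (chartAt (Cn n) x).symm (chartAt (Cn n) x x) :=
        (chartAt (Cn n) x).continuousAt_symm ((chartAt (Cn n) x).map_source hs)
      have hmem : Kᶜ ∈ nhds ((chartAt (Cn n) x).symm (chartAt (Cn n) x x)) := by
        rw [(chartAt (Cn n) x).left_inv hs]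
        exact hK.isOpen_compl.mem_nhds hx
      filter_upwards [hcont hmem] with w hw
      exact h0 _ hw
    rw [delBarAt, wirtingerBar_congr this, wirtingerBar_const]
  ext j k
  simp [delBarMulDel, h1, h0 x hx]

namespace KahlerForm

variable (Ω : KahlerForm n M)

/-- The matrix of `Ω + t (√-1/2π) ∂∂̄f` at `x`. -/
def deformAt (f : M → ℂ) (t : ℂ) (x : M) : Matrix (Fin n) (Fin n) ℂ := Ω.gAt x + t • hessAt f x

/-- The matrix of `Ω + t (√-1/2π) ∂∂̄f` in the chart `c`. -/
def deformMatrix (f : M → ℂ) (t : ℂ) (c : OpenPartialHomeomorph M (Cn n)) (z : Cn n) :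
    Matrix (Fin n) (Fin n) ℂ := Ω.metricMatrix c z + t • complexHessian (f ∘ c.symm) z

section

variable {c : OpenPartialHomeomorph M (Cn n)} {f : M → ℂ}

theorem contDiffOn_deformMatrix (hc : c ∈ atlas (Cn n) M) (hf : ChartSmooth n f) (t : ℂ)
    (i j : Fin n) : ContDiffOn ℝ ∞ (fun z => Ω.deformMatrix f t c z i j) c.target :=
  (Ω.contDiffOn_metricMatrix hc i j).add (contDiffOn_const.mul
    (((hf c hc).wirtingerBar c.open_target j).wirtinger c.open_target i))

theorem wirtingerBar_deformMatrix_comm (hc : c ∈ atlas (Cn n) M) (hf : ChartSmooth n f) (t : ℂ)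
    {z : Cn n} (hz : z ∈ c.target) (a b k : Fin n) :
    wirtingerBar k (fun w => Ω.deformMatrix f t c w a b) z =
      wirtingerBar b (fun w => Ω.deformMatrix f t c w a k) z := by
  have hg := fun i j => (Ω.contDiffOn_metricMatrix hc i j).differentiableAt_of_isOpen
    c.open_target hz
  have hh := fun i j => (((hf c hc).wirtingerBar c.open_target j).wirtinger
    c.open_target i).differentiableAt_of_isOpen c.open_target hz
  have key : ∀ b k, wirtingerBar k (fun w => Ω.deformMatrix f t c w a b) z =
      wirtingerBar k (fun w => Ω.metricMatrix c w a b) z +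
        t * wirtingerBar k (fun w => complexHessian (f ∘ c.symm) w a b) z := by
    intro b k
    refine (wirtingerBar_add k (hg a b) ((hh a b).const_mul t)).trans ?_
    rw [wirtingerBar_const_mul k t (hh a b)]
    rfl
  rw [key, key, Ω.wirtingerBar_metricMatrix_comm hc hz,
    wirtingerBar_complexHessian_comm c.open_target (hf c hc) hz]

theorem contDiffOn_divergence_field (hc : c ∈ atlas (Cn n) M) (hf : ChartSmooth n f) {u v : M → ℂ}
    (hu : ChartSmooth n u) (hv : ChartSmooth n v) (t : ℂ) (k : Fin n) :
    ContDiffOn ℝ ∞ (fun w => (u ∘ c.symm) w *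
      ∑ j, (Ω.deformMatrix f t c w).adjugate k j * wirtinger j (v ∘ c.symm) w) c.target :=
  (hu c hc).mul (ContDiffOn.sum fun j _ =>
    (ContDiffOn.matrix_adjugate (fun a b => Ω.contDiffOn_deformMatrix hc hf t a b) k j).mul
      ((hv c hc).wirtinger c.open_target j))

variable [IsManifold 𝓘(ℂ, Cn n) ω M]

theorem deformMatrix_eq (hc : c ∈ atlas (Cn n) M) (hf : ChartSmooth n f) (t : ℂ) {z : Cn n}
    (hz : z ∈ c.target) : Ω.deformMatrix f t c z =
      (jac c z).transpose * Ω.deformAt f t (c.symm z) * (jac c z).map (starRingEnd ℂ) := by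
  rw [deformMatrix, deformAt, metricMatrix_eq, complexHessian_chart hc hf hz, Matrix.mul_add,
    Matrix.add_mul, Matrix.mul_smul, Matrix.smul_mul]

theorem delBarMulDel_chart (hc : c ∈ atlas (Cn n) M) {u v : M → ℂ} (hu : ChartSmooth n u)
    (hv : ChartSmooth n v) {z : Cn n} (hz : z ∈ c.target) :
    Matrix.of (fun j k => wirtinger j (v ∘ c.symm) z * wirtingerBar k (u ∘ c.symm) z) +
        (u ∘ c.symm) z • complexHessian (v ∘ c.symm) z =
      (jac c z).transpose * delBarMulDel n u v (c.symm z) * (jac c z).map (starRingEnd ℂ) := by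
  rw [delBarMulDel, complexHessian_chart hc hv hz, Matrix.mul_add, Matrix.add_mul,
    Matrix.mul_smul, Matrix.smul_mul]
  congr 1
  ext j k
  simp only [Matrix.of_apply, wirtinger_chart hc hv hz, wirtingerBar_chart hc hu hz,
    Matrix.mul_apply, Matrix.transpose_apply, Matrix.map_apply, Finset.sum_mul, Finset.mul_sum]
  refine Finset.sum_congr rfl fun a _ => Finset.sum_congr rfl fun b _ => ?_
  ring

/-- The function `∂̄(u ∂v) ∧ (Ω + t (√-1/2π) ∂∂̄f)ⁿ⁻¹` is a divergence in each chart. -/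
theorem chartDensity_divergence (hc : c ∈ atlas (Cn n) M) (hf : ChartSmooth n f) {u v : M → ℂ}
    (hu : ChartSmooth n u) (hv : ChartSmooth n v) (t : ℂ) {z : Cn n} (hz : z ∈ c.target) :
    chartDensity c (fun x => ((Ω.deformAt f t x).adjugate * delBarMulDel n u v x).trace) z =
      ∑ k, wirtingerBar k (fun w => (u ∘ c.symm) w *
        ∑ j, (Ω.deformMatrix f t c w).adjugate k j * wirtinger j (v ∘ c.symm) w) z := by
  rw [divergence_adjugate c.open_target hz (hu c hc) (hv c hc)
    (fun i j => (Ω.contDiffOn_deformMatrix hc hf t i j).differentiableAt_of_isOpen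
      c.open_target hz) (fun a b k => Ω.wirtingerBar_deformMatrix_comm hc hf t hz a b k),
    Ω.deformMatrix_eq hc hf t hz, delBarMulDel_chart hc hu hv hz, Matrix.trace_adjugate_congr,
    chartDensity]

theorem contDensity_divergence (hf : ChartSmooth n f) {u v : M → ℂ}
    (hu : ChartSmooth n u) (hv : ChartSmooth n v) (t : ℂ) :
    ContDensity n fun x => ((Ω.deformAt f t x).adjugate * delBarMulDel n u v x).trace := by
  intro c hc
  refine (ContinuousOn.congr ?_ fun z hz => Ω.chartDensity_divergence hc hf hu hv t hz)
  exact continuousOn_finsetSum _ fun k _ =>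
    ((Ω.contDiffOn_divergence_field hc hf hu hv t k).wirtingerBar c.open_target k).continuousOn

end

variable [T2Space M] [CompactSpace M] [IsManifold 𝓘(ℂ, Cn n) ω M]

theorem chartSmooth_chartPartition (p : M) :
    ChartSmooth n fun x => (chartPartition n M p x : ℂ) :=
  ContMDiff.chartSmooth_of (Complex.ofRealCLM.contDiff.contMDiff.comp (chartPartition n M p).2)

/-- Stokes' theorem: `∫ ∂̄(u ∂v) ∧ (Ω + t (√-1/2π) ∂∂̄f)ⁿ⁻¹ = 0`. The integrand is linear in `u`, so
a partition of unity reduces the claim to functions `u` supported in a chart. -/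
theorem densInt_divergence {f u v : M → ℂ} (hf : ChartSmooth n f) (hu : ChartSmooth n u)
    (hv : ChartSmooth n v) (t : ℂ) :
    densInt n (fun x => ((Ω.deformAt f t x).adjugate * delBarMulDel n u v x).trace) = 0 := by
  set U : M → M → ℂ := fun p x => (chartPartition n M p x : ℂ) * u x with hU
  have hUs : ∀ p, ChartSmooth n (U p) := fun p => (chartSmooth_chartPartition p).mul hu
  have hsum : ∀ x, u x = ∑ p ∈ activeCharts n M, U p x := by
    intro x
    simp only [hU]
    rw [← Finset.sum_mul, sum_chartPartition, one_mul]
  have hdb : ∀ x, delBarMulDel n u v x = ∑ p ∈ activeCharts n M, delBarMulDel n (U p) v x := by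
    intro x
    have h1 : ∀ k : Fin n, delBarAt u x k = ∑ p ∈ activeCharts n M, delBarAt (U p) x k := by
      intro k
      have hs := mem_chart_source (Cn n) x
      have : u ∘ (chartAt (Cn n) x).symm = fun w =>
          ∑ p ∈ activeCharts n M, (U p ∘ (chartAt (Cn n) x).symm) w := funext fun w => hsum _
      rw [delBarAt, this, wirtingerBar_sum]
      · rfl
      · intro p _
        exact (hUs p _ (chart_mem_atlas _ _)).differentiableAt_of_isOpen (chartAt _ x).open_target
          ((chartAt (Cn n) x).map_source hs)
    ext j k
    simp only [delBarMulDel, Matrix.sum_apply, Matrix.add_apply, Matrix.of_apply,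
      Matrix.smul_apply, smul_eq_mul, Finset.sum_add_distrib, h1, ← Finset.mul_sum,
      ← Finset.sum_mul, ← hsum]
  have hint : (fun x => ((Ω.deformAt f t x).adjugate * delBarMulDel n u v x).trace) = fun x =>
      ∑ p ∈ activeCharts n M,
        ((Ω.deformAt f t x).adjugate * delBarMulDel n (U p) v x).trace := by
    funext x
    rw [hdb, Matrix.mul_sum, Matrix.trace_sum]
  rw [hint, densInt_sum _ fun p _ => Ω.contDensity_divergence hf (hUs p) hv t]
  refine Finset.sum_eq_zero fun p _ => ?_
  have hc := chart_mem_atlas (Cn n) p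
  have hU0 : ∀ x, x ∉ tsupport (chartPartition n M p) → U p x = 0 := by
    intro x hx
    simp [hU, image_eq_zero_of_notMem_tsupport hx]
  have hsub := tsupport_chartPartition (n := n) p
  rw [densInt_eq_of_support hc (Ω.contDensity_divergence hf (hUs p) hv t) (isClosed_tsupport _) hsub
    fun x hx => by rw [delBarMulDel_eq_zero (isClosed_tsupport _) hU0 hx]; simp]
  rw [MeasureTheory.setIntegral_congr_fun (chartAt (Cn n) p).open_target.measurableSet
    fun z hz => Ω.chartDensity_divergence hc hf (hUs p) hv t hz]
  obtain ⟨h1, h2, h3⟩ := isCompact_image_chart (isClosed_tsupport _) hsub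
  have hV := fun k => Ω.contDiffOn_divergence_field hc hf (hUs p) hv t k
  have hV0 : ∀ k, ∀ z ∈ (chartAt (Cn n) p).target,
      z ∉ chartAt (Cn n) p '' tsupport (chartPartition n M p) →
      (fun w => (U p ∘ (chartAt (Cn n) p).symm) w * ∑ j,
        (Ω.deformMatrix f t (chartAt (Cn n) p) w).adjugate k j *
          wirtinger j (v ∘ (chartAt (Cn n) p).symm) w) z = 0 := by
    intro k z hz hz'
    simp [hU0 _ (h3 z hz hz')]
  rw [MeasureTheory.integral_finsetSum]
  · exact Finset.sum_eq_zero fun k _ => integral_wirtingerBar_eq_zero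
      (chartAt (Cn n) p).open_target (hV k) h1 h2 (hV0 k) k
  · intro k _
    refine integrableOn_of_compact (chartAt (Cn n) p).open_target
      ((hV k).wirtingerBar (chartAt (Cn n) p).open_target k).continuousOn h1 h2 fun z hz hz' => ?_
    have : (fun w => (U p ∘ (chartAt (Cn n) p).symm) w * ∑ j,
        (Ω.deformMatrix f t (chartAt (Cn n) p) w).adjugate k j *
          wirtinger j (v ∘ (chartAt (Cn n) p).symm) w) =ᶠ[nhds z] fun _ => 0 := by
      filter_upwards [(chartAt (Cn n) p).open_target.mem_nhds hz,
        h1.isClosed.isOpen_compl.mem_nhds hz'] with w hw hw'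
      exact hV0 k w hw hw'
    rw [wirtingerBar_congr this, wirtingerBar_const]

end KahlerForm

end Stokes

/-! ### Holomorphic potentials -/

section Injective

variable {n : ℕ}

/-- The alternating form that reads off the coefficient of `dzⱼ ∧ dz̄ₖ`. -/
def coeffForm (j k : Fin n) : (Cn n →ₗ[ℝ] ℂ) [⋀^Fin 2]→ₗ[ℂ] ℂ :=
  (Matrix.detRowAlternating (n := Fin 2) (R := ℂ)).compLinearMap
    (LinearMap.pi fun b : Fin 2 => (2⁻¹ : ℂ) •
      if b = 0 then LinearMap.applyₗ' ℂ (Pi.single j 1 : Cn n) -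
        Complex.I • LinearMap.applyₗ' ℂ (Pi.single j Complex.I : Cn n)
      else LinearMap.applyₗ' ℂ (Pi.single k 1 : Cn n) +
        Complex.I • LinearMap.applyₗ' ℂ (Pi.single k Complex.I : Cn n))

theorem coeffForm_dz (j k a b : Fin n) :
    coeffForm j k ![dzCn a, dzBarCn b] = (if a = j then 1 else 0) * (if b = k then 1 else 0) := by
  change Matrix.det (n := Fin 2) (R := ℂ) (Matrix.of fun i l => _) = _
  rw [Matrix.det_fin_two]
  by_cases h : a = j <;> by_cases h' : b = k <;>
    simp [dzCn, dzBarCn, Pi.single_apply, h, h'] <;> norm_num <;>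
    exact Or.inl (by split_ifs <;> norm_num)

theorem oneOneCn_injective : Function.Injective (oneOneCn (n := n)) := by
  intro A B h
  have key : ∀ (A : Matrix (Fin n) (Fin n) ℂ) (j k : Fin n),
      ExteriorAlgebra.liftAlternating
        (Pi.single (M := fun i : ℕ => (Cn n →ₗ[ℝ] ℂ) [⋀^Fin i]→ₗ[ℂ] ℂ) 2 (coeffForm j k))
        (oneOneCn A) = Complex.I / (2 * Real.pi) * A j k := by
    intro A j k
    have h2 : ∀ a b, ExteriorAlgebra.ι ℂ (dzCn a) * ExteriorAlgebra.ι ℂ (dzBarCn (n := n) b) =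
        ExteriorAlgebra.ιMulti ℂ 2 ![dzCn a, dzBarCn b] := by
      intro a b
      simp [ExteriorAlgebra.ιMulti_apply]
    simp only [oneOneCn, map_smul, map_sum, h2, ExteriorAlgebra.liftAlternating_apply_ιMulti,
      Pi.single_eq_same, coeffForm_dz, smul_eq_mul]
    congr 1
    simp
  ext j k
  have h1 := key A j k
  rw [h, key B j k] at h1
  have hp : (Complex.I / (2 * Real.pi) : ℂ) ≠ 0 := by
    have : (Real.pi : ℂ) ≠ 0 := by exact_mod_cast Real.pi_ne_zero
    simp [this]
  exact (mul_left_cancel₀ hp h1).symm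

end Injective

section Holomorphic

variable {n : ℕ} {M : Type*} [TopologicalSpace M] [ChartedSpace (Cn n) M]
  [IsManifold 𝓘(ℂ, Cn n) ω M]

/-- The coordinates of `X` in the preferred chart of `p` are holomorphic near `p`. -/
theorem IsHolomorphicVectorField.contDiffAt {X : ∀ x : M, TSpace n x}
    (hX : IsHolomorphicVectorField X) (p : M) :
    ContDiffAt ℂ ω (fun z => (jac (chartAt (Cn n) p) z)⁻¹.mulVec
      (toCn X ((chartAt (Cn n) p).symm z))) (chartAt (Cn n) p p) := by
  have hs := mem_chart_source (Cn n) p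
  set c := chartAt (Cn n) p with hc
  have h1 : ContMDiffAt 𝓘(ℂ, Cn n) 𝓘(ℂ, Cn n) ω
      (fun x => (trivializationAt (Cn n) (TangentSpace 𝓘(ℂ, Cn n)) p
        (⟨x, X x⟩ : TangentBundle 𝓘(ℂ, Cn n) M)).2) p :=
    (Bundle.contMDiffAt_totalSpace.1 (hX p)).2
  have h2 : ContMDiffAt 𝓘(ℂ, Cn n) 𝓘(ℂ, Cn n) ω c.symm (c p) :=
    (contMDiffOn_symm_of_mem_maximalAtlas (IsManifold.subset_maximalAtlas
      (chart_mem_atlas (Cn n) p))).contMDiffAt (c.open_target.mem_nhds (c.map_source hs))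
  have h3 : ContMDiffAt 𝓘(ℂ, Cn n) 𝓘(ℂ, Cn n) ω
      ((fun x => (trivializationAt (Cn n) (TangentSpace 𝓘(ℂ, Cn n)) p
        (⟨x, X x⟩ : TangentBundle 𝓘(ℂ, Cn n) M)).2) ∘ c.symm) (c p) := by
    refine ContMDiffAt.comp (c p) ?_ h2
    rw [c.left_inv hs]
    exact h1
  refine (contMDiffAt_iff_contDiffAt.1 h3).congr_of_eventuallyEq ?_
  filter_upwards [c.open_target.mem_nhds (c.map_source hs)] with z hz
  set x := c.symm z with hx
  have hxs : x ∈ c.source := c.map_target hz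
  have hxx := mem_chart_source (Cn n) x
  have hcx := (chartAt (Cn n) x).left_inv hxx
  have h4 : (trivializationAt (Cn n) (TangentSpace 𝓘(ℂ, Cn n)) p
        (⟨x, X x⟩ : TangentBundle 𝓘(ℂ, Cn n) M)).2 =
      fderiv ℂ (c ∘ (chartAt (Cn n) x).symm) (chartAt (Cn n) x x) (toCn X x) := by
    rw [TangentBundle.trivializationAt_apply]
    simp
    rfl
  have h5 := jac_transition (z := chartAt (Cn n) x x) (chart_mem_atlas _ x)
    (chart_mem_atlas (Cn n) p) ((chartAt (Cn n) x).map_source hxx) (by rw [hcx]; exact hxs)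
  rw [jac_chartAt, hcx, hx, c.right_inv hz, ← hx] at h5
  rw [Matrix.inv_eq_right_inv h5.symm]
  refine Eq.trans ?_ h4.symm
  funext a
  rw [ContinuousLinearMap.apply_eq_sum_single]
  rfl

end Holomorphic

section LogDet

variable {n : ℕ}

theorem contDiffOn_log_det {s : Set (Cn n)} {G : Cn n → Matrix (Fin n) (Fin n) ℂ}
    (hG : ∀ i j, ContDiffOn ℝ ∞ (fun z => G z i j) s)
    (hpos : ∀ z ∈ s, ∃ r : ℝ, 0 < r ∧ (G z).det = r) :
    ContDiffOn ℝ ∞ (fun w => (Real.log (G w).det.re : ℂ)) s := by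
  have h1 : ContDiffOn ℝ ∞ (fun w => (G w).det.re) s :=
    Complex.reCLM.contDiff.comp_contDiffOn (ContDiffOn.matrix_det hG)
  have h2 : ContDiffOn ℝ ∞ (fun w => Real.log (G w).det.re) s := h1.log fun z hz => by
    obtain ⟨r, hr, h⟩ := hpos z hz
    rw [h]
    exact hr.ne'
  exact Complex.ofRealCLM.contDiff.comp_contDiffOn h2

theorem wirtinger_log_det {s : Set (Cn n)} (hs : IsOpen s) {G : Cn n → Matrix (Fin n) (Fin n) ℂ}
    (hG : ∀ i j, ContDiffOn ℝ ∞ (fun z => G z i j) s)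
    (hpos : ∀ z ∈ s, ∃ r : ℝ, 0 < r ∧ (G z).det = r) {z : Cn n} (hz : z ∈ s) (l : Fin n) :
    wirtinger l (fun w => (Real.log (G w).det.re : ℂ)) z =
      ∑ i, ∑ j, (G z)⁻¹ j i * wirtinger l (fun w => G w i j) z := by
  have hd := fun i j => (hG i j).differentiableAt_of_isOpen hs hz
  have h1 : (fun w => (Real.log (G w).det.re : ℂ)) =ᶠ[nhds z] fun w => Complex.log (G w).det := by
    filter_upwards [hs.mem_nhds hz] with w hw
    obtain ⟨r, hr, h⟩ := hpos w hw
    rw [h, Complex.ofReal_re, Complex.ofReal_log hr.le]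
  obtain ⟨r, hr, h⟩ := hpos z hz
  have h2 : HasFDerivAt (fun w => Complex.log (G w).det)
      ((G z).det⁻¹ • fderiv ℝ (fun w => (G w).det) z) z := by
    have hsp : (G z).det ∈ Complex.slitPlane := by
      rw [h]; exact Complex.ofReal_mem_slitPlane.2 hr
    have h3 := ((Complex.hasStrictDerivAt_log hsp).hasDerivAt.hasFDerivAt.restrictScalars ℝ).comp z
      (differentiableAt_det hd).hasFDerivAt
    exact h3.congr_fderiv (ContinuousLinearMap.ext fun v => by simp [mul_comm])
  have h4 : wirtinger l (fun w => Complex.log (G w).det) z =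
      (G z).det⁻¹ * wirtinger l (fun w => (G w).det) z := by
    rw [wirtinger, wirtinger, h2.fderiv]
    simp
    ring
  rw [wirtinger_congr h1, h4, wirtinger_det hd, Finset.mul_sum]
  refine Finset.sum_congr rfl fun i _ => ?_
  rw [Finset.mul_sum]
  refine Finset.sum_congr rfl fun j _ => ?_
  rw [Matrix.inv_def, Ring.inverse_eq_inv', Matrix.smul_apply, smul_eq_mul, mul_assoc]

end LogDet

section Potential

variable {n : ℕ} {M : Type*} [TopologicalSpace M] [ChartedSpace (Cn n) M]

namespace KahlerForm

variable (Ω : KahlerForm n M)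

/-- The gradient field `Yˡ = ∑ₖ gˡᵏ ∂̄ₖθ` in the chart `c`. -/
def gradient (θ : M → ℂ) (c : OpenPartialHomeomorph M (Cn n)) (z : Cn n) : Cn n :=
  Matrix.vecMul (fun k => wirtingerBar k (θ ∘ c.symm) z) (Ω.metricMatrix c z)⁻¹

variable {c : OpenPartialHomeomorph M (Cn n)} {θ : M → ℂ}

variable [IsManifold 𝓘(ℂ, Cn n) ω M]

theorem isUnit_det_metricMatrix (hc : c ∈ atlas (Cn n) M) {z : Cn n} (hz : z ∈ c.target) :
    IsUnit (Ω.metricMatrix c z).det := by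
  obtain ⟨r, hr, h⟩ := Ω.det_metricMatrix_pos hc hz
  rw [h]
  exact (Complex.ofReal_ne_zero.2 hr.ne').isUnit

theorem contDiffOn_inv_metricMatrix (hc : c ∈ atlas (Cn n) M) (i j : Fin n) :
    ContDiffOn ℝ ∞ (fun z => (Ω.metricMatrix c z)⁻¹ i j) c.target := by
  have h1 := ContDiffOn.matrix_det (Ω.contDiffOn_metricMatrix hc)
  have h2 := ContDiffOn.matrix_adjugate (Ω.contDiffOn_metricMatrix hc) i j
  refine ((h1.inv fun z hz => (Ω.isUnit_det_metricMatrix hc hz).ne_zero).mul h2).congr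
    fun z _ => ?_
  rw [Matrix.inv_def, Ring.inverse_eq_inv', Matrix.smul_apply, smul_eq_mul]
  rfl

theorem contDiffOn_gradient (hc : c ∈ atlas (Cn n) M) (hθ : ChartSmooth n θ) (l : Fin n) :
    ContDiffOn ℝ ∞ (fun z => Ω.gradient θ c z l) c.target := by
  simp only [gradient, Matrix.vecMul, dotProduct]
  exact ContDiffOn.sum fun k _ => ((hθ c hc).wirtingerBar c.open_target k).mul
    (Ω.contDiffOn_inv_metricMatrix hc k l)

theorem gradient_mul_metricMatrix (hc : c ∈ atlas (Cn n) M) {z : Cn n} (hz : z ∈ c.target)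
    (k : Fin n) : ∑ l, Ω.gradient θ c z l * Ω.metricMatrix c z l k =
      wirtingerBar k (θ ∘ c.symm) z := by
  have : Matrix.vecMul (Ω.gradient θ c z) (Ω.metricMatrix c z) =
      fun k => wirtingerBar k (θ ∘ c.symm) z := by
    rw [gradient, Matrix.vecMul_vecMul, Matrix.nonsing_inv_mul _ (Ω.isUnit_det_metricMatrix hc hz),
      Matrix.vecMul_one]
  exact congrFun this k

/-- The gradient of a potential of `X` is `X`. -/
theorem gradient_eq {X : ∀ x : M, TSpace n x} (hθ : Ω.IsPotentialOf X θ)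
    (hc : c ∈ atlas (Cn n) M) {z : Cn n} (hz : z ∈ c.target) :
    Ω.gradient θ c z = (jac c z)⁻¹.mulVec (toCn X (c.symm z)) := by
  have hJ : IsUnit (jac c z).det := (det_jac_ne_zero hc hz).isUnit
  set Y := (jac c z)⁻¹.mulVec (toCn X (c.symm z)) with hY
  have h1 : (jac c z).mulVec Y = toCn X (c.symm z) := by
    rw [hY, Matrix.mulVec_mulVec, Matrix.mul_nonsing_inv _ hJ, Matrix.one_mulVec]
  have h2 : Matrix.vecMul Y (Ω.metricMatrix c z) = fun k => wirtingerBar k (θ ∘ c.symm) z := by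
    rw [metricMatrix_eq, ← Matrix.vecMul_vecMul, ← Matrix.vecMul_vecMul, Matrix.vecMul_transpose,
      h1]
    funext k
    rw [wirtingerBar_chart hc (hθ.1.chartSmooth_of) hz]
    simp only [Matrix.vecMul, dotProduct, Matrix.map_apply, ← Ω.sum_gAt_mul hθ]
  rw [gradient, ← h2, Matrix.vecMul_vecMul,
    Matrix.mul_nonsing_inv _ (Ω.isUnit_det_metricMatrix hc hz), Matrix.vecMul_one]

theorem toCn_eq {X : ∀ x : M, TSpace n x} (hθ : Ω.IsPotentialOf X θ)
    (hc : c ∈ atlas (Cn n) M) {z : Cn n} (hz : z ∈ c.target) (a : Fin n) :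
    toCn X (c.symm z) a = ∑ j, jac c z a j * Ω.gradient θ c z j := by
  have hJ : IsUnit (jac c z).det := (det_jac_ne_zero hc hz).isUnit
  have : (jac c z).mulVec (Ω.gradient θ c z) = toCn X (c.symm z) := by
    rw [Ω.gradient_eq hθ hc hz, Matrix.mulVec_mulVec, Matrix.mul_nonsing_inv _ hJ,
      Matrix.one_mulVec]
  exact (congrFun this a).symm

theorem derivative_chart {X : ∀ x : M, TSpace n x} (hθ : Ω.IsPotentialOf X θ) {u : M → ℂ}
    (hu : ContMDiff 𝓘(ℝ, Cn n) 𝓘(ℝ, ℂ) ∞ u) (hc : c ∈ atlas (Cn n) M) {z : Cn n}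
    (hz : z ∈ c.target) : delValue u (c.symm z) (X (c.symm z)) =
      ∑ j, Ω.gradient θ c z j * wirtinger j (u ∘ c.symm) z := by
  have h0 : delValue u (c.symm z) (X (c.symm z)) =
      ∑ a, delAt u (c.symm z) a * toCn X (c.symm z) a := delValue_eq hu _ _
  rw [h0]
  simp only [Ω.toCn_eq hθ hc hz, wirtinger_chart hc hu.chartSmooth_of hz, Finset.mul_sum]
  rw [Finset.sum_comm]
  exact Finset.sum_congr rfl fun j _ => Finset.sum_congr rfl fun a _ => by ring

theorem chartSmooth_derivative {X : ∀ x : M, TSpace n x} (hθ : Ω.IsPotentialOf X θ) {u : M → ℂ}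
    (hu : ContMDiff 𝓘(ℝ, Cn n) 𝓘(ℝ, ℂ) ∞ u) : ChartSmooth n fun x => delValue u x (X x) := by
  intro c hc
  refine ContDiffOn.congr ?_ fun z hz => Ω.derivative_chart hθ hu hc hz
  exact ContDiffOn.sum fun j _ => (Ω.contDiffOn_gradient hc hθ.1.chartSmooth_of j).mul
    ((hu.chartSmooth_of c hc).wirtinger c.open_target j)

theorem laplacian_eq (u : M → ℂ) (x : M) :
    Ω.laplacian u x = ((Ω.gAt x)⁻¹ * hessAt u x).trace := by
  rw [laplacian, metricMatrix_chartAt]; rfl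

theorem laplacian_chart {u : M → ℂ} (hu : ChartSmooth n u) (hc : c ∈ atlas (Cn n) M) {z : Cn n}
    (hz : z ∈ c.target) : Ω.laplacian u (c.symm z) =
      ((Ω.metricMatrix c z)⁻¹ * complexHessian (u ∘ c.symm) z).trace := by
  have hm : ((jac c z).map (starRingEnd ℂ)).det = (starRingEnd ℂ) (jac c z).det :=
    ((starRingEnd ℂ).map_det (jac c z)).symm
  have hdet : (Ω.metricMatrix c z).det =
      (Complex.normSq (jac c z).det : ℂ) * (Ω.gAt (c.symm z)).det := by
    rw [metricMatrix_eq, Matrix.det_mul, Matrix.det_mul, Matrix.det_transpose, hm,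
      ← Complex.mul_conj]
    ring
  have hJ : (Complex.normSq (jac c z).det : ℂ) ≠ 0 := by
    exact_mod_cast (Complex.normSq_pos.2 (det_jac_ne_zero hc hz)).ne'
  rw [laplacian_eq, Matrix.inv_def, Matrix.inv_def, Ring.inverse_eq_inv',
    Matrix.smul_mul, Matrix.smul_mul, Matrix.trace_smul, Matrix.trace_smul, hdet,
    complexHessian_chart hc hu hz, metricMatrix_eq, Matrix.trace_adjugate_congr, smul_eq_mul,
    smul_eq_mul, mul_inv]
  field_simp

theorem chartSmooth_laplacian {u : M → ℂ} (hu : ChartSmooth n u) :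
    ChartSmooth n (Ω.laplacian u) := by
  intro c hc
  refine ContDiffOn.congr ?_ fun z hz => Ω.laplacian_chart hu hc hz
  simp only [Matrix.trace, Matrix.diag, Matrix.mul_apply]
  exact ContDiffOn.sum fun i _ => ContDiffOn.sum fun j _ =>
    (Ω.contDiffOn_inv_metricMatrix hc i j).mul
      (((hu c hc).wirtingerBar c.open_target i).wirtinger c.open_target j)

/-- `Δθ = ∑ᵢ ∂ᵢYⁱ + Y(log det g)` for the gradient `Y` of `θ`, because `Ω` is closed. -/
theorem laplacian_eq_divergence (hθ : ChartSmooth n θ) (hc : c ∈ atlas (Cn n) M) {z : Cn n}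
    (hz : z ∈ c.target) : Ω.laplacian θ (c.symm z) =
      ∑ i, wirtinger i (fun w => Ω.gradient θ c w i) z + ∑ l, Ω.gradient θ c z l *
        wirtinger l (fun w => (Real.log (Ω.metricMatrix c w).det.re : ℂ)) z := by
  have hY := fun l => (Ω.contDiffOn_gradient hc hθ l).differentiableAt_of_isOpen c.open_target hz
  have hG := fun i j => (Ω.contDiffOn_metricMatrix hc i j).differentiableAt_of_isOpen
    c.open_target hz
  have h1 : ∀ i k, complexHessian (θ ∘ c.symm) z i k =
      ∑ l, wirtinger i (fun w => Ω.gradient θ c w l) z * Ω.metricMatrix c z l k +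
        ∑ l, Ω.gradient θ c z l * wirtinger l (fun w => Ω.metricMatrix c w i k) z := by
    intro i k
    have e : wirtingerBar k (θ ∘ c.symm) =ᶠ[nhds z]
        fun w => ∑ l, Ω.gradient θ c w l * Ω.metricMatrix c w l k := by
      filter_upwards [c.open_target.mem_nhds hz] with w hw
      exact (Ω.gradient_mul_metricMatrix hc hw k).symm
    change wirtinger i (wirtingerBar k (θ ∘ c.symm)) z = _
    rw [wirtinger_congr e, wirtinger_sum _ _ fun l _ => (hY l).fun_mul (hG l k),
      ← Finset.sum_add_distrib]
    refine Finset.sum_congr rfl fun l _ => ?_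
    rw [wirtinger_mul i (hY l) (hG l k), Ω.wirtinger_metricMatrix_comm hc hz i l k]
  have h2 : ∀ i l, ∑ k, (Ω.metricMatrix c z) l k * (Ω.metricMatrix c z)⁻¹ k i =
      if l = i then 1 else 0 := by
    intro i l
    rw [← Matrix.mul_apply, Matrix.mul_nonsing_inv _ (Ω.isUnit_det_metricMatrix hc hz),
      Matrix.one_apply]
  rw [Ω.laplacian_chart hθ hc hz, Matrix.trace_mul_comm]
  simp only [Matrix.trace, Matrix.diag, Matrix.mul_apply, h1, add_mul, Finset.sum_add_distrib,
    Finset.sum_mul]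
  congr 1
  · refine Finset.sum_congr rfl fun i _ => ?_
    rw [Finset.sum_comm]
    simp only [mul_assoc, ← Finset.mul_sum, h2]
    simp
  · have h3 := fun l => wirtinger_log_det c.open_target (Ω.contDiffOn_metricMatrix hc)
      (fun z hz => Ω.det_metricMatrix_pos hc hz) hz l
    simp only [h3, Finset.mul_sum]
    have : ∀ f : Fin n → Fin n → Fin n → ℂ,
        ∑ i, ∑ k, ∑ l, f i k l = ∑ l, ∑ i, ∑ k, f i k l := by
      intro f
      rw [Finset.sum_comm' (t' := Finset.univ) (s' := fun _ => Finset.univ) (by simp)]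
      calc _ = ∑ k, ∑ l, ∑ i, f i k l := Finset.sum_congr rfl fun _ _ => Finset.sum_comm
        _ = ∑ l, ∑ k, ∑ i, f i k l := Finset.sum_comm
        _ = _ := Finset.sum_congr rfl fun _ _ => Finset.sum_comm
    rw [this]
    exact Finset.sum_congr rfl fun l _ => Finset.sum_congr rfl fun i _ =>
      Finset.sum_congr rfl fun k _ => by ring

end KahlerForm

end Potential

section RicciPotential

variable {n : ℕ} {M : Type*} [TopologicalSpace M] [ChartedSpace (Cn n) M]

namespace KahlerForm

theorem IsRicciPotential.contMDiff_ofReal {Ω : KahlerForm n M} {f : M → ℝ}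
    (hf : Ω.IsRicciPotential f) :
    ContMDiff 𝓘(ℝ, Cn n) 𝓘(ℝ, ℂ) ∞ fun x => (f x : ℂ) :=
  Complex.ofRealCLM.contDiff.contMDiff.comp hf.1

variable [IsManifold 𝓘(ℂ, Cn n) ω M]

variable (Ω : KahlerForm n M) {X : ∀ x : M, TSpace n x} {θ : M → ℂ} {f : M → ℝ}

theorem ricciMatrix_eq (hf : Ω.IsRicciPotential f) (x : M) :
    Ω.ricciMatrix (chartAt (Cn n) x) (chartAt (Cn n) x x) =
      Ω.gAt x + hessAt (fun y => (f y : ℂ)) x := by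
  have h1 : Ω.ricciForm x = Ω.toForm x + ddbar (fun y => (f y : ℂ)) x := by
    rw [← hf.2 x]; abel
  rw [toForm_eq] at h1
  have h2 : oneOneCn (Ω.ricciMatrix (chartAt (Cn n) x) (chartAt (Cn n) x x)) =
      oneOneCn (Ω.gAt x) + oneOneCn (hessAt (fun y => (f y : ℂ)) x) := h1
  rw [← oneOneCn_add] at h2
  exact oneOneCn_injective h2

variable (X f θ) in
/-- The function `X(f) + θ + Δθ`, which is locally constant if `θ` is a potential of the
holomorphic field `X` and `f` a Ricci potential. -/
def holomorphyDefect (x : M) : ℂ :=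
  delValue (fun y => (f y : ℂ)) x (X x) + θ x + Ω.laplacian θ x

theorem chartSmooth_holomorphyDefect (hθ : Ω.IsPotentialOf X θ) (hf : Ω.IsRicciPotential f) :
    ChartSmooth n (Ω.holomorphyDefect X θ f) := fun c hc =>
  ((Ω.chartSmooth_derivative hθ hf.contMDiff_ofReal c hc).add (hθ.1.chartSmooth_of c hc)).add
    (Ω.chartSmooth_laplacian hθ.1.chartSmooth_of c hc)

theorem eventually_differentiableAt_gradient (hX : IsHolomorphicVectorField X)
    (hθ : Ω.IsPotentialOf X θ) (p : M) : ∀ᶠ z in nhds (chartAt (Cn n) p p),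
      ∀ l, DifferentiableAt ℂ (fun w => Ω.gradient θ (chartAt (Cn n) p) w l) z := by
  have hs := (chartAt (Cn n) p).map_source (mem_chart_source (Cn n) p)
  have h1 := ((hX.contDiffAt p).of_le (m := 1) le_top).eventually (by simp)
  filter_upwards [h1, (chartAt (Cn n) p).open_target.mem_nhds hs] with z hz hzt l
  have h2 : Ω.gradient θ (chartAt (Cn n) p) =ᶠ[nhds z] fun z =>
      (jac (chartAt (Cn n) p) z)⁻¹.mulVec (toCn X ((chartAt (Cn n) p).symm z)) := by
    filter_upwards [(chartAt (Cn n) p).open_target.mem_nhds hzt] with w hw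
    exact Ω.gradient_eq hθ (chart_mem_atlas _ _) hw
  have h3 : DifferentiableAt ℂ (Ω.gradient θ (chartAt (Cn n) p)) z :=
    (hz.differentiableAt (by simp)).congr_of_eventuallyEq h2
  exact differentiableAt_pi.1 h3 l

/-- `∂̄(X(u)) = i(X) ∂∂̄u` for a holomorphic field `X`. -/
theorem delBarAt_derivative (hX : IsHolomorphicVectorField X) (hθ : Ω.IsPotentialOf X θ)
    {u : M → ℂ} (hu : ContMDiff 𝓘(ℝ, Cn n) 𝓘(ℝ, ℂ) ∞ u) (p : M) (k : Fin n) :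
    delBarAt (fun x => delValue u x (X x)) p k = ∑ j, toCn X p j * hessAt u p j k := by
  set c := chartAt (Cn n) p with hcdef
  have hc : c ∈ atlas (Cn n) M := chart_mem_atlas _ _
  have hs := mem_chart_source (Cn n) p
  have hz := c.map_source hs
  have hY := (Ω.eventually_differentiableAt_gradient hX hθ p).self_of_nhds
  have e : (fun x => delValue u x (X x)) ∘ c.symm =ᶠ[nhds (c p)]
      fun z => ∑ j, Ω.gradient θ c z j * wirtinger j (u ∘ c.symm) z := by
    filter_upwards [c.open_target.mem_nhds hz] with z hz
    exact Ω.derivative_chart hθ hu hc hz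
  have hw := fun j => ((hu.chartSmooth_of c hc).wirtinger c.open_target
    j).differentiableAt_of_isOpen c.open_target hz
  rw [delBarAt, wirtingerBar_congr e,
    wirtingerBar_sum _ _ fun j _ => ((hY j).restrictScalars ℝ).fun_mul (hw j)]
  refine Finset.sum_congr rfl fun j _ => ?_
  rw [wirtingerBar_mul k ((hY j).restrictScalars ℝ) (hw j), wirtingerBar_holomorphic k (hY j),
    zero_mul, zero_add, ← wirtinger_wirtingerBar_comm c.open_target (hu.chartSmooth_of c hc) hz]
  have h1 : toCn X p j = Ω.gradient θ c (c p) j := by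
    have := Ω.toCn_eq hθ hc hz j
    rw [c.left_inv hs, jac_chartAt] at this
    rw [this]
    simp [Matrix.one_apply]
  rw [h1]
  rfl

/-- `∂̄(X(f) + θ + Δθ) = 0`. -/
theorem delBarAt_holomorphyDefect (hX : IsHolomorphicVectorField X) (hθ : Ω.IsPotentialOf X θ)
    (hf : Ω.IsRicciPotential f) (p : M) (k : Fin n) :
    delBarAt (Ω.holomorphyDefect X θ f) p k = 0 := by
  set c := chartAt (Cn n) p with hcdef
  have hc : c ∈ atlas (Cn n) M := chart_mem_atlas _ _
  have hs := mem_chart_source (Cn n) p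
  have hz := c.map_source hs
  have hθs := hθ.1.chartSmooth_of
  have hYe : ∀ᶠ z in nhds (c p), ∀ l, DifferentiableAt ℂ (fun w => Ω.gradient θ c w l) z :=
    Ω.eventually_differentiableAt_gradient hX hθ p
  have hY : ∀ l, DifferentiableAt ℂ (fun w => Ω.gradient θ c w l) (c p) := hYe.self_of_nhds
  have hYs := fun l => Ω.contDiffOn_gradient hc hθs l
  set ℓ : Cn n → ℂ := fun w => (Real.log (Ω.metricMatrix c w).det.re : ℂ) with hℓ
  have hℓs : ContDiffOn ℝ ∞ ℓ c.target := contDiffOn_log_det (Ω.contDiffOn_metricMatrix hc)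
    fun z hz => Ω.det_metricMatrix_pos hc hz
  have hℓw := fun l => (hℓs.wirtinger c.open_target l).differentiableAt_of_isOpen c.open_target hz
  have hYw := fun l => ((hYs l).wirtinger c.open_target l).differentiableAt_of_isOpen
    c.open_target hz
  have hX' : ∀ j, toCn X p j = Ω.gradient θ c (c p) j := by
    intro j
    have := Ω.toCn_eq hθ hc hz j
    rw [c.left_inv hs, jac_chartAt] at this
    rw [this]
    simp [Matrix.one_apply]
  -- `∂̄` of `Δθ`, from the divergence formula and holomorphy of the gradient
  have hlap : delBarAt (Ω.laplacian θ) p k = -∑ l, toCn X p l *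
      Ω.ricciMatrix c (c p) l k := by
    have e : Ω.laplacian θ ∘ c.symm =ᶠ[nhds (c p)] fun z =>
        ∑ i, wirtinger i (fun w => Ω.gradient θ c w i) z +
          ∑ l, Ω.gradient θ c z l * wirtinger l ℓ z := by
      filter_upwards [c.open_target.mem_nhds hz] with z hz
      exact Ω.laplacian_eq_divergence hθs hc hz
    have h1 : ∀ i, wirtingerBar k (wirtinger i (fun w => Ω.gradient θ c w i)) (c p) = 0 := by
      intro i
      rw [← wirtinger_wirtingerBar_comm c.open_target (hYs i) hz]
      have : wirtingerBar k (fun w => Ω.gradient θ c w i) =ᶠ[nhds (c p)] fun _ => 0 :=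
        hYe.mono fun z hz => wirtingerBar_holomorphic k (hz i)
      rw [wirtinger_congr this, wirtinger_const]
    rw [delBarAt, wirtingerBar_congr e, wirtingerBar_add k (DifferentiableAt.fun_sum fun i _ => hYw i)
      (DifferentiableAt.fun_sum fun l _ => ((hY l).restrictScalars ℝ).fun_mul (hℓw l)),
      wirtingerBar_sum _ _ fun i _ => hYw i,
      wirtingerBar_sum _ _ fun l _ => ((hY l).restrictScalars ℝ).fun_mul (hℓw l)]
    rw [Finset.sum_eq_zero fun i _ => h1 i, zero_add, ← Finset.sum_neg_distrib]
    refine Finset.sum_congr rfl fun l _ => ?_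
    rw [wirtingerBar_mul k ((hY l).restrictScalars ℝ) (hℓw l), wirtingerBar_holomorphic k (hY l),
      zero_mul, zero_add, ← wirtinger_wirtingerBar_comm c.open_target hℓs hz, hX']
    simp [ricciMatrix, complexHessian, hℓ]
  have hd := fun {u : M → ℂ} (hu : ChartSmooth n u) =>
    (hu c hc).differentiableAt_of_isOpen c.open_target hz
  have hh := Ω.chartSmooth_derivative hθ hf.contMDiff_ofReal
  have hadd : delBarAt (Ω.holomorphyDefect X θ f) p k =
      delBarAt (fun x => delValue (fun y => (f y : ℂ)) x (X x)) p k + delBarAt θ p k +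
        delBarAt (Ω.laplacian θ) p k := by
    have h1 := wirtingerBar_add k (hd hh) (hd hθs)
    have h2 := wirtingerBar_add k ((hd hh).fun_add (hd hθs)) (hd (Ω.chartSmooth_laplacian hθs))
    rw [h1] at h2
    exact h2
  rw [hadd, Ω.delBarAt_derivative hX hθ hf.contMDiff_ofReal, hlap, ← Ω.sum_gAt_mul hθ,
    Ω.ricciMatrix_eq hf]
  simp only [Matrix.add_apply, mul_add, Finset.sum_add_distrib]
  ring

end KahlerForm

end RicciPotential

/-! ### The coefficients of `det (G + tS)` -/

section Pencil

variable {n : ℕ}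

/-- The coefficients of `det (G + t S)` are densities. -/
theorem pencil_congr (J G S : Matrix (Fin n) (Fin n) ℂ) :
    pencil (J.transpose * G * J.map (starRingEnd ℂ)) (J.transpose * S * J.map (starRingEnd ℂ)) =
      Polynomial.C (Complex.normSq J.det : ℂ) * pencil G S := by
  have hm : (J.map (starRingEnd ℂ)).det = (starRingEnd ℂ) J.det :=
    ((starRingEnd ℂ).map_det J).symm
  refine Polynomial.funext fun t => ?_
  rw [Polynomial.eval_mul, eval_pencil, eval_pencil, Polynomial.eval_C, ← Matrix.smul_mul,
    ← Matrix.mul_smul, ← Matrix.add_mul, ← Matrix.mul_add, Matrix.det_mul, Matrix.det_mul,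
    Matrix.det_transpose, hm, ← Complex.mul_conj]
  ring

theorem eval_derivative_pencil (G S : Matrix (Fin n) (Fin n) ℂ) (t : ℂ) :
    (Polynomial.derivative (pencil G S)).eval t = ((G + t • S).adjugate * S).trace := by
  have h1 := (pencil G S).hasDerivAt t
  have hB : ∀ i j, HasFDerivAt (fun t : ℂ => (G + t • S) i j)
      (ContinuousLinearMap.toSpanSingleton ℂ (S i j)) t := by
    intro i j
    have : HasDerivAt (fun t : ℂ => (G + t • S) i j) (S i j) t := by
      simpa using ((hasDerivAt_id t).mul_const (S i j)).const_add (G i j)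
    exact this.hasFDerivAt
  have h2 := (hasFDerivAt_det hB).hasDerivAt
  have h3 : (fun t : ℂ => (G + t • S).det) = fun t => (pencil G S).eval t :=
    funext fun t => (eval_pencil G S t).symm
  rw [h3] at h2
  rw [h1.unique h2, Matrix.trace_mul_comm]
  simp [Matrix.trace, Matrix.mul_apply, mul_comm]

theorem continuousOn_coeff_pencil {s : Set (Cn n)} {G S : Cn n → Matrix (Fin n) (Fin n) ℂ}
    (hG : ∀ i j, ContinuousOn (fun z => G z i j) s) (hS : ∀ i j, ContinuousOn (fun z => S z i j) s)
    (m : ℕ) : ContinuousOn (fun z => (pencil (G z) (S z)).coeff m) s := by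
  have hmul : ∀ {P Q : Cn n → Polynomial ℂ}, (∀ m, ContinuousOn (fun z => (P z).coeff m) s) →
      (∀ m, ContinuousOn (fun z => (Q z).coeff m) s) →
      ∀ m, ContinuousOn (fun z => (P z * Q z).coeff m) s := by
    intro P Q hP hQ m
    simp only [Polynomial.coeff_mul]
    exact continuousOn_finsetSum _ fun x _ => (hP _).mul (hQ _)
  have hprod : ∀ (t : Finset (Fin n)) (P : Fin n → Cn n → Polynomial ℂ),
      (∀ i m, ContinuousOn (fun z => (P i z).coeff m) s) →
      ∀ m, ContinuousOn (fun z => (∏ i ∈ t, P i z).coeff m) s := by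
    intro t P hP
    induction t using Finset.induction_on with
    | empty => intro m; simpa using continuousOn_const
    | insert a t ha ih =>
      simp only [Finset.prod_insert ha]
      exact hmul (hP a) ih
  simp only [pencil, Matrix.det_apply', Polynomial.finsetSum_coeff]
  refine continuousOn_finsetSum _ fun σ _ => hmul (fun m => ?_) (hprod _ _ fun i m => ?_) m
  · exact continuousOn_const
  · simp only [Matrix.add_apply, Matrix.smul_apply, Matrix.map_apply, smul_eq_mul,
      Polynomial.coeff_add, Polynomial.coeff_mul_C, Polynomial.coeff_C]
    refine ContinuousOn.add (continuousOn_const.mul (hS _ _)) ?_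
    · split_ifs
      · exact hG _ _
      · exact continuousOn_const

/-- The form of `G + S` in place of one of the factors, expanded in powers of the form of `S`. -/
theorem topCoeff_add_pow_mul (G S : Matrix (Fin n) (Fin n) ℂ) {k : ℕ} (hk : k ≤ n) :
    topCoeff n (oneOneCn (G + S) ^ k * oneOneCn G ^ (n - k)) =
      ∑ j ∈ Finset.range (k + 1), (k.choose j : ℂ) / n.choose j *
        ((n.factorial : ℂ) * ((Real.pi : ℂ)⁻¹) ^ n) * (pencil G S).coeff j := by
  rw [add_comm, oneOneCn_add, (commute_oneOneCn S G).add_pow, Finset.sum_mul, map_sum]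
  refine Finset.sum_congr rfl fun j hj => ?_
  have hjk : j ≤ k := Nat.lt_succ_iff.1 (Finset.mem_range.1 hj)
  have hne : (n.choose j : ℂ) ≠ 0 := by exact_mod_cast (Nat.choose_pos (hjk.trans hk)).ne'
  have h1 : oneOneCn S ^ j * oneOneCn G ^ (k - j) * (k.choose j : ℕ) * oneOneCn G ^ (n - k) =
      (k.choose j : ℂ) • (oneOneCn S ^ j * oneOneCn G ^ (n - j)) := by
    rw [show n - j = (k - j) + (n - k) by omega, pow_add, ← nsmul_eq_mul', smul_mul_assoc,
      mul_assoc, Nat.cast_smul_eq_nsmul]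
  rw [h1, map_smul, smul_eq_mul, div_mul_eq_mul_div, div_mul_eq_mul_div, eq_div_iff hne, mul_assoc,
    mul_comm (topCoeff n _), choose_mul_topCoeff G S (hjk.trans hk)]
  ring

end Pencil

/-- The combinatorial identity behind the theorem. With `qⱼ = (k choose j) / (n choose j)`, the weights
in the last sum satisfy `(n - k) (k+1 choose j+1) / (n choose j+1) = (k + 1) (qⱼ - qⱼ₊₁)`, and the
sums telescope. For `k = n`, `j = n` the left side is a division by zero and `a (n + 1) = 0` is
needed instead. -/
theorem sum_choose_div_choose {n k : ℕ} (hk : k ≤ n) {a d : ℕ → ℂ} (hd : d 0 = 0)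
    (hda : ∀ j, d (j + 1) = a (j + 2) - a (j + 1)) (ha : a (n + 1) = 0) :
    ((n : ℂ) - k) * a 0 + (k + 1) * ∑ j ∈ Finset.range (k + 1), (k.choose j : ℂ) / n.choose j * d j -
      ((n : ℂ) - k) * ∑ j ∈ Finset.range (k + 2), ((k + 1).choose j : ℂ) / n.choose j * a j =
      -((k + 1) * a 1) := by
  set q : ℕ → ℂ := fun j => (k.choose j : ℂ) / n.choose j with hq
  have h1 : ∀ j ∈ Finset.range (k + 1),
      ((n : ℂ) - k) * (((k + 1).choose (j + 1) : ℂ) / n.choose (j + 1) * a (j + 1)) =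
        (k + 1) * (q j - q (j + 1)) * a (j + 1) := by
    intro j hj
    have hjk : j ≤ k := Nat.lt_succ_iff.1 (Finset.mem_range.1 hj)
    rcases (hjk.trans hk).lt_or_eq with hjn | hjn
    · have e1 : (n.choose (j + 1) : ℂ) * (j + 1) = n.choose j * ((n : ℂ) - j) := by
        have := Nat.choose_succ_right_eq n j
        rw [← Nat.cast_sub hjn.le]
        exact_mod_cast this
      have e2 : (k.choose (j + 1) : ℂ) * (j + 1) = k.choose j * ((k : ℂ) - j) := by
        have := Nat.choose_succ_right_eq k j
        rw [← Nat.cast_sub hjk]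
        exact_mod_cast this
      have e3 : ((k + 1).choose (j + 1) : ℂ) * (j + 1) = (k + 1) * k.choose j := by
        exact_mod_cast (Nat.add_one_mul_choose_eq k j).symm
      have n1 : (n.choose (j + 1) : ℂ) ≠ 0 := by exact_mod_cast (Nat.choose_pos hjn).ne'
      have n2 : (n.choose j : ℂ) ≠ 0 := by exact_mod_cast (Nat.choose_pos hjn.le).ne'
      have n3 : (j + 1 : ℂ) ≠ 0 := by exact_mod_cast Nat.succ_ne_zero j
      have e4 : (n.choose (j + 1) : ℂ) = n.choose j * ((n : ℂ) - j) / (j + 1) := by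
        rw [eq_div_iff n3, e1]
      have e5 : (k.choose (j + 1) : ℂ) = k.choose j * ((k : ℂ) - j) / (j + 1) := by
        rw [eq_div_iff n3, e2]
      have e6 : ((k + 1).choose (j + 1) : ℂ) = (k + 1) * k.choose j / (j + 1) := by
        rw [eq_div_iff n3, e3]
      have n4 : (n : ℂ) - j ≠ 0 := by
        rw [← Nat.cast_sub hjn.le]
        exact_mod_cast (Nat.sub_pos_of_lt hjn).ne'
      simp only [hq]
      rw [e4, e5, e6]
      field_simp
      ring
    · rw [hjn, ha]; simp
  have h2 : ((n : ℂ) - k) *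
      ∑ j ∈ Finset.range (k + 2), ((k + 1).choose j : ℂ) / n.choose j * a j =
      ((n : ℂ) - k) * a 0 + (k + 1) * ∑ j ∈ Finset.range (k + 1), (q j - q (j + 1)) * a (j + 1) := by
    rw [Finset.sum_range_succ', mul_add, Finset.mul_sum, Finset.sum_congr rfl h1, Finset.mul_sum]
    simp only [Nat.choose_zero_right, Nat.cast_one, div_one, one_mul, mul_assoc]
    ring
  have h3 : ∑ j ∈ Finset.range (k + 1), q j * d j =
      ∑ j ∈ Finset.range (k + 1), q j * (a (j + 1) - a j) - (a 1 - a 0) := by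
    rw [Finset.sum_range_succ', Finset.sum_range_succ' (fun j => q j * (a (j + 1) - a j))]
    simp [hd, hda, hq]
  have h4 : ∑ j ∈ Finset.range (k + 1), q j * (a (j + 1) - a j) -
      ∑ j ∈ Finset.range (k + 1), (q j - q (j + 1)) * a (j + 1) = -a 0 := by
    rw [← Finset.sum_sub_distrib]
    have := Finset.sum_range_sub (fun j => q j * a j) (k + 1)
    simp only [hq, Nat.choose_succ_self, Nat.cast_zero, zero_div, zero_mul, Nat.choose_zero_right,
      Nat.cast_one, div_one, one_mul, zero_sub] at this ⊢
    rw [← this]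
    exact Finset.sum_congr rfl fun j _ => by ring
  rw [h2, h3]
  linear_combination (k + 1 : ℂ) * h4

/-! ### Integrals against the mixed powers of `Ω` and `∂∂̄f` -/

section Integrals

variable {n : ℕ} {M : Type*} [TopologicalSpace M] [ChartedSpace (Cn n) M]

theorem contDensity_mul_coeff_pencil [IsManifold 𝓘(ℂ, Cn n) ω M] (Ω : KahlerForm n M)
    {F u : M → ℂ} (hF : ChartSmooth n F) (hu : ChartSmooth n u) (j : ℕ) :
    ContDensity n fun x => u x * (pencil (Ω.gAt x) (hessAt F x)).coeff j := by
  intro c hc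
  have hcont : ContinuousOn (fun z => u (c.symm z) * (pencil (Ω.metricMatrix c z)
      (complexHessian (F ∘ c.symm) z)).coeff j) c.target :=
    (hu c hc).continuousOn.mul (continuousOn_coeff_pencil
      (fun a b => (Ω.contDiffOn_metricMatrix hc a b).continuousOn)
      (fun a b => (((hF c hc).wirtingerBar c.open_target b).wirtinger
        c.open_target a).continuousOn) j)
  refine hcont.congr fun z hz => ?_
  simp only [chartDensity, complexHessian_chart hc hF hz, Ω.metricMatrix_eq, pencil_congr,
    Polynomial.coeff_C_mul]
  ring

theorem KahlerForm.trace_adjugate_mul_delBarMulDel (Ω : KahlerForm n M) (F u v : M → ℂ) (t : ℂ) (x : M) :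
    ((Ω.deformAt F t x).adjugate * delBarMulDel n u v x).trace =
      ((Ω.deformAt F t x).adjugate *
        Matrix.of fun j k : Fin n => delAt (n := n) v x j * delBarAt u x k).trace +
      u x * ((Ω.deformAt F t x).adjugate * hessAt v x).trace := by
  rw [delBarMulDel, Matrix.mul_add, Matrix.trace_add, Matrix.mul_smul, Matrix.trace_smul,
    smul_eq_mul]

variable [T2Space M] [CompactSpace M] [IsManifold 𝓘(ℂ, Cn n) ω M]

/-- A top degree form is integrated through the density of its coefficients. -/
theorem formIntegral_eq_densInt {η : ∀ x : M, FormAlg n x} {w : M → ℂ}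
    (h : ∀ c ∈ atlas (Cn n) M, ∀ z ∈ c.target, chartTopCoeff c η z = chartDensity c w z) :
    formIntegral η = densInt n w := by
  rw [formIntegral, densInt]
  refine finsum_congr fun p => ?_
  refine MeasureTheory.setIntegral_congr_fun (chartAt (Cn n) p).open_target.measurableSet
    fun z hz => ?_
  simp only [h _ (chart_mem_atlas _ _) z hz]

/-- A function `x ↦ Q x` with polynomial values, of bounded degree, whose integral vanishes at each
value of the variable, has coefficients with vanishing integral. -/
theorem densInt_coeff_eq_zero {Q : M → Polynomial ℂ} {N : ℕ} (hN : ∀ x, (Q x).natDegree < N)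
    (hQ : ∀ j, ContDensity n fun x => (Q x).coeff j)
    (h : ∀ t, densInt n (fun x => (Q x).eval t) = 0) {j : ℕ} (hj : j < N) :
    densInt n (fun x => (Q x).coeff j) = 0 := by
  have h1 : (∑ i ∈ Finset.range N, Polynomial.C (densInt n fun x => (Q x).coeff i) *
      Polynomial.X ^ i) = 0 := by
    refine Polynomial.funext fun t => ?_
    rw [Polynomial.eval_zero, ← h t, Polynomial.eval_finsetSum]
    have : (fun x => (Q x).eval t) = fun x => ∑ i ∈ Finset.range N, t ^ i * (Q x).coeff i := by
      funext x
      rw [Polynomial.eval_eq_sum_range' (hN x)]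
      exact Finset.sum_congr rfl fun _ _ => mul_comm _ _
    rw [this, densInt_sum _ fun i _ => (hQ i).const_mul _]
    refine Finset.sum_congr rfl fun i _ => ?_
    rw [densInt_const_mul, Polynomial.eval_mul, Polynomial.eval_C, Polynomial.eval_pow,
      Polynomial.eval_X, mul_comm]
  have h2 := congrArg (fun P => Polynomial.coeff P j) h1
  simpa [Polynomial.finsetSum_coeff, Polynomial.coeff_C_mul, Polynomial.coeff_X_pow, hj] using h2

namespace KahlerForm

variable (Ω : KahlerForm n M) {X : ∀ x : M, TSpace n x} {θ : M → ℂ} {f : M → ℝ}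

/-- The integral of `u` against the coefficient of `tʲ` in `det (g + t ∂∂̄F)`. -/
def coeffInt (F u : M → ℂ) (j : ℕ) : ℂ :=
  densInt n fun x => u x * (pencil (Ω.gAt x) (hessAt F x)).coeff j

/-- The forms `Ricᵏ ∧ Ωⁿ⁻ᵏ`, expanded in powers of `(√-1/2π) ∂∂̄f = Ric - Ω`. -/
theorem formIntegral_ricciForm_pow (hf : Ω.IsRicciPotential f) {u : M → ℂ}
    (hu : ChartSmooth n u) {k : ℕ} (hk : k ≤ n) :
    formIntegral (fun x => u x • (Ω.ricciForm x ^ k * Ω.toForm x ^ (n - k))) =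
      ((n.factorial : ℂ) * ((Real.pi : ℂ)⁻¹) ^ n) *
        ∑ j ∈ Finset.range (k + 1), (k.choose j : ℂ) / n.choose j *
          Ω.coeffInt (fun y => (f y : ℂ)) u j := by
  set F : M → ℂ := fun y => (f y : ℂ) with hF
  have hFs : ChartSmooth n F := hf.contMDiff_ofReal.chartSmooth_of
  set κ : ℂ := (n.factorial : ℂ) * ((Real.pi : ℂ)⁻¹) ^ n with hκ
  have hcd := fun j => contDensity_mul_coeff_pencil Ω hFs hu j
  rw [formIntegral_eq_densInt (w := fun x => κ * ∑ j ∈ Finset.range (k + 1),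
    (k.choose j : ℂ) / n.choose j * (u x * (pencil (Ω.gAt x) (hessAt F x)).coeff j)),
    densInt_const_mul, densInt_sum _ fun j _ => (hcd j).const_mul _]
  · simp only [densInt_const_mul, coeffInt]
  intro c hc z hz
  have h1 : chartTopCoeff c (fun x => u x • (Ω.ricciForm x ^ k * Ω.toForm x ^ (n - k))) z =
      u (c.symm z) * topCoeff n (oneOneCn ((jac c z).transpose * Ω.gAt (c.symm z) *
        (jac c z).map (starRingEnd ℂ) + (jac c z).transpose * hessAt F (c.symm z) *
        (jac c z).map (starRingEnd ℂ)) ^ k * oneOneCn ((jac c z).transpose * Ω.gAt (c.symm z) *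
        (jac c z).map (starRingEnd ℂ)) ^ (n - k)) := by
    rw [chartTopCoeff, map_smul, map_smul, map_mul, map_pow, map_pow, ricciForm,
      Ω.ricciMatrix_eq hf, toForm_eq, map_oneOneForm, map_oneOneForm, Matrix.mul_add,
      Matrix.add_mul, smul_eq_mul]
  rw [h1, topCoeff_add_pow_mul _ _ hk, pencil_congr, chartDensity]
  simp only [Polynomial.coeff_C_mul, Finset.mul_sum]
  refine Finset.sum_congr rfl fun j _ => ?_
  ring

theorem coeffInt_eq_zero (F u : M → ℂ) {j : ℕ} (hj : n < j) : Ω.coeffInt F u j = 0 := by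
  have h : (fun x => u x * (pencil (Ω.gAt x) (hessAt F x)).coeff j) = fun x => 0 * u x := by
    funext x
    rw [Polynomial.coeff_eq_zero_of_natDegree_lt ((natDegree_pencil_le _ _).trans_lt hj), mul_zero,
      zero_mul]
  rw [coeffInt, h, densInt_const_mul, zero_mul]

/-- Stokes' theorem for `∂̄(u ∂F)` with `u = θ + t X(F)`, whose `∂̄` is the contraction of `X` with
`g + t ∂∂̄F`. -/
theorem coeffInt_derivative_add (hX : IsHolomorphicVectorField X) (hθ : Ω.IsPotentialOf X θ)
    {F : M → ℂ} (hF : ContMDiff 𝓘(ℝ, Cn n) 𝓘(ℝ, ℂ) ∞ F) (j : ℕ) :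
    Ω.coeffInt F (fun x => delValue F x (X x)) j + Ω.coeffInt F θ (j + 1) = 0 := by
  have hFs := hF.chartSmooth_of
  have hθs := hθ.1.chartSmooth_of
  set h : M → ℂ := fun x => delValue F x (X x) with hh
  have hhs : ChartSmooth n h := Ω.chartSmooth_derivative hθ hF
  set P : M → Polynomial ℂ := fun x => pencil (Ω.gAt x) (hessAt F x) with hP
  have hPd : ∀ x, (P x).natDegree ≤ n := fun x => natDegree_pencil_le _ _
  set Q : M → Polynomial ℂ := fun x => Polynomial.derivative
    (Polynomial.C (h x) * (Polynomial.X * P x) + Polynomial.C (θ x) * P x) with hQ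
  have hcoeff : ∀ x j, (Q x).coeff j =
      (j + 1 : ℂ) * (h x * (P x).coeff j + θ x * (P x).coeff (j + 1)) := by
    intro x j
    simp only [hQ, Polynomial.coeff_derivative, Polynomial.coeff_add, Polynomial.coeff_C_mul,
      Polynomial.coeff_X_mul]
    ring
  have hc1 := fun j => contDensity_mul_coeff_pencil Ω hFs hhs j
  have hc2 := fun j => contDensity_mul_coeff_pencil Ω hFs hθs j
  rcases le_or_gt j n with hj | hj
  · have key : densInt n (fun x => (Q x).coeff j) = 0 := by
      refine densInt_coeff_eq_zero (N := n + 1) (fun x => ?_) (fun j => ?_) (fun t => ?_)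
        (Nat.lt_succ_of_le hj)
      · rw [Nat.lt_succ_iff, Polynomial.natDegree_le_iff_coeff_eq_zero]
        intro i hi
        rw [hcoeff, Polynomial.coeff_eq_zero_of_natDegree_lt ((hPd x).trans_lt hi),
          Polynomial.coeff_eq_zero_of_natDegree_lt ((hPd x).trans_lt (hi.trans (Nat.lt_succ_self i)))]
        simp
      · simp only [hcoeff]
        exact ((hc1 j).add (hc2 (j + 1))).const_mul _
      · have hu : ChartSmooth n fun x => θ x + t * h x := fun c hc =>
          (hθs c hc).add (contDiffOn_const.mul (hhs c hc))
        rw [← Ω.densInt_divergence hFs hu hFs t]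
        congr 1
        funext x
        have hdb : ∀ k : Fin n, delBarAt (n := n) (fun x => θ x + t * h x) x k =
            ∑ j, toCn X x j * Ω.deformAt F t x j k := by
          intro k
          have hz := (chartAt (Cn n) x).map_source (mem_chart_source (Cn n) x)
          have hd := fun {u : M → ℂ} (hu : ChartSmooth n u) =>
            (hu _ (chart_mem_atlas _ x)).differentiableAt_of_isOpen (chartAt _ x).open_target hz
          have h1 : delBarAt (n := n) (fun x => θ x + t * h x) x k =
              delBarAt θ x k + t * delBarAt h x k := by
            refine (wirtingerBar_add k (hd hθs) ((hd hhs).const_mul t)).trans ?_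
            rw [wirtingerBar_const_mul k t (hd hhs)]
            rfl
          rw [h1, ← Ω.sum_gAt_mul hθ, Ω.delBarAt_derivative hX hθ hF, Finset.mul_sum,
            ← Finset.sum_add_distrib]
          refine Finset.sum_congr rfl fun j _ => ?_
          simp only [deformAt, Matrix.add_apply, Matrix.smul_apply, smul_eq_mul]
          ring
        have htr : ((Ω.deformAt F t x).adjugate *
            Matrix.of fun (j k : Fin n) => delAt F x j * delBarAt (n := n) (fun x => θ x + t * h x) x k).trace =
            (Ω.deformAt F t x).det * h x := by
          have h1 : (Matrix.of fun j k : Fin n => delAt F x j *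
              delBarAt (n := n) (fun x => θ x + t * h x) x k) =
              Matrix.vecMulVec (delAt F x) (toCn X x) * Ω.deformAt F t x := by
            ext j k
            simp only [Matrix.of_apply, hdb, Matrix.mul_apply, Matrix.vecMulVec_apply,
              Finset.mul_sum, mul_assoc]
          have h2 : h x = ∑ a, delAt F x a * toCn X x a := delValue_eq hF _ _
          rw [h1, ← mul_assoc, Matrix.trace_mul_comm, ← mul_assoc, Matrix.mul_adjugate,
            Matrix.smul_mul, one_mul, Matrix.trace_smul, smul_eq_mul, h2]
          rfl
        have hdet : (Ω.deformAt F t x).det = (P x).eval t := (eval_pencil _ _ _).symm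
        have hder : ((Ω.deformAt F t x).adjugate * hessAt F x).trace =
            (Polynomial.derivative (P x)).eval t := (eval_derivative_pencil _ _ _).symm
        rw [trace_adjugate_mul_delBarMulDel, htr, hdet, hder]
        simp [hQ]
        ring
    have h1 : (fun x => (Q x).coeff j) = fun x =>
        (j + 1 : ℂ) * (h x * (P x).coeff j + θ x * (P x).coeff (j + 1)) :=
      funext fun x => hcoeff x j
    rw [h1, densInt_const_mul, densInt_add (hc1 j) (hc2 (j + 1))] at key
    exact (mul_eq_zero.1 key).resolve_left (by exact_mod_cast Nat.succ_ne_zero j)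
  · rw [Ω.coeffInt_eq_zero _ _ hj, Ω.coeffInt_eq_zero _ _ (hj.trans (Nat.lt_succ_self j)), add_zero]

/-- A function with `∂̄u = 0` integrates to zero against `(∂∂̄F)ʲ⁺¹ ∧ Ωⁿ⁻ʲ⁻¹`. -/
theorem coeffInt_of_delBarAt_eq_zero {F u : M → ℂ} (hF : ChartSmooth n F) (hu : ChartSmooth n u)
    (hdb : ∀ x (k : Fin n), delBarAt u x k = 0) (j : ℕ) : Ω.coeffInt F u (j + 1) = 0 := by
  set P : M → Polynomial ℂ := fun x => pencil (Ω.gAt x) (hessAt F x) with hP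
  have hPd : ∀ x, (P x).natDegree ≤ n := fun x => natDegree_pencil_le _ _
  have hcoeff : ∀ x j, (Polynomial.derivative (Polynomial.C (u x) * P x)).coeff j =
      (j + 1 : ℂ) * (u x * (P x).coeff (j + 1)) := by
    intro x j
    simp only [Polynomial.coeff_derivative, Polynomial.coeff_C_mul]
    ring
  have hc := fun j => contDensity_mul_coeff_pencil Ω hF hu j
  rcases le_or_gt j n with hj | hj
  · have key : densInt n
        (fun x => (Polynomial.derivative (Polynomial.C (u x) * P x)).coeff j) = 0 := by
      refine densInt_coeff_eq_zero (N := n + 1) (fun x => ?_) (fun j => ?_) (fun t => ?_)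
        (Nat.lt_succ_of_le hj)
      · rw [Nat.lt_succ_iff, Polynomial.natDegree_le_iff_coeff_eq_zero]
        intro i hi
        rw [hcoeff, Polynomial.coeff_eq_zero_of_natDegree_lt
          ((hPd x).trans_lt (hi.trans (Nat.lt_succ_self i)))]
        simp
      · simp only [hcoeff]
        exact (hc (j + 1)).const_mul _
      · rw [← Ω.densInt_divergence hF hu hF t]
        congr 1
        funext x
        have hder : ((Ω.deformAt F t x).adjugate * hessAt F x).trace =
            (Polynomial.derivative (P x)).eval t := (eval_derivative_pencil _ _ _).symm
        have h0 : (Matrix.of fun (j k : Fin n) => delAt (n := n) F x j * delBarAt u x k) = 0 := by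
          ext j k
          simp [hdb]
        rw [trace_adjugate_mul_delBarMulDel, hder, h0]
        simp
    simp only [hcoeff] at key
    rw [densInt_const_mul] at key
    exact (mul_eq_zero.1 key).resolve_left (by exact_mod_cast Nat.succ_ne_zero j)
  · exact Ω.coeffInt_eq_zero _ _ (hj.trans (Nat.lt_succ_self j))

/-- `∫ Δv Ωⁿ = 0`. -/
theorem coeffInt_laplacian_zero (F : M → ℂ) {v : M → ℂ} (hv : ChartSmooth n v) :
    Ω.coeffInt F (Ω.laplacian v) 0 = 0 := by
  have hone : ChartSmooth n fun _ : M => (1 : ℂ) := fun c _ => contDiffOn_const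
  rw [coeffInt, ← Ω.densInt_divergence (f := fun _ => 0) (fun c _ => contDiffOn_const) hone hv 0]
  congr 1
  funext x
  obtain ⟨r, hr, hdet⟩ := Ω.det_gAt_pos x
  have hne : (Ω.gAt x).det ≠ 0 := by rw [hdet]; exact_mod_cast hr.ne'
  have h0 : (Matrix.of fun j k => delAt (n := n) v x j * delBarAt (n := n) (fun _ : M => (1 : ℂ)) x k) = 0 := by
    ext j k
    have : delBarAt (n := n) (fun _ : M => (1 : ℂ)) x k = 0 := wirtingerBar_const _ _
    simp [this]
  rw [trace_adjugate_mul_delBarMulDel, h0, Polynomial.coeff_zero_eq_eval_zero, eval_pencil,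
    laplacian_eq, Matrix.inv_def, Ring.inverse_eq_inv', deformAt, zero_smul, zero_smul, add_zero,
    Matrix.smul_mul, Matrix.trace_smul, smul_eq_mul]
  field_simp
  simp

/-- On `(∂∂̄f)ʲ⁺¹ ∧ Ωⁿ⁻ʲ⁻¹`, the function `Δθ` integrates as `-θ - X(f)`. -/
theorem coeffInt_laplacian_succ (hX : IsHolomorphicVectorField X) (hθ : Ω.IsPotentialOf X θ)
    (hf : Ω.IsRicciPotential f) (j : ℕ) :
    Ω.coeffInt (fun y => (f y : ℂ)) (Ω.laplacian θ) (j + 1) =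
      Ω.coeffInt (fun y => (f y : ℂ)) θ (j + 2) - Ω.coeffInt (fun y => (f y : ℂ)) θ (j + 1) := by
  set F : M → ℂ := fun y => (f y : ℂ) with hF
  have hFs : ChartSmooth n F := hf.contMDiff_ofReal.chartSmooth_of
  have hθs := hθ.1.chartSmooth_of
  have hhs : ChartSmooth n fun x => delValue F x (X x) :=
    Ω.chartSmooth_derivative hθ hf.contMDiff_ofReal
  have h1 := Ω.coeffInt_of_delBarAt_eq_zero hFs (Ω.chartSmooth_holomorphyDefect hθ hf)
    (Ω.delBarAt_holomorphyDefect hX hθ hf) j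
  have h2 := Ω.coeffInt_derivative_add hX hθ hf.contMDiff_ofReal (j + 1)
  have h3 : Ω.coeffInt F (Ω.holomorphyDefect X θ f) (j + 1) =
      Ω.coeffInt F (fun x => delValue F x (X x)) (j + 1) + Ω.coeffInt F θ (j + 1) +
        Ω.coeffInt F (Ω.laplacian θ) (j + 1) := by
    have c1 := contDensity_mul_coeff_pencil Ω hFs hhs (j + 1)
    have c2 := contDensity_mul_coeff_pencil Ω hFs hθs (j + 1)
    have c3 := contDensity_mul_coeff_pencil Ω hFs (Ω.chartSmooth_laplacian hθs) (j + 1)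
    simp only [coeffInt, holomorphyDefect, add_mul]
    rw [densInt_add (c1.add c2) c3, densInt_add c1 c2]
  linear_combination h1 - h2 - h3

end KahlerForm

end Integrals

end

theorem theorem1p2 (n : ℕ) {M : Type*} [TopologicalSpace M] [T2Space M] [CompactSpace M]
    [ChartedSpace (Cn n) M] [IsManifold 𝓘(ℂ, Cn n) ω M]
    (Ω : KahlerForm n M) (hΩ : Ω.RepresentsFirstChernClass)
    (f : M → ℝ) (hf : Ω.IsRicciPotential f)
    (X : ∀ x : M, TSpace n x) (hX : IsHolomorphicVectorField X)
    (θ : M → ℂ) (hθ : Ω.IsPotentialOf X θ)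
    (k : ℕ) (hk : k ≤ n) :
    Ω.chenTian θ k = (k + 1) * Ω.futaki X f := by
  have hθs := hθ.1.chartSmooth_of
  have hF := hf.contMDiff_ofReal
  set F : M → ℂ := fun y => (f y : ℂ) with hFdef
  have hhs : ChartSmooth n fun x => delValue F x (X x) := Ω.chartSmooth_derivative hθ hF
  have hvol : ∀ {u : M → ℂ}, ChartSmooth n u → formIntegral (fun x => u x • Ω.toForm x ^ n) =
      ((n.factorial : ℂ) * ((Real.pi : ℂ)⁻¹) ^ n) * Ω.coeffInt F u 0 := by
    intro u hu
    simpa using Ω.formIntegral_ricciForm_pow hf hu (Nat.zero_le n)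
  have h1 := Ω.formIntegral_ricciForm_pow hf (Ω.chartSmooth_laplacian hθs) hk
  -- for `k = n` the last form has degree `2n + 2`, and its coefficient is `0`
  have h2 : ((n : ℂ) - k) * formIntegral
        (fun x => θ x • (Ω.ricciForm x ^ (k + 1) * Ω.toForm x ^ (n - k - 1))) =
      ((n : ℂ) - k) * (((n.factorial : ℂ) * ((Real.pi : ℂ)⁻¹) ^ n) *
        ∑ j ∈ Finset.range (k + 2), ((k + 1).choose j : ℂ) / n.choose j * Ω.coeffInt F θ j) := by
    rcases hk.lt_or_eq with h | h
    · rw [Nat.sub_sub, Ω.formIntegral_ricciForm_pow hf hθs h]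
    · rw [h, sub_self, zero_mul, zero_mul]
  have h3 := sum_choose_div_choose hk (a := Ω.coeffInt F θ) (d := Ω.coeffInt F (Ω.laplacian θ))
    (Ω.coeffInt_laplacian_zero F hθs) (Ω.coeffInt_laplacian_succ hX hθ hf)
    (Ω.coeffInt_eq_zero F θ (Nat.lt_succ_self n))
  have h4 := Ω.coeffInt_derivative_add hX hθ hF 0
  rw [KahlerForm.chenTian, KahlerForm.futaki, hvol hθs, h1, h2, hvol hhs]
  linear_combination ((n.factorial : ℂ) * ((Real.pi : ℂ)⁻¹) ^ n) * h3 -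
    (k + 1 : ℂ) * ((n.factorial : ℂ) * ((Real.pi : ℂ)⁻¹) ^ n) * h4
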